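/- Let $k$ be a field and let $Q$ be a locally finite quiver (only finitely many arrows start, and only finitely many arrows end, at each vertex), with vertex set $Q_0$; paths are composed from right to left. Let $R$ be a quadratic ideal of the path algebra $kQ$, that is, an ideal generated by linear combinations of parallel paths of length two (from a vertex $x$ to a vertex $y$), and put $\Lambda=kQ/R$. Write $e_x$ for the class of the trivial path at $x$, $\bar\gamma$ for the class of $\gamma\in kQ$, $J$ for the ideal of $\Lambda$ generated by the arrows, and $\Lambda_n$ for the span of the classes of the paths of length $n$. Assume that $\Lambda$ is locally finite dimensional: $e_y\Lambda e_x$ is finite dimensional for all $x,y\in Q_0$. Modules are left $\Lambda$-modules $M$ with $M=\sum_{x} e_xM$. For $a\in Q_0$ put $P_a=\Lambda e_a$, graded by the subspaces $\Lambda_ne_a$, and $S_a=\Lambda e_a/Je_a$. Let $I_a$ be the module with $e_xI_a=\mathrm{Hom}_k(e_a\Lambda e_x,k)$ and $(uf)(v)=f(vu)$ for $u\in e_y\Lambda e_x$, $f\in e_xI_a$, $v\in e_a\Lambda e_y$; for $u\in e_b\Lambda e_a$ let $I[u]:I_b\to I_a$ be the morphism given by $I[u](f)(v)=f(uv)$ for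 $v\in e_a\Lambda e_x$, $f\in e_xI_b$. The algebra $\Lambda$ is called Koszul if every simple $\Lambda$-module $S$ admits a linear projective resolution, that is, an exact sequence $\cdots\to P^{-2}\to P^{-1}\to P^0\to S\to 0$ in which each $P^{-n}$ is a finite direct sum of modules $P_x$, the kernel of the morphism starting at $P^{-n}$ is contained in $JP^{-n}$ for all $n\ge 0$, and the morphisms $P^{-n-1}\to P^{-n}$ are homogeneous of degree one. Let $\Lambda^{\rm o}=kQ^{\rm o}/R^{\rm o}$ be the opposite algebra, where $Q^{\rm o}$ is the opposite quiver, $\gamma\mapsto\gamma^{\rm o}$ is the canonical anti-isomorphism $kQ\to kQ^{\rm o}$ and $R^{\rm o}=\{\rho^{\rm o}\mid\rho\in R\}$. Let $\Lambda^!=kQ^{\rm o}/R^!$ be the quadratic dual, where $R^!$ is the ideal generated by the elements $\rho^{\rm o}$, with $\rho=\sum_p\lambda_p\,p$ a linear combination of paths of length two from $x$ to $y$ ($x,y\in Q_0$) such that $\sum_p\lambda_p\mu_p=0$ for every linear combination $\sum_p\mu_p\,p\in R$ of such paths. For $a\in Q_0$ let $T_a^\bullet$ be the sequence with $$T_a^n=\bigoplus_{x\in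 Q_0} I_x\otimes_k e_x\Lambda^!_ne_a\quad(n\ge 0),$$ whose differential $d^n:T_a^n\to T_a^{n+1}$ has the components $$\sum_{\alpha:y\to x} I[\bar\alpha]\otimes(\alpha^{\rm o}\cdot-)\;:\; I_x\otimes e_x\Lambda^!_ne_a\to I_y\otimes e_y\Lambda^!_{n+1}e_a,$$ where the sum runs over the arrows $\alpha:y\to x$ of $Q$ and $\alpha^{\rm o}\cdot-$ is the left multiplication by the class of $\alpha^{\rm o}$ in $\Lambda^!$. The following statements are equivalent. 1. The algebra $\Lambda$ is Koszul. 2. The opposite algebra $\Lambda^{\rm o}$ is Koszul. 3. For each $a\in Q_0$, the sequence $T_a^\bullet$ is an injective co-resolution of $S_a$: all $T_a^n$ are injective $\Lambda$-modules and there is an exact sequence $0\to S_a\to T_a^0\xrightarrow{d^0}T_a^1\xrightarrow{d^1}T_a^2\to\cdots$. -/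

import Mathlib

open scoped TensorProduct DirectSum

universe u v w w' w'' i

/-- A quiver is locally finite if only finitely many arrows start, and only finitely many arrows
end, at each vertex. -/
class Quiver.LocallyFinite (Q : Type u) [Quiver.{v + 1} Q] : Prop where
  finite_star : ∀ x : Q, Finite (Quiver.Star x)
  finite_costar : ∀ x : Q, Finite (Quiver.Costar x)

noncomputable section

/-! ### Path algebras

The path algebra `kQ` is the direct sum of the spaces `kQ(x, y)` of linear combinations of paths
from `x` to `y`; we work with these pieces. Products are read from right to left, as for maps. -/

/-- The space `kQ(x, y)` with basis the paths from `x` to `y`. -/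
abbrev PathSpace (k : Type w) [Field k] {Q : Type u} [Quiver.{v + 1} Q] (x y : Q) :
    Type (max u (v + 1) w) :=
  Quiver.Path x y →₀ k

namespace PathSpace

variable {k : Type w} [Field k] {Q : Type u} [Quiver.{v + 1} Q]

/-- The product `γ δ` in the path algebra, for `γ ∈ kQ(y, z)` and `δ ∈ kQ(x, y)`; on paths it is
concatenation (`δ` first, then `γ`). -/
def mul {x y z : Q} : PathSpace k y z →ₗ[k] PathSpace k x y →ₗ[k] PathSpace k x z :=
  Finsupp.linearCombination k fun p => Finsupp.lmapDomain k k fun q => q.comp p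

@[simp]
theorem mul_single {x y z : Q} (p : Quiver.Path y z) (q : Quiver.Path x y) (c d : k) :
    mul (Finsupp.single p c) (Finsupp.single q d) = Finsupp.single (q.comp p) (c * d) := by
  simp [mul]

theorem mul_assoc {x y z t : Q} (γ : PathSpace k z t) (δ : PathSpace k y z)
    (ε : PathSpace k x y) : mul (mul γ δ) ε = mul γ (mul δ ε) := by
  induction γ using Finsupp.induction_linear with
  | zero => simp
  | add _ _ h₁ h₂ => simp [h₁, h₂]
  | single p c =>
    induction δ using Finsupp.induction_linear with
    | zero => simp
    | add _ _ h₁ h₂ => simp [h₁, h₂]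
    | single q d =>
      induction ε using Finsupp.induction_linear with
      | zero => simp
      | add _ _ h₁ h₂ => simp only [map_add, h₁, h₂]
      | single r e => simp only [mul_single, Quiver.Path.comp_assoc, _root_.mul_assoc]

/-- The trivial path at `x`. -/
def one (x : Q) : PathSpace k x x := Finsupp.single Quiver.Path.nil 1

@[simp]
theorem one_mul {x y : Q} (γ : PathSpace k x y) : mul (one y) γ = γ := by
  induction γ using Finsupp.induction_linear with
  | zero => simp
  | add _ _ h₁ h₂ => simp [h₁, h₂]
  | single p c => simp [one]

@[simp]
theorem mul_one {x y : Q} (γ : PathSpace k x y) : mul γ (one x) = γ := by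
  induction γ using Finsupp.induction_linear with
  | zero => simp
  | add _ _ h₁ h₂ => simp [h₁, h₂]
  | single p c => simp [one]

/-- An arrow as an element of the path algebra. -/
def arrow {x y : Q} (α : x ⟶ y) : PathSpace k x y := Finsupp.single α.toPath 1

/-- The space `kQ_n(x, y)` of linear combinations of paths of length `n` from `x` to `y`. -/
def deg (n : ℕ) (x y : Q) : Submodule k (PathSpace k x y) :=
  Finsupp.supported k k {p | p.length = n}

theorem arrow_mul_mem_deg {x y z : Q} {n : ℕ} (α : y ⟶ z) {γ : PathSpace k x y}
    (hγ : γ ∈ deg n x y) : mul (arrow α) γ ∈ deg (n + 1) x z := by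
  have h : mul (arrow α) γ = Finsupp.mapDomain (fun q => q.comp α.toPath) γ := by
    simp [mul, arrow]
  classical
  rw [h, deg, Finsupp.mem_supported]
  intro p hp
  obtain ⟨q, hq, rfl⟩ := Finset.mem_image.1 (Finsupp.mapDomain_support hp)
  have := (Finsupp.mem_supported k γ).1 hγ hq
  simpa [Quiver.Hom.toPath] using this

end PathSpace

/-! ### The opposite quiver -/

/-- A path in the opposite quiver, read backwards as a path in the original quiver. -/
def Quiver.Path.unopPath {Q : Type u} [Quiver.{v + 1} Q] {a : Qᵒᵖ} :
    ∀ {b : Qᵒᵖ}, Quiver.Path a b → Quiver.Path b.unop a.unop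
  | _, .nil => .nil
  | _, .cons p e => (Quiver.Hom.toPath e.unop).comp p.unopPath

theorem Quiver.Path.unopPath_comp {Q : Type u} [Quiver.{v + 1} Q] {a b c : Qᵒᵖ}
    (p : Quiver.Path a b) (q : Quiver.Path b c) :
    (p.comp q).unopPath = q.unopPath.comp p.unopPath := by
  induction q with
  | nil => simp [unopPath]
  | cons q e ih => simp [unopPath, ih]

namespace PathSpace

variable {k : Type w} [Field k] {Q : Type u} [Quiver.{v + 1} Q]

/-- The inverse of the anti-isomorphism `γ ↦ γᵒ` from `kQ` to `kQᵒ`. -/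
def unop {a b : Qᵒᵖ} : PathSpace k a b →ₗ[k] PathSpace k b.unop a.unop :=
  Finsupp.lmapDomain k k Quiver.Path.unopPath

theorem unop_mul {a b c : Qᵒᵖ} (γ : PathSpace k b c) (δ : PathSpace k a b) :
    unop (mul γ δ) = mul (unop δ) (unop γ) := by
  induction γ using Finsupp.induction_linear with
  | zero => simp
  | add _ _ h₁ h₂ => simp [h₁, h₂]
  | single p c =>
    induction δ using Finsupp.induction_linear with
    | zero => simp
    | add _ _ h₁ h₂ => simp [h₁, h₂]
    | single q d =>
      simp only [unop, mul_single, Finsupp.lmapDomain_apply, Finsupp.mapDomain_single,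
        Quiver.Path.unopPath_comp, mul_comm]

end PathSpace

/-! ### Ideals of the path algebra and the algebra `Λ = kQ/R` -/

/-- A two-sided ideal `R` of the path algebra `kQ`. Since `kQ` is spanned by paths and contains the
trivial paths, such an ideal is the direct sum of the subspaces `R(x, y) = R ∩ kQ(x, y)`, and these
are exactly the families of subspaces closed under multiplication from both sides. -/
structure PathIdeal (k : Type w) [Field k] (Q : Type u) [Quiver.{v + 1} Q] where
  /-- The subspace `R(x, y)` of `kQ(x, y)`. -/
  carrier : ∀ x y : Q, Submodule k (PathSpace k x y)
  mul_mem_left : ∀ {x y z : Q} (γ : PathSpace k y z) {ρ : PathSpace k x y},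
    ρ ∈ carrier x y → PathSpace.mul γ ρ ∈ carrier x z
  mul_mem_right : ∀ {x y z : Q} {ρ : PathSpace k y z} (δ : PathSpace k x y),
    ρ ∈ carrier y z → PathSpace.mul ρ δ ∈ carrier x z

namespace PathIdeal

variable {k : Type w} [Field k] {Q : Type u} [Quiver.{v + 1} Q]

/-- The ideal generated by a set of relations: its `(x, y)`-part is spanned by all `ζ ρ δ` with
`ρ ∈ S(b, c)`, `δ ∈ kQ(x, b)` and `ζ ∈ kQ(c, y)`. -/
def span (S : ∀ x y : Q, Set (PathSpace k x y)) : PathIdeal k Q where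
  carrier x y := Submodule.span k
    {σ | ∃ (b c : Q) (ζ : PathSpace k c y) (ρ : PathSpace k b c) (δ : PathSpace k x b),
      ρ ∈ S b c ∧ σ = PathSpace.mul ζ (PathSpace.mul ρ δ)}
  mul_mem_left {x y z} γ ρ hρ := by
    induction hρ using Submodule.span_induction with
    | mem σ h =>
      obtain ⟨b, c, ζ, ρ, δ, hρ, rfl⟩ := h
      exact Submodule.subset_span
        ⟨b, c, PathSpace.mul γ ζ, ρ, δ, hρ, (PathSpace.mul_assoc _ _ _).symm⟩
    | zero => simp
    | add _ _ _ _ h₁ h₂ => simpa using add_mem h₁ h₂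
    | smul c _ _ h => simpa using Submodule.smul_mem _ c h
  mul_mem_right {x y z} ρ δ' hρ := by
    induction hρ using Submodule.span_induction with
    | mem σ h =>
      obtain ⟨b, c, ζ, ρ, δ, hρ, rfl⟩ := h
      refine Submodule.subset_span ⟨b, c, ζ, ρ, PathSpace.mul δ δ', hρ, ?_⟩
      simp [PathSpace.mul_assoc]
    | zero => simp
    | add _ _ _ _ h₁ h₂ => simpa using add_mem h₁ h₂
    | smul c _ _ h => simpa using Submodule.smul_mem _ c h

/-- `R` is quadratic if it is generated by relations that are linear combinations of paths of
length two. -/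
def IsQuadratic (R : PathIdeal k Q) : Prop :=
  ∃ S : ∀ x y : Q, Set (PathSpace k x y), (∀ x y, ∀ ρ ∈ S x y, ρ ∈ PathSpace.deg 2 x y) ∧ R = span S

/-- The ideal `Rᵒ = {ρᵒ | ρ ∈ R}` of `kQᵒ`; the opposite algebra of `kQ/R` is `kQᵒ/Rᵒ`. -/
def op (R : PathIdeal k Q) : PathIdeal k Qᵒᵖ where
  carrier a b := (R.carrier b.unop a.unop).comap PathSpace.unop
  mul_mem_left γ ρ hρ := by
    simpa [PathSpace.unop_mul] using R.mul_mem_right (PathSpace.unop γ) hρ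
  mul_mem_right δ hρ := by
    simpa [PathSpace.unop_mul] using R.mul_mem_left (PathSpace.unop δ) hρ

/-- The ideal `R^!` of `kQᵒ`; the quadratic dual of `kQ/R` is `kQᵒ/R^!`. It is generated by the
elements `ρᵒ`, `ρ` a linear combination of paths of length two from `x` to `y`, such that the
linear form `ρ^*` (in terms of the basis dual to the paths) vanishes on `R ∩ kQ_2(x, y)`. -/
def quadraticDual (R : PathIdeal k Q) : PathIdeal k Qᵒᵖ :=
  span fun a b => {γ | γ ∈ PathSpace.deg 2 a b ∧
    ∀ σ ∈ R.carrier b.unop a.unop, σ ∈ PathSpace.deg 2 b.unop a.unop →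
      (PathSpace.unop γ).sum (fun p c => c * σ p) = 0}

variable (R : PathIdeal k Q)

/-- The space `e_y Λ e_x = kQ(x, y) / R(x, y)`, where `Λ = kQ/R`. -/
abbrev Alg (x y : Q) : Type (max u (v + 1) w) := PathSpace k x y ⧸ R.carrier x y

/-- The class in `Λ` of an element of the path algebra. -/
abbrev cls {x y : Q} : PathSpace k x y →ₗ[k] R.Alg x y := (R.carrier x y).mkQ

/-- The multiplication of `Λ`. -/
def mul {x y z : Q} : R.Alg y z →ₗ[k] R.Alg x y →ₗ[k] R.Alg x z :=
  Submodule.liftQ _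
    (LinearMap.flip (Submodule.liftQ _
      (LinearMap.flip (PathSpace.mul.compr₂ R.cls)) (by
        intro δ hδ
        apply LinearMap.ext
        intro γ
        exact (Submodule.Quotient.mk_eq_zero _).2 (R.mul_mem_left γ hδ))))
    (by
      intro γ hγ
      apply LinearMap.ext
      intro f
      obtain ⟨δ, rfl⟩ := Submodule.mkQ_surjective _ f
      exact (Submodule.Quotient.mk_eq_zero _).2 (R.mul_mem_right δ hγ))

@[simp]
theorem mul_cls {x y z : Q} (γ : PathSpace k y z) (δ : PathSpace k x y) :
    R.mul (R.cls γ) (R.cls δ) = R.cls (PathSpace.mul γ δ) := rfl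

theorem mul_assoc {x y z t : Q} (f : R.Alg z t) (g : R.Alg y z) (h : R.Alg x y) :
    R.mul (R.mul f g) h = R.mul f (R.mul g h) := by
  obtain ⟨f, rfl⟩ := Submodule.mkQ_surjective _ f
  obtain ⟨g, rfl⟩ := Submodule.mkQ_surjective _ g
  obtain ⟨h, rfl⟩ := Submodule.mkQ_surjective _ h
  simp only [mul_cls, PathSpace.mul_assoc]

@[simp]
theorem one_mul {x y : Q} (f : R.Alg x y) : R.mul (R.cls (PathSpace.one y)) f = f := by
  obtain ⟨f, rfl⟩ := Submodule.mkQ_surjective _ f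
  simp only [mul_cls, PathSpace.one_mul]

@[simp]
theorem mul_one {x y : Q} (f : R.Alg x y) : R.mul f (R.cls (PathSpace.one x)) = f := by
  obtain ⟨f, rfl⟩ := Submodule.mkQ_surjective _ f
  simp only [mul_cls, PathSpace.mul_one]

/-- The class `ᾱ` in `e_y Λ e_x` of an arrow `α : x ⟶ y`. -/
def arrow {x y : Q} (α : x ⟶ y) : R.Alg x y := R.cls (PathSpace.arrow α)

/-- `Λ` is locally finite dimensional: all the spaces `e_y Λ e_x` are finite dimensional. -/
def IsLocallyFiniteDimensional : Prop := ∀ x y : Q, FiniteDimensional k (R.Alg x y)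

/-- The subspace `e_y Λ_n e_x` of `e_y Λ e_x` spanned by the classes of the paths of length `n`. -/
def algDeg (n : ℕ) (x y : Q) : Submodule k (R.Alg x y) := (PathSpace.deg n x y).map R.cls

/-- Left multiplication by the class of an arrow `α : y ⟶ z`, from `e_y Λ_n e_x` to
`e_z Λ_{n+1} e_x`. -/
def arrowMulDeg (n : ℕ) (x : Q) {y z : Q} (α : y ⟶ z) :
    R.algDeg n x y →ₗ[k] R.algDeg (n + 1) x z :=
  (R.mul (R.arrow α)).restrict (by
    rintro _ ⟨γ, hγ, rfl⟩
    exact ⟨_, PathSpace.arrow_mul_mem_deg α hγ, rfl⟩)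

end PathIdeal

/-! ### Modules as representations of the bound quiver -/

/-- The action of a path on a family of vector spaces and linear maps indexed by a quiver. -/
def Quiver.Path.eval {k : Type w} [Field k] {Q : Type u} [Quiver.{v + 1} Q] {M : Q → Type w'}
    [∀ x, AddCommGroup (M x)] [∀ x, Module k (M x)] (f : ∀ {x y : Q}, (x ⟶ y) → M x →ₗ[k] M y)
    {x : Q} : ∀ {y : Q}, Quiver.Path x y → M x →ₗ[k] M y
  | _, .nil => LinearMap.id
  | _, .cons p α => f α ∘ₗ p.eval f

/-- The action of an element of the path algebra, extending the action of paths linearly. -/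
def PathSpace.eval {k : Type w} [Field k] {Q : Type u} [Quiver.{v + 1} Q] {M : Q → Type w'}
    [∀ x, AddCommGroup (M x)] [∀ x, Module k (M x)] (f : ∀ {x y : Q}, (x ⟶ y) → M x →ₗ[k] M y)
    {x y : Q} : PathSpace k x y →ₗ[k] M x →ₗ[k] M y :=
  Finsupp.linearCombination k fun p => p.eval f

/-- If linear maps commute with the action of the arrows, they commute with the action of the path
algebra. -/
theorem PathSpace.eval_natural {k : Type w} [Field k] {Q : Type u} [Quiver.{v + 1} Q]
    {M : Q → Type w'} [∀ x, AddCommGroup (M x)] [∀ x, Module k (M x)]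
    {N : Q → Type w''} [∀ x, AddCommGroup (N x)] [∀ x, Module k (N x)]
    (f : ∀ {x y : Q}, (x ⟶ y) → M x →ₗ[k] M y) (g : ∀ {x y : Q}, (x ⟶ y) → N x →ₗ[k] N y)
    (φ : ∀ x, M x →ₗ[k] N x)
    (h : ∀ {x y : Q} (α : x ⟶ y) (m : M x), g α (φ x m) = φ y (f α m))
    {x y : Q} (γ : PathSpace k x y) (m : M x) :
    PathSpace.eval g γ (φ x m) = φ y (PathSpace.eval f γ m) := by
  induction γ using Finsupp.induction_linear with
  | zero => simp
  | add _ _ h₁ h₂ => simp [h₁, h₂]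
  | single p c =>
    have hp : p.eval g (φ x m) = φ _ (p.eval f m) := by
      induction p with
      | nil => rfl
      | cons p α ih => simp [Quiver.Path.eval, ih, h]
    simp [PathSpace.eval, hp]

/-- A module over `Λ = kQ/R` (always: a unitary left module), given as a representation of the
bound quiver `(Q, R)`: vector spaces `M(x) = e_x M` and linear maps `M(α)`, the multiplications by
the arrows, such that every element of `R` acts as zero. -/
structure BoundRep {k : Type w} [Field k] {Q : Type u} [Quiver.{v + 1} Q]
    (R : PathIdeal k Q) where
  /-- The vector space at a vertex. -/
  obj : Q → Type w'
  [addCommGroup : ∀ x, AddCommGroup (obj x)]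
  [module : ∀ x, Module k (obj x)]
  /-- The linear map of an arrow. -/
  map : ∀ {x y : Q}, (x ⟶ y) → obj x →ₗ[k] obj y
  eval_eq_zero : ∀ {x y : Q} (ρ : PathSpace k x y), ρ ∈ R.carrier x y →
    PathSpace.eval map ρ = 0

attribute [instance] BoundRep.addCommGroup BoundRep.module

namespace BoundRep

variable {k : Type w} [Field k] {Q : Type u} [Quiver.{v + 1} Q] {R : PathIdeal k Q}

/-- A morphism of modules. -/
structure Hom (M : BoundRep.{u, v, w, w'} R) (N : BoundRep.{u, v, w, w''} R) where
  /-- The linear map at a vertex. -/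
  app : ∀ x : Q, M.obj x →ₗ[k] N.obj x
  naturality : ∀ {x y : Q} (α : x ⟶ y) (m : M.obj x),
    app y (M.map α m) = N.map α (app x m)

/-- A family of subspaces is a submodule if it is stable under the arrows. -/
def IsSubrep (M : BoundRep.{u, v, w, w'} R) (N : ∀ x : Q, Submodule k (M.obj x)) : Prop :=
  ∀ {x y : Q} (α : x ⟶ y), N x ≤ (N y).comap (M.map α)

/-- A module is simple if it is nonzero and has no submodules but zero and itself. -/
def IsSimple (M : BoundRep.{u, v, w, w'} R) : Prop :=
  (∃ x, Nontrivial (M.obj x)) ∧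
    ∀ N : ∀ x : Q, Submodule k (M.obj x), M.IsSubrep N → (∀ x, N x = ⊥) ∨ (∀ x, N x = ⊤)

/-- A module is injective if every morphism into it extends along every monomorphism. -/
def IsInjective (M : BoundRep.{u, v, w, w'} R) : Prop :=
  ∀ (X Y : BoundRep.{u, v, w, w'} R) (j : X.Hom Y), (∀ x, Function.Injective (j.app x)) →
    ∀ f : X.Hom M, ∃ g : Y.Hom M, ∀ x (m : X.obj x), g.app x (j.app x m) = f.app x m

/-- The submodule `JM`, where `J` is the ideal of `Λ` generated by the arrows. At a vertex `y` it
is the sum of the images of all arrows ending at `y`. -/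
def rad (M : BoundRep.{u, v, w, w'} R) (y : Q) : Submodule k (M.obj y) :=
  ⨆ α : Quiver.Costar y, LinearMap.range (M.map α.2)

theorem map_mem_rad (M : BoundRep.{u, v, w, w'} R) {x y : Q} (α : x ⟶ y) (m : M.obj x) :
    M.map α m ∈ M.rad y :=
  le_iSup (fun α : Quiver.Costar y => LinearMap.range (M.map α.2)) ⟨x, α⟩ ⟨m, rfl⟩

/-- The quotient `M/JM`. -/
def top (M : BoundRep.{u, v, w, w'} R) : BoundRep.{u, v, w, w'} R where
  obj x := M.obj x ⧸ M.rad x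
  map {x y} α := Submodule.mapQ (M.rad x) (M.rad y) (M.map α) fun m _ => M.map_mem_rad α m
  eval_eq_zero {x y} ρ hρ := by
    apply LinearMap.ext
    intro m
    obtain ⟨m, rfl⟩ := Submodule.mkQ_surjective _ m
    rw [PathSpace.eval_natural M.map _ (fun x => (M.rad x).mkQ) (fun _ _ => rfl),
      M.eval_eq_zero ρ hρ]
    simp

/-- The tensor product `M ⊗ V` of a module with a vector space. -/
def tensor (M : BoundRep.{u, v, w, w'} R) (V : Type w'') [AddCommGroup V] [Module k V] :
    BoundRep.{u, v, w, max w' w''} R where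
  obj x := M.obj x ⊗[k] V
  map α := (M.map α).rTensor V
  eval_eq_zero {x y} ρ hρ := by
    apply TensorProduct.ext'
    intro m t
    have := PathSpace.eval_natural M.map (fun {x y} (α : x ⟶ y) => (M.map α).rTensor V)
      (fun x => (TensorProduct.mk k (M.obj x) V).flip t) (fun _ _ => by simp) ρ m
    rw [M.eval_eq_zero ρ hρ] at this
    simpa using this

/-- The direct sum of a family of modules. -/
def directSum {ι : Type i} (M : ι → BoundRep.{u, v, w, w'} R) :
    BoundRep.{u, v, w, max i w'} R where
  obj x := ⨁ j, (M j).obj x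
  map α := DFinsupp.mapRange.linearMap fun j => (M j).map α
  eval_eq_zero {x y} ρ hρ := by
    classical
    apply DirectSum.linearMap_ext
    intro j
    apply LinearMap.ext
    intro m
    have := PathSpace.eval_natural (M j).map
      (fun {x y} (α : x ⟶ y) => DFinsupp.mapRange.linearMap fun j => (M j).map α)
      (fun x => DirectSum.lof k ι (fun j => (M j).obj x) j)
      (fun α m => by simp [DirectSum.lof]) ρ m
    rw [(M j).eval_eq_zero ρ hρ] at this
    simpa using this

open Classical in
/-- The inclusion of a summand of a direct sum, at the vertex `x`. -/
def summand {ι : Type i} (M : ι → BoundRep.{u, v, w, w'} R) (j : ι) (x : Q) :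
    (M j).obj x →ₗ[k] (directSum M).obj x :=
  DirectSum.lof k ι (fun j => (M j).obj x) j

open Classical in
/-- The linear map on a direct sum, at the vertex `x`, given by linear maps on the summands. -/
def desc {ι : Type i} (M : ι → BoundRep.{u, v, w, w'} R) {x : Q} {V : Type w''} [AddCommGroup V]
    [Module k V] (φ : ∀ j, (M j).obj x →ₗ[k] V) : (directSum M).obj x →ₗ[k] V :=
  DirectSum.toModule k ι V φ

/-- The projection of a direct sum onto a summand, at the vertex `x`. -/
def component {ι : Type i} (M : ι → BoundRep.{u, v, w, w'} R) (j : ι) (x : Q) :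
    (directSum M).obj x →ₗ[k] (M j).obj x :=
  DirectSum.component k ι (fun j => (M j).obj x) j

theorem desc_summand {ι : Type i} (M : ι → BoundRep.{u, v, w, w'} R) {x : Q} {V : Type w''}
    [AddCommGroup V] [Module k V] (φ : ∀ j, (M j).obj x →ₗ[k] V) (j : ι) (m : (M j).obj x) :
    desc M φ (summand M j x m) = φ j m := by
  classical
  exact DirectSum.toModule_lof (M := fun j => (M j).obj x) k j m

theorem map_summand {ι : Type i} (M : ι → BoundRep.{u, v, w, w'} R) {x y : Q} (α : x ⟶ y) (j : ι)
    (m : (M j).obj x) :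
    (directSum M).map α (summand M j x m) = summand M j y ((M j).map α m) := by
  classical
  exact DFinsupp.mapRange_single (hf := fun i => map_zero ((M i).map α))

theorem directSum_ext {ι : Type i} (M : ι → BoundRep.{u, v, w, w'} R) {x : Q} {V : Type w''}
    [AddCommGroup V] [Module k V] {f g : (directSum M).obj x →ₗ[k] V}
    (h : ∀ j (m : (M j).obj x), f (summand M j x m) = g (summand M j x m)) : f = g := by
  classical
  exact DirectSum.linearMap_ext k fun j => LinearMap.ext (h j)

end BoundRep

namespace PathIdeal

variable {k : Type w} [Field k] {Q : Type u} [Quiver.{v + 1} Q] (R : PathIdeal k Q)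

/-- The projective module `P_a = Λ e_a`. -/
def proj (a : Q) : BoundRep.{u, v, w, max u (v + 1) w} R where
  obj x := R.Alg a x
  map α := R.mul (R.arrow α)
  eval_eq_zero {x y} ρ hρ := by
    apply LinearMap.ext
    intro f
    obtain ⟨δ, rfl⟩ := Submodule.mkQ_surjective _ f
    have hp : ∀ {z : Q} (p : Quiver.Path x z),
        p.eval (M := fun x => R.Alg a x) (fun α => R.mul (R.arrow α)) (R.cls δ) =
          R.cls (PathSpace.mul (Finsupp.single p 1) δ) := by
      intro z p
      induction p with
      | nil => exact congrArg R.cls (PathSpace.one_mul δ).symm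
      | cons p α ih =>
        rw [Quiver.Path.eval, LinearMap.comp_apply, ih, arrow, mul_cls, ← PathSpace.mul_assoc,
          PathSpace.arrow, PathSpace.mul_single, _root_.mul_one]
        rfl
    have key : ∀ γ : PathSpace k x y,
        PathSpace.eval (M := fun x => R.Alg a x) (fun α => R.mul (R.arrow α)) γ (R.cls δ) =
          R.cls (PathSpace.mul γ δ) := by
      intro γ
      induction γ using Finsupp.induction_linear with
      | zero => simp
      | add _ _ h₁ h₂ => simp only [map_add, LinearMap.add_apply, h₁, h₂]
      | single p c =>
        rw [← Finsupp.smul_single_one]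
        simp only [map_smul, LinearMap.smul_apply, ← hp]
        simp [PathSpace.eval]
    refine (key ρ).trans ?_
    exact (Submodule.Quotient.mk_eq_zero _).2 (R.mul_mem_right δ hρ)

/-- The simple module `S_a = Λ e_a / J e_a`. -/
def simple (a : Q) : BoundRep.{u, v, w, max u (v + 1) w} R := (R.proj a).top

/-- The module `I_a = D(Λᵒ e_a)`: one has `I_a(x) = Hom_k(e_a Λ e_x, k)` and `(u f)(v) = f(v u)`
for `u` in `e_y Λ e_x`, `f` in `I_a(x)` and `v` in `e_a Λ e_y`. -/
def inj (a : Q) : BoundRep.{u, v, w, max u (v + 1) w} R where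
  obj x := Module.Dual k (R.Alg x a)
  map α := (R.mul.flip (R.arrow α)).dualMap
  eval_eq_zero {x y} ρ hρ := by
    apply LinearMap.ext
    intro f
    apply LinearMap.ext
    intro g
    obtain ⟨δ, rfl⟩ := Submodule.mkQ_surjective _ g
    have hp : ∀ {z : Q} (p : Quiver.Path x z) (δ : PathSpace k z a),
        p.eval (M := fun x => Module.Dual k (R.Alg x a))
          (fun α => (R.mul.flip (R.arrow α)).dualMap) f (R.cls δ) =
          f (R.cls (PathSpace.mul δ (Finsupp.single p 1))) := by
      intro z p
      induction p with
      | nil => intro δ; exact congrArg (fun t => f (R.cls t)) (PathSpace.mul_one δ).symm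
      | cons p α ih =>
        intro δ
        rw [Quiver.Path.eval, LinearMap.comp_apply, LinearMap.dualMap_apply, LinearMap.flip_apply,
          arrow, mul_cls, ih, PathSpace.mul_assoc, PathSpace.arrow, PathSpace.mul_single,
          _root_.mul_one]
        rfl
    have key : ∀ γ : PathSpace k x y,
        PathSpace.eval (M := fun x => Module.Dual k (R.Alg x a))
          (fun α => (R.mul.flip (R.arrow α)).dualMap) γ f (R.cls δ) =
          f (R.cls (PathSpace.mul δ γ)) := by
      intro γ
      induction γ using Finsupp.induction_linear with
      | zero => simp
      | add _ _ h₁ h₂ => simp only [map_add, LinearMap.add_apply, h₁, h₂]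
      | single p c =>
        rw [← Finsupp.smul_single_one]
        simp only [map_smul, LinearMap.smul_apply, ← hp]
        simp [PathSpace.eval]
    refine (key ρ).trans ?_
    have h0 : R.cls (PathSpace.mul δ ρ) = 0 :=
      (Submodule.Quotient.mk_eq_zero _).2 (R.mul_mem_left δ hρ)
    rw [h0, map_zero]
    rfl

/-! ### Koszul algebras -/

/-- The direct sum of finitely many modules `P_{c i}`. -/
abbrev projSum {m : ℕ} (c : Fin m → Q) : BoundRep.{u, v, w, max u (v + 1) w} R :=
  BoundRep.directSum fun j => R.proj (c j)

/-- A morphism between finite direct sums of modules `P_x` is homogeneous of degree one if it sends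
elements of degree `n` to elements of degree `n + 1`; here `P_x = ⊕ Λ_n e_x` is graded by `n`. -/
def IsHomogeneousOfDegreeOne {m m' : ℕ} {c : Fin m → Q} {c' : Fin m' → Q}
    (d : (R.projSum c).Hom (R.projSum c')) : Prop :=
  ∀ (n : ℕ) (x : Q) (p : (R.projSum c).obj x),
    (∀ j, (BoundRep.component _ j x p : R.Alg (c j) x) ∈ R.algDeg n (c j) x) →
      ∀ j, (BoundRep.component _ j x (d.app x p) : R.Alg (c' j) x) ∈ R.algDeg (n + 1) (c' j) x

/-- The module `M` admits a linear projective resolution: there is an exact sequence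
`⋯ → P^{-2} → P^{-1} → P^0 → M → 0`, in which the `P^{-n}` are finite direct sums of modules `P_x`,
each morphism co-restricts to a projective `J`-cover of its image (that is, the kernel of a morphism
starting at `P^{-n}` lies in `J P^{-n}`), and the morphisms between the `P^{-n}` are homogeneous of
degree one. -/
def HasLinearProjectiveResolution (M : BoundRep.{u, v, w, max u (v + 1) w} R) : Prop :=
  ∃ (m : ℕ → ℕ) (c : ∀ n, Fin (m n) → Q)
    (d : ∀ n, (R.projSum (c (n + 1))).Hom (R.projSum (c n)))
    (ε : (R.projSum (c 0)).Hom M),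
    (∀ x, Function.Surjective (ε.app x)) ∧
    (∀ x, Function.Exact ((d 0).app x) (ε.app x)) ∧
    (∀ n x, Function.Exact ((d (n + 1)).app x) ((d n).app x)) ∧
    (∀ x, LinearMap.ker (ε.app x) ≤ (R.projSum (c 0)).rad x) ∧
    (∀ n x, LinearMap.ker ((d n).app x) ≤ (R.projSum (c (n + 1))).rad x) ∧
    (∀ n, R.IsHomogeneousOfDegreeOne (d n))

/-- The algebra `Λ = kQ/R` is Koszul: every simple `Λ`-module admits a linear projective
resolution. -/
def IsKoszul : Prop :=
  ∀ S : BoundRep.{u, v, w, max u (v + 1) w} R, S.IsSimple → R.HasLinearProjectiveResolution S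

/-! ### The complexes `T_a` -/

/-- The linear map `I[u] : I_b(x) → I_a(x)` for `u` in `e_b Λ e_a`: one has `I[u](f)(v) = f(u v)`
for `f` in `I_b(x)` and `v` in `e_a Λ e_x`. -/
def injMap {a b : Q} (u : R.Alg a b) (x : Q) : (R.inj b).obj x →ₗ[k] (R.inj a).obj x :=
  LinearMap.dualMap (R.mul u : R.Alg x a →ₗ[k] R.Alg x b)

theorem injMap_naturality {a b : Q} (u : R.Alg a b) {x y : Q} (α : x ⟶ y)
    (f : (R.inj b).obj x) :
    R.injMap u y ((R.inj b).map α f) = (R.inj a).map α (R.injMap u x f) := by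
  apply LinearMap.ext
  intro v
  exact congrArg (show Module.Dual k (R.Alg x b) from f) (R.mul_assoc u v (R.arrow α))

/-- The module `I_x ⊗ e_x Λ^!_n e_a`. -/
def coresSummand (a : Q) (n : ℕ) (x : Q) : BoundRep.{u, v, w, max u (v + 1) w} R :=
  (R.inj x).tensor (R.quadraticDual.algDeg n (Opposite.op a) (Opposite.op x))

/-- The module `T_a^n = ⊕_x I_x ⊗ e_x Λ^!_n e_a`. -/
abbrev coresObj (a : Q) (n : ℕ) : BoundRep.{u, v, w, max u (v + 1) w} R :=
  BoundRep.directSum (R.coresSummand a n)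

/-- The linear map `I[ᾱ] ⊗ P_a^!(αᵒ) : I_x ⊗ e_x Λ^!_n e_a → I_y ⊗ e_y Λ^!_{n+1} e_a` belonging to
an arrow `α : y ⟶ x`, at the vertex `z`; here `P_a^!(αᵒ)` is the left multiplication by the class
of `αᵒ` in `Λ^!`. -/
def coresDiffArrow (a : Q) (n : ℕ) {x y : Q} (α : y ⟶ x) (z : Q) :
    (R.coresSummand a n x).obj z →ₗ[k] (R.coresSummand a (n + 1) y).obj z :=
  TensorProduct.map (R.injMap (R.arrow α) z)
    (R.quadraticDual.arrowMulDeg n (Opposite.op a) α.op)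

theorem coresDiffArrow_naturality (a : Q) (n : ℕ) {x y : Q} (α : y ⟶ x) {z t : Q} (β : z ⟶ t)
    (m : (R.coresSummand a n x).obj z) :
    R.coresDiffArrow a n α t ((R.coresSummand a n x).map β m) =
      (R.coresSummand a (n + 1) y).map β (R.coresDiffArrow a n α z m) := by
  suffices h : R.coresDiffArrow a n α t ∘ₗ (R.coresSummand a n x).map β =
      (R.coresSummand a (n + 1) y).map β ∘ₗ R.coresDiffArrow a n α z from LinearMap.congr_fun h m
  apply TensorProduct.ext'
  intro f v
  exact congrArg (fun g => g ⊗ₜ[k] _) (R.injMap_naturality (R.arrow α) β f)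

/-- The differential `T_a^n → T_a^{n+1}` at the vertex `z`: on the summand belonging to `x` it is
the sum of the maps `I[ᾱ] ⊗ P_a^!(αᵒ)` over all (finitely many) arrows `α` ending at `x`. -/
def coresDiffApp (a : Q) (n : ℕ) (z : Q) :
    (R.coresObj a n).obj z →ₗ[k] (R.coresObj a (n + 1)).obj z :=
  BoundRep.desc _ fun x => ∑ᶠ α : Quiver.Costar x,
    BoundRep.summand (R.coresSummand a (n + 1)) α.1 z ∘ₗ R.coresDiffArrow a n α.2 z

/-- The differential `T_a^n → T_a^{n+1}` as a morphism of modules. -/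
def coresDiff [Quiver.LocallyFinite Q] (a : Q) (n : ℕ) :
    (R.coresObj a n).Hom (R.coresObj a (n + 1)) where
  app z := R.coresDiffApp a n z
  naturality {z t} β m := by
    suffices h : R.coresDiffApp a n t ∘ₗ (R.coresObj a n).map β =
        (R.coresObj a (n + 1)).map β ∘ₗ R.coresDiffApp a n z from LinearMap.congr_fun h m
    apply BoundRep.directSum_ext
    intro x m
    have := Quiver.LocallyFinite.finite_costar x
    have := Fintype.ofFinite (Quiver.Costar x)
    rw [LinearMap.comp_apply, LinearMap.comp_apply, BoundRep.map_summand, coresDiffApp,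
      coresDiffApp, BoundRep.desc_summand, BoundRep.desc_summand, finsum_eq_sum_of_fintype,
      finsum_eq_sum_of_fintype, LinearMap.sum_apply, LinearMap.sum_apply, map_sum]
    refine Finset.sum_congr rfl fun α _ => ?_
    rw [LinearMap.comp_apply, LinearMap.comp_apply, coresDiffArrow_naturality,
      BoundRep.map_summand]

end PathIdeal

namespace BoundRep

variable {k : Type w} [Field k] {Q : Type u} [Quiver.{v + 1} Q] {R : PathIdeal k Q}

/-- The sequence `T^0 → T^1 → ⋯` is an injective co-resolution of `M`: all `T^n` are injective, and
there is an exact sequence `0 → M → T^0 → T^1 → ⋯` with the given morphisms between the `T^n`. -/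
def IsInjectiveCoresolution (M : BoundRep.{u, v, w, w'} R) (T : ℕ → BoundRep.{u, v, w, w'} R)
    (d : ∀ n, (T n).Hom (T (n + 1))) : Prop :=
  (∀ n, (T n).IsInjective) ∧
    ∃ ι : M.Hom (T 0), (∀ x, Function.Injective (ι.app x)) ∧
      (∀ x, Function.Exact (ι.app x) ((d 0).app x)) ∧
      ∀ n x, Function.Exact ((d n).app x) ((d (n + 1)).app x)

end BoundRep

end

/-! For vertices b and z consider the complex with terms ∏ₛ Hom_k(e_s Λ e_z, e_s Λ^!_n e_b) and
differential φ ↦ (u ↦ ∑ αᵒ φ(ᾱu)), the sum running over the arrows α that start at s. Let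
`DualExact` be its exactness in positive degrees n, for all b and z. The proof passes through this
property: Λ Koszul ⇒ `DualExact` ⇒ Λᵒ Koszul, and `DualExact` is the third condition.

Third condition. The spaces e_s Λ e_z are finite dimensional and Λ^!_n e_b lives at finitely many
vertices, so T_b^n at the vertex z is the n-th term above (`coresToHom_bijective`,
`coresToHom_diff`). Thus T_b^n is coinduced from vector spaces, hence injective, and the kernel of
d^0 is always S_b. Only exactness in positive degrees is left (`isInjectiveCoresolution_iff`).

Λ Koszul ⇒ `DualExact`. The differential lowers the degree of the argument in Λ by one, so the
complex splits into strands, treated by induction on the degree j in Λ. For j = 0 exactness says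
that Λ^! is generated by arrows; for j = 1 it says that the relations of Λ^! are generated by the
quadratic forms orthogonal to R. For larger j, map a linear resolution of a simple module into Λ^!
e_b. This gives a bicomplex whose resolution direction is exact in positive internal degree, and
whose Koszul direction is exact one degree lower by induction; a diagram chase
(`exact_of_bicomplex`) gives the next degree (`exactAt_add_two`). Local finite dimensionality allows
the solutions on the strands to be added up (`exists_algCodiff_eq`).

`DualExact` ⇒ Λᵒ Koszul. Bases of the spaces Λ^!_n e_a index finite direct sums of projective
Λᵒ-modules, and the matrices of the arrows acting on Λ^! e_a define maps between them with entries
spanned by arrows. The k-dual of this sequence at a vertex z is the complex above, so the sequence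
is exact; it is linear and minimal because its entries have degree one
(`IsKoszulDual.hasLinearProjectiveResolution`). By local finite dimensionality every simple module
is one-dimensional with zero action of the arrows (`exists_of_isSimple`), so these resolutions
suffice.

Finally, if Λᵒ is Koszul, the first implication for Λᵒ and the same construction of resolutions,
read from Λᵒ back to Λ, show that Λ is Koszul. -/

noncomputable section

/-! ### The grading of the path algebra by the length of paths -/

namespace PathSpace

variable {k : Type w} [Field k] {Q : Type u} [Quiver.{v + 1} Q]

/-- The projection of the path algebra onto its part of degree `n`. -/
def part (n : ℕ) {x y : Q} : PathSpace k x y →ₗ[k] PathSpace k x y :=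
  (deg n x y).subtype ∘ₗ Finsupp.restrictDom k k {p : Quiver.Path x y | p.length = n}

theorem part_mem_deg (n : ℕ) {x y : Q} (γ : PathSpace k x y) : part n γ ∈ deg n x y :=
  (Finsupp.restrictDom k k {p : Quiver.Path x y | p.length = n} γ).2

theorem part_apply (n : ℕ) {x y : Q} (γ : PathSpace k x y) (p : Quiver.Path x y) :
    part n γ p = if p.length = n then γ p else 0 := by
  classical
  change (Finsupp.restrictDom k k {p : Quiver.Path x y | p.length = n} γ : PathSpace k x y) p = _
  rw [Finsupp.restrictDom_apply, Finsupp.filter_apply]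
  rfl

theorem mem_deg_iff {n : ℕ} {x y : Q} {γ : PathSpace k x y} :
    γ ∈ deg n x y ↔ ∀ p : Quiver.Path x y, p.length ≠ n → γ p = 0 := by
  rw [deg, Finsupp.mem_supported']
  rfl

theorem part_of_mem_deg {n : ℕ} {x y : Q} {γ : PathSpace k x y} (h : γ ∈ deg n x y) :
    part n γ = γ := by
  ext p
  rw [part_apply]
  split_ifs with hp
  · rfl
  · exact (mem_deg_iff.1 h p hp).symm

theorem part_of_mem_deg_ne {m n : ℕ} {x y : Q} {γ : PathSpace k x y} (h : γ ∈ deg n x y)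
    (hmn : n ≠ m) : part m γ = 0 := by
  ext p
  rw [part_apply]
  split_ifs with hp
  · exact mem_deg_iff.1 h p fun h' => hmn (h'.symm.trans hp)
  · rfl

theorem single_mem_deg {x y : Q} (p : Quiver.Path x y) (c : k) :
    (Finsupp.single p c : PathSpace k x y) ∈ deg p.length x y :=
  Finsupp.single_mem_supported k c rfl

theorem one_mem_deg (x : Q) : (one x : PathSpace k x x) ∈ deg 0 x x := single_mem_deg _ _

theorem arrow_mem_deg {x y : Q} (α : x ⟶ y) : (arrow α : PathSpace k x y) ∈ deg 1 x y :=
  single_mem_deg _ _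

theorem mul_mem_deg {m n : ℕ} {x y z : Q} {γ : PathSpace k y z} {δ : PathSpace k x y}
    (hγ : γ ∈ deg m y z) (hδ : δ ∈ deg n x y) : mul γ δ ∈ deg (n + m) x z := by
  rw [deg, Finsupp.supported_eq_span_single] at hγ hδ
  induction hγ using Submodule.span_induction with
  | zero => simp
  | add _ _ _ _ h₁ h₂ => simpa using add_mem h₁ h₂
  | smul c _ _ h => simpa using Submodule.smul_mem _ c h
  | mem γ h =>
    obtain ⟨p, hp, rfl⟩ := h
    induction hδ using Submodule.span_induction with
    | zero => simp
    | add _ _ _ _ h₁ h₂ => simpa using add_mem h₁ h₂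
    | smul c _ _ h => simpa using Submodule.smul_mem _ c h
    | mem δ h =>
      obtain ⟨q, hq, rfl⟩ := h
      simp only [Set.mem_ofPred_eq] at hp hq
      have := single_mem_deg (k := k) (q.comp p) (1 * 1)
      rw [Quiver.Path.length_comp, hp, hq] at this
      simpa using this

theorem exists_sum_part {x y : Q} (γ : PathSpace k x y) :
    ∃ N : ℕ, ∑ n ∈ Finset.range N, part n γ = γ := by
  -- One more than the length of the longest path in the support.
  refine ⟨γ.support.sup Quiver.Path.length + 1, ?_⟩
  ext p
  simp only [Finsupp.coe_finsetSum, Finset.sum_apply, part_apply, Finset.sum_ite_eq,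
    Finset.mem_range]
  split_ifs with h
  · rfl
  · by_contra hp
    exact h (Nat.lt_succ_of_le (Finset.le_sup (f := Quiver.Path.length)
      (Finsupp.mem_support_iff.2 (Ne.symm hp))))

theorem induction_deg {x y : Q} {P : PathSpace k x y → Prop} (γ : PathSpace k x y)
    (hadd : ∀ γ δ, P γ → P δ → P (γ + δ)) (hdeg : ∀ n, ∀ γ ∈ deg n x y, P γ) : P γ := by
  obtain ⟨N, hN⟩ := exists_sum_part γ
  rw [← hN]
  refine Finset.sum_induction _ P hadd (hdeg 0 _ (zero_mem _)) fun n _ =>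
    hdeg n _ (part_mem_deg n γ)

theorem part_mul_left {m n : ℕ} {x y z : Q} {γ : PathSpace k y z} (hγ : γ ∈ deg m y z)
    (δ : PathSpace k x y) : part (n + m) (mul γ δ) = mul γ (part n δ) := by
  induction δ using induction_deg with
  | hadd _ _ h₁ h₂ => simp only [map_add, h₁, h₂]
  | hdeg l δ hδ =>
    by_cases h : l = n
    · subst h
      rw [part_of_mem_deg (mul_mem_deg hγ hδ), part_of_mem_deg hδ]
    · rw [part_of_mem_deg_ne (mul_mem_deg hγ hδ) (by omega), part_of_mem_deg_ne hδ h, map_zero]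

theorem part_mul_right {m n : ℕ} {x y z : Q} (γ : PathSpace k y z) {δ : PathSpace k x y}
    (hδ : δ ∈ deg m x y) : part (n + m) (mul γ δ) = mul (part n γ) δ := by
  induction γ using induction_deg with
  | hadd _ _ h₁ h₂ => simp only [map_add, h₁, h₂, LinearMap.add_apply]
  | hdeg l γ hγ =>
    by_cases h : l = n
    · subst h
      rw [add_comm l m, part_of_mem_deg (mul_mem_deg hγ hδ), part_of_mem_deg hγ]
    · rw [part_of_mem_deg_ne (mul_mem_deg hγ hδ) (by omega), part_of_mem_deg_ne hγ h, map_zero,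
        LinearMap.zero_apply]

theorem part_mul_left_eq_zero {m n : ℕ} (hn : n < m) {x y z : Q} {γ : PathSpace k y z}
    (hγ : γ ∈ deg m y z) (δ : PathSpace k x y) : part n (mul γ δ) = 0 := by
  induction δ using induction_deg with
  | hadd _ _ h₁ h₂ => simp only [map_add, h₁, h₂, add_zero]
  | hdeg l δ hδ => rw [part_of_mem_deg_ne (mul_mem_deg hγ hδ) (by omega)]

theorem part_mul_right_eq_zero {m n : ℕ} (hn : n < m) {x y z : Q} (γ : PathSpace k y z)
    {δ : PathSpace k x y} (hδ : δ ∈ deg m x y) : part n (mul γ δ) = 0 := by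
  induction γ using induction_deg with
  | hadd _ _ h₁ h₂ => simp only [map_add, h₁, h₂, LinearMap.add_apply, add_zero]
  | hdeg l γ hγ => rw [part_of_mem_deg_ne (mul_mem_deg hγ hδ) (by omega)]

theorem deg_zero_of_ne {x y : Q} (h : x ≠ y) {γ : PathSpace k x y} (hγ : γ ∈ deg 0 x y) :
    γ = 0 := by
  ext p
  exact mem_deg_iff.1 hγ p fun hp => h (Quiver.Path.eq_of_length_zero p hp)

theorem deg_zero_self {x : Q} {γ : PathSpace k x x} (hγ : γ ∈ deg 0 x x) :
    γ = γ Quiver.Path.nil • one x := by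
  ext p
  by_cases hp : p = Quiver.Path.nil
  · subst hp; simp [one]
  · rw [mem_deg_iff.1 hγ p fun h => hp (Quiver.Path.eq_nil_of_length_zero p h)]
    simp [one, Ne.symm hp]

/-- The part of degree `n + 1` is spanned by products of arrows with paths of length `n`. -/
theorem deg_succ_induction {n : ℕ} {x z : Q} {P : PathSpace k x z → Prop} {γ : PathSpace k x z}
    (hγ : γ ∈ deg (n + 1) x z) (hzero : P 0) (hadd : ∀ γ δ, P γ → P δ → P (γ + δ))
    (hmul : ∀ {y : Q} (α : y ⟶ z), ∀ γ ∈ deg n x y, P (mul (arrow α) γ)) : P γ := by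
  suffices h : ∀ γ : PathSpace k x z, P (part (n + 1) γ) by
    have := h γ
    rwa [part_of_mem_deg hγ] at this
  intro γ
  induction γ using Finsupp.induction_linear with
  | zero => simpa using hzero
  | add _ _ h₁ h₂ => rw [map_add]; exact hadd _ _ h₁ h₂
  | single p c =>
    cases p with
    | nil =>
      rw [part_of_mem_deg_ne (single_mem_deg _ _) (by simp)]
      exact hzero
    | cons p α =>
      have h : (Finsupp.single (p.cons α) c : PathSpace k x z) =
          mul (arrow α) (Finsupp.single p c) := by
        rw [arrow, mul_single, _root_.one_mul]; rfl
      rw [h, part_mul_left (arrow_mem_deg α)]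
      exact hmul α _ (part_mem_deg _ _)

end PathSpace

namespace PathIdeal

variable {k : Type w} [Field k] {Q : Type u} [Quiver.{v + 1} Q] (R : PathIdeal k Q)

/-- The ideal `R` is homogeneous with respect to the length of paths, and it contains no nonzero
element of degree at most one. -/
structure IsGraded : Prop where
  part_mem : ∀ (n : ℕ) {x y : Q} {ρ : PathSpace k x y}, ρ ∈ R.carrier x y →
    PathSpace.part n ρ ∈ R.carrier x y
  part_eq_zero : ∀ {n : ℕ}, n < 2 → ∀ {x y : Q} {ρ : PathSpace k x y}, ρ ∈ R.carrier x y →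
    PathSpace.part n ρ = 0

variable {R}

/-- Both claims are linear, so they can be checked on generators ζρδ with ζ and δ homogeneous; such
an element is homogeneous, of degree at least that of ρ, which is two. -/
theorem IsQuadratic.isGraded (h : R.IsQuadratic) : R.IsGraded := by
  obtain ⟨S, hS, rfl⟩ := h
  constructor
  · intro n x y σ hσ
    induction hσ using Submodule.span_induction with
    | zero => simp
    | add _ _ _ _ h₁ h₂ => simpa using add_mem h₁ h₂
    | smul c _ _ h => simpa using Submodule.smul_mem _ c h
    | mem σ h =>
      obtain ⟨b, c, ζ, ρ, δ, hρ, rfl⟩ := h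
      induction ζ using PathSpace.induction_deg with
      | hadd _ _ h₁ h₂ =>
        simp only [map_add, LinearMap.add_apply]
        exact add_mem h₁ h₂
      | hdeg l ζ hζ =>
        induction δ using PathSpace.induction_deg with
        | hadd _ _ h₁ h₂ =>
          simp only [map_add]
          exact add_mem h₁ h₂
        | hdeg m δ hδ =>
          have := PathSpace.mul_mem_deg hζ (PathSpace.mul_mem_deg (hS _ _ _ hρ) hδ)
          by_cases hn : m + 2 + l = n
          · subst hn
            rw [PathSpace.part_of_mem_deg this]
            exact Submodule.subset_span ⟨b, c, ζ, ρ, δ, hρ, rfl⟩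
          · rw [PathSpace.part_of_mem_deg_ne this hn]
            exact zero_mem _
  · intro n hn x y σ hσ
    induction hσ using Submodule.span_induction with
    | zero => simp
    | add _ _ _ _ h₁ h₂ => simp [h₁, h₂]
    | smul c _ _ h => simp [h]
    | mem σ h =>
      obtain ⟨b, c, ζ, ρ, δ, hρ, rfl⟩ := h
      induction ζ using PathSpace.induction_deg with
      | hadd _ _ h₁ h₂ => simp only [map_add, LinearMap.add_apply, h₁, h₂, add_zero]
      | hdeg l ζ hζ =>
        induction δ using PathSpace.induction_deg with
        | hadd _ _ h₁ h₂ => simp only [map_add, h₁, h₂, add_zero]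
        | hdeg m δ hδ =>
          have := PathSpace.mul_mem_deg hζ (PathSpace.mul_mem_deg (hS _ _ _ hρ) hδ)
          exact PathSpace.part_of_mem_deg_ne this (by omega)

/-- This makes all results on the grading available for Λ^!. -/
theorem quadraticDual_isQuadratic : R.quadraticDual.IsQuadratic :=
  ⟨_, fun _ _ _ h => h.1, rfl⟩

/-! ### The grading of `Λ` -/

namespace IsGraded

variable (h : R.IsGraded)

/-- The projection of `e_y Λ e_x` onto `e_y Λ_n e_x`. -/
def part (n : ℕ) {x y : Q} : R.Alg x y →ₗ[k] R.Alg x y :=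
  Submodule.mapQ _ _ (PathSpace.part n) fun _ hρ => h.part_mem n hρ

theorem part_cls (n : ℕ) {x y : Q} (γ : PathSpace k x y) :
    h.part n (R.cls γ) = R.cls (PathSpace.part n γ) := rfl

theorem part_mem_algDeg (n : ℕ) {x y : Q} (f : R.Alg x y) : h.part n f ∈ R.algDeg n x y := by
  obtain ⟨γ, rfl⟩ := Submodule.mkQ_surjective _ f
  exact ⟨_, PathSpace.part_mem_deg n γ, rfl⟩

theorem part_of_mem {n : ℕ} {x y : Q} {f : R.Alg x y} (hf : f ∈ R.algDeg n x y) :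
    h.part n f = f := by
  obtain ⟨γ, hγ, rfl⟩ := hf
  rw [part_cls, PathSpace.part_of_mem_deg hγ]

theorem part_of_mem_ne {m n : ℕ} {x y : Q} {f : R.Alg x y} (hf : f ∈ R.algDeg n x y)
    (hmn : n ≠ m) : h.part m f = 0 := by
  obtain ⟨γ, hγ, rfl⟩ := hf
  rw [part_cls, PathSpace.part_of_mem_deg_ne hγ hmn, map_zero]

theorem exists_sum_part {x y : Q} (f : R.Alg x y) :
    ∃ N : ℕ, ∑ n ∈ Finset.range N, h.part n f = f := by
  obtain ⟨γ, rfl⟩ := Submodule.mkQ_surjective _ f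
  obtain ⟨N, hN⟩ := PathSpace.exists_sum_part γ
  refine ⟨N, ?_⟩
  conv_rhs => rw [← hN]
  rw [map_sum]
  rfl

theorem part_part_self {n : ℕ} {x y : Q} (f : R.Alg x y) : h.part n (h.part n f) = h.part n f :=
  h.part_of_mem (h.part_mem_algDeg n f)

theorem part_part_ne {m n : ℕ} {x y : Q} (hmn : n ≠ m) (f : R.Alg x y) :
    h.part m (h.part n f) = 0 :=
  h.part_of_mem_ne (h.part_mem_algDeg n f) hmn

theorem part_arrow_mul (n : ℕ) {x y z : Q} (α : y ⟶ z) (f : R.Alg x y) :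
    h.part (n + 1) (R.mul (R.arrow α) f) = R.mul (R.arrow α) (h.part n f) := by
  obtain ⟨γ, rfl⟩ := Submodule.mkQ_surjective _ f
  rw [arrow, mul_cls, part_cls, part_cls, PathSpace.part_mul_left (PathSpace.arrow_mem_deg α),
    mul_cls]

theorem part_zero_arrow_mul {x y z : Q} (α : y ⟶ z) (f : R.Alg x y) :
    h.part 0 (R.mul (R.arrow α) f) = 0 := by
  obtain ⟨γ, rfl⟩ := Submodule.mkQ_surjective _ f
  rw [arrow, mul_cls, part_cls, PathSpace.part_mul_left_eq_zero Nat.zero_lt_one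
    (PathSpace.arrow_mem_deg α), map_zero]

theorem part_mul_arrow (n : ℕ) {x y z : Q} (f : R.Alg y z) (α : x ⟶ y) :
    h.part (n + 1) (R.mul f (R.arrow α)) = R.mul (h.part n f) (R.arrow α) := by
  obtain ⟨γ, rfl⟩ := Submodule.mkQ_surjective _ f
  rw [arrow, mul_cls, part_cls, part_cls, PathSpace.part_mul_right _ (PathSpace.arrow_mem_deg α),
    mul_cls]

theorem part_zero_mul_arrow {x y z : Q} (f : R.Alg y z) (α : x ⟶ y) :
    h.part 0 (R.mul f (R.arrow α)) = 0 := by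
  obtain ⟨γ, rfl⟩ := Submodule.mkQ_surjective _ f
  rw [arrow, mul_cls, part_cls, PathSpace.part_mul_right_eq_zero Nat.zero_lt_one _
    (PathSpace.arrow_mem_deg α), map_zero]

theorem part_one (x : Q) : h.part 0 (R.cls (PathSpace.one x)) = R.cls (PathSpace.one x) := by
  rw [part_cls, PathSpace.part_of_mem_deg (PathSpace.one_mem_deg x)]

theorem part_zero_of_ne {x y : Q} (hxy : x ≠ y) (f : R.Alg x y) : h.part 0 f = 0 := by
  obtain ⟨γ, rfl⟩ := Submodule.mkQ_surjective _ f
  rw [part_cls, PathSpace.deg_zero_of_ne hxy (PathSpace.part_mem_deg 0 γ), map_zero]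

theorem exists_part_zero_eq {x : Q} (f : R.Alg x x) :
    ∃ c : k, h.part 0 f = c • R.cls (PathSpace.one x) := by
  obtain ⟨γ, rfl⟩ := Submodule.mkQ_surjective _ f
  rw [part_cls, PathSpace.deg_zero_self (PathSpace.part_mem_deg 0 γ), map_smul]
  exact ⟨_, rfl⟩

include h in
theorem cls_one_ne_zero (x : Q) : R.cls (PathSpace.one x) ≠ 0 := by
  intro h0
  have := h.part_eq_zero (n := 0) (by omega) ((Submodule.Quotient.mk_eq_zero _).1 h0)
  rw [PathSpace.part_of_mem_deg (PathSpace.one_mem_deg x)] at this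
  simp [PathSpace.one] at this

/-- An element without component of degree zero is a sum of products with arrows. -/
theorem mul_arrow_induction {x z : Q} {P : R.Alg x z → Prop} {f : R.Alg x z}
    (hf : h.part 0 f = 0) (hzero : P 0) (hadd : ∀ f g, P f → P g → P (f + g))
    (hmul : ∀ {y : Q} (α : y ⟶ z) (f : R.Alg x y), P (R.mul (R.arrow α) f)) : P f := by
  obtain ⟨N, hN⟩ := h.exists_sum_part f
  rw [← hN]
  refine Finset.sum_induction _ P hadd hzero fun n _ => ?_
  cases n with
  | zero => rwa [hf]
  | succ n =>
    obtain ⟨γ, hγ, hγf⟩ := h.part_mem_algDeg (n + 1) f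
    rw [← hγf]
    refine PathSpace.deg_succ_induction (P := fun γ => P (R.cls γ)) hγ ?_ ?_ ?_
    · rwa [map_zero]
    · intro _ _ h₁ h₂
      rw [map_add]
      exact hadd _ _ h₁ h₂
    · exact fun α γ _ => hmul α (R.cls γ)

/-- A finite basis involves finitely many homogeneous components in all. This bound is used to sum
solutions found degree by degree, and to show that iterating J cannot preserve a simple module. -/
theorem exists_part_eq_zero (hfin : R.IsLocallyFiniteDimensional) (x y : Q) :
    ∃ N : ℕ, ∀ n, N ≤ n → ∀ f : R.Alg x y, h.part n f = 0 := by
  have := hfin x y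
  let b := Module.finBasis k (R.Alg x y)
  choose N hN using fun j => h.exists_sum_part (b j)
  refine ⟨Finset.univ.sup N, fun n hn f => ?_⟩
  suffices hz : h.part (x := x) (y := y) n = 0 by rw [hz, LinearMap.zero_apply]
  refine b.ext fun j => ?_
  rw [← hN j, map_sum, LinearMap.zero_apply]
  refine Finset.sum_eq_zero fun m hm => h.part_part_ne ?_ _
  have := Finset.le_sup (f := N) (Finset.mem_univ j)
  rw [Finset.mem_range] at hm
  omega

end IsGraded

end PathIdeal

/-! ### A diagram chase in a bicomplex -/

/-- `D₀`, `D₁`, `D₂` play the role of three consecutive internal degrees, which both differentials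
`r` and `p` lower by one. Exactness of `r` is known in `D₀` and exactness of `p` in `D₁`; the chase
yields exactness of `r` in `D₁` at the edge `n = 0`. -/
theorem exact_of_bicomplex {k : Type*} [Field k] {C : ℕ → ℕ → Type*}
    [∀ n m, AddCommGroup (C n m)] [∀ n m, Module k (C n m)]
    (r : ∀ n m, C n m →ₗ[k] C n (m + 1)) (p : ∀ n m, C n m →ₗ[k] C (n + 1) m)
    (hrp : ∀ n m c, r (n + 1) m (p n m c) = p n (m + 1) (r n m c))
    (hrr : ∀ n m c, r n (m + 1) (r n m c) = 0) (hpp : ∀ n m c, p (n + 1) m (p n m c) = 0)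
    (D₀ D₁ D₂ : ∀ n m, Submodule k (C n m))
    (hpD : ∀ n m, ∀ c ∈ D₁ n m, p n m c ∈ D₀ (n + 1) m)
    (hrD : ∀ n m, ∀ c ∈ D₂ n m, r n m c ∈ D₁ n (m + 1))
    (hr₀ : ∀ n, ∀ c ∈ D₀ n 0, r n 0 c = 0 → c = 0)
    (hr : ∀ n m, ∀ c ∈ D₀ n (m + 1), r n (m + 1) c = 0 → ∃ e ∈ D₁ n m, r n m e = c)
    (hp₀ : ∀ m, ∀ c ∈ D₁ 0 m, p 0 m c = 0 → c = 0)
    (hp : ∀ n m, ∀ c ∈ D₁ (n + 1) m, p (n + 1) m c = 0 → ∃ e ∈ D₂ n m, p n m e = c) (m : ℕ) :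
    ∀ c ∈ D₁ 0 (m + 1), r 0 (m + 1) c = 0 → ∃ e ∈ D₂ 0 m, r 0 m e = c := by
  -- Modulo the kernel of `r`, such a `c` is a `p`-boundary. The induction goes down the staircase
  -- from `(n, m + 1)` to `(n + 1, m)` and ends at `m = 0`, where `r` is injective on `D₀`.
  have key : ∀ m n, ∀ c ∈ D₁ (n + 1) m, r (n + 2) m (p (n + 1) m c) = 0 →
      ∃ e ∈ D₂ n m, r (n + 1) m (p n m e) = r (n + 1) m c := by
    intro m
    induction m with
    | zero =>
      intro n c hc h
      obtain ⟨e, he, rfl⟩ := hp n 0 c hc (hr₀ _ _ (hpD _ _ _ hc) h)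
      exact ⟨e, he, rfl⟩
    | succ m ih =>
      intro n c hc h
      obtain ⟨c', hc', h'⟩ := hr _ _ _ (hpD _ _ _ hc) h
      obtain ⟨e', he', h''⟩ := ih (n + 1) c' hc' (by rw [hrp, h', hpp])
      obtain ⟨e, he, h₃⟩ := hp n (m + 1) (c - r (n + 1) m e') (sub_mem hc (hrD _ _ _ he'))
        (by rw [map_sub, ← hrp, h'', h', sub_self])
      refine ⟨e, he, ?_⟩
      rw [h₃, map_sub, hrr, sub_zero]
  intro c hc h
  obtain ⟨c', hc', h'⟩ := hr _ _ _ (hpD _ _ _ hc) (by rw [hrp, h, map_zero])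
  obtain ⟨e, he, h''⟩ := key m 0 c' hc' (by rw [hrp, h', hpp])
  -- The difference is killed by `p`, which is injective on `D₁` at `n = 0`.
  refine ⟨e, he, (sub_eq_zero.1 (hp₀ _ (c - r 0 m e) (sub_mem hc (hrD _ _ _ he)) ?_)).symm⟩
  rw [map_sub, ← hrp, h'', h', sub_self]

/-! ### Complexes of linear maps from a module to a graded representation of the opposite quiver -/

instance Quiver.LocallyFinite.fintypeStar {Q : Type u} [Quiver.{v + 1} Q]
    [Quiver.LocallyFinite Q] (x : Q) : Fintype (Quiver.Star x) :=
  have := Quiver.LocallyFinite.finite_star x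
  Fintype.ofFinite _

instance Quiver.LocallyFinite.fintypeCostar {Q : Type u} [Quiver.{v + 1} Q]
    [Quiver.LocallyFinite Q] (x : Q) : Fintype (Quiver.Costar x) :=
  have := Quiver.LocallyFinite.finite_costar x
  Fintype.ofFinite _

/-- A graded representation of the opposite quiver, in which arrows act with degree one. -/
structure GradedOpRep (k : Type w) [Field k] (Q : Type u) [Quiver.{v + 1} Q] where
  /-- The vector space at a vertex in a given degree. -/
  obj : ℕ → Q → Type w'
  [addCommGroup : ∀ n x, AddCommGroup (obj n x)]
  [module : ∀ n x, Module k (obj n x)]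
  /-- The action of an arrow. -/
  map : ∀ (n : ℕ) {x y : Q}, (x ⟶ y) → obj n y →ₗ[k] obj (n + 1) x

attribute [instance] GradedOpRep.addCommGroup GradedOpRep.module

namespace GradedOpRep

variable {k : Type w} [Field k] {Q : Type u} [Quiver.{v + 1} Q] [Quiver.LocallyFinite Q]
  {R : PathIdeal k Q} (G : GradedOpRep.{u, v, w, w''} k Q)

/-- The differential of the complex with terms `∏ₛ Hom(M(s), Gₙ(s))`. -/
def codiff (M : BoundRep.{u, v, w, w'} R) (n : ℕ) :
    (∀ s, M.obj s →ₗ[k] G.obj n s) →ₗ[k] ∀ s, M.obj s →ₗ[k] G.obj (n + 1) s where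
  toFun φ s := ∑ α : Quiver.Star s, G.map n α.2 ∘ₗ φ α.1 ∘ₗ M.map α.2
  map_add' φ ψ := by
    funext s
    ext u
    simp [Finset.sum_add_distrib]
  map_smul' c φ := by
    funext s
    ext u
    simp [Finset.smul_sum]

theorem codiff_apply (M : BoundRep.{u, v, w, w'} R) (n : ℕ) (φ : ∀ s, M.obj s →ₗ[k] G.obj n s)
    (s : Q) (u : M.obj s) :
    G.codiff M n φ s u = ∑ α : Quiver.Star s, G.map n α.2 (φ α.1 (M.map α.2 u)) := by
  simp [codiff]

/-- The differential of the complex with terms `∏ₛ Hom(e_s Λ e_z, Gₙ(s))`. -/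
def algCodiff (z : Q) (n : ℕ) :
    (∀ s, R.Alg z s →ₗ[k] G.obj n s) →ₗ[k] ∀ s, R.Alg z s →ₗ[k] G.obj (n + 1) s :=
  G.codiff (R.proj z) n

theorem algCodiff_apply (z : Q) (n : ℕ) (φ : ∀ s, R.Alg z s →ₗ[k] G.obj n s)
    (s : Q) (u : R.Alg z s) :
    G.algCodiff z n φ s u =
      ∑ α : Quiver.Star s, G.map n α.2 (φ α.1 (R.mul (R.arrow α.2) u)) :=
  G.codiff_apply (R.proj z) n φ s u

variable (R) in
/-- The relations of `G` are orthogonal to those of `R`: the action of the arrows generates `G`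
from its part of degree zero, and the relations between products with arrows are consequences of
those of length two orthogonal to `R`. -/
structure IsQuadraticallyPresented : Prop where
  codiff_codiff : ∀ (M : BoundRep.{u, v, w, max u (v + 1) w} R) (n : ℕ)
    (φ : ∀ s, M.obj s →ₗ[k] G.obj n s), G.codiff M (n + 1) (G.codiff M n φ) = 0
  eq_zero_of_sum : ∀ (s : Q) (x : ∀ α : Quiver.Star s, G.obj 0 α.1),
    ∑ α : Quiver.Star s, G.map 0 α.2 (x α) = 0 → ∀ α, x α = 0
  exists_of_sum : ∀ (n : ℕ) (s : Q) (x : ∀ α : Quiver.Star s, G.obj (n + 1) α.1),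
    ∑ α : Quiver.Star s, G.map (n + 1) α.2 (x α) = 0 →
      ∃ ψ : ∀ y, R.Alg s y →ₗ[k] G.obj n y, ∀ α : Quiver.Star s,
        G.algCodiff s n ψ α.1 (R.arrow α.2) = x α
  exists_sum_eq : ∀ (n : ℕ) (s : Q) (x : G.obj (n + 1) s),
    ∃ y : ∀ α : Quiver.Star s, G.obj n α.1, ∑ α : Quiver.Star s, G.map n α.2 (y α) = x

end GradedOpRep

namespace BoundRep

variable {k : Type w} [Field k] {Q : Type u} [Quiver.{v + 1} Q] {R : PathIdeal k Q}

theorem mapRange_summand {ι : Type i} (M : ι → BoundRep.{u, v, w, w'} R) {x : Q}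
    (g : ∀ j, (M j).obj x →ₗ[k] (M j).obj x) (j : ι) (m : (M j).obj x) :
    DFinsupp.mapRange.linearMap g (summand M j x m) = summand M j x (g j m) := by
  classical
  exact DFinsupp.mapRange_single (hf := fun i => map_zero (g i))

theorem component_summand_self {ι : Type i} (M : ι → BoundRep.{u, v, w, w'} R) {x : Q} (j : ι)
    (m : (M j).obj x) : component M j x (summand M j x m) = m := by
  classical
  exact DFinsupp.single_eq_same (β := fun j => (M j).obj x)

theorem component_summand_ne {ι : Type i} (M : ι → BoundRep.{u, v, w, w'} R) {x : Q} {j l : ι}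
    (hjl : l ≠ j) (m : (M l).obj x) : component M j x (summand M l x m) = 0 := by
  classical
  exact DFinsupp.single_eq_of_ne hjl.symm

theorem sum_summand_component {ι : Type i} [Fintype ι] (M : ι → BoundRep.{u, v, w, w'} R) {x : Q}
    (m : (directSum M).obj x) : ∑ j, summand M j x (component M j x m) = m := by
  classical
  exact DirectSum.sum_univ_of m

end BoundRep

namespace PathIdeal

variable {k : Type w} [Field k] {Q : Type u} [Quiver.{v + 1} Q] {R : PathIdeal k Q}

/-! ### Finite direct sums of projective modules -/

variable (R) in
/-- The components of an element of `P_{c 1} ⊕ ⋯ ⊕ P_{c m}`. -/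
def coord {m : ℕ} (c : Fin m → Q) (j : Fin m) (x : Q) :
    (R.projSum c).obj x →ₗ[k] R.Alg (c j) x :=
  BoundRep.component (fun j => R.proj (c j)) j x

variable (R) in
/-- The inclusions of the summands of `P_{c 1} ⊕ ⋯ ⊕ P_{c m}`. -/
def incl {m : ℕ} (c : Fin m → Q) (j : Fin m) (x : Q) :
    R.Alg (c j) x →ₗ[k] (R.projSum c).obj x :=
  BoundRep.summand (fun j => R.proj (c j)) j x

variable (R) in
/-- The linear map on `P_{c 1} ⊕ ⋯ ⊕ P_{c m}` given by linear maps on the summands. -/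
def projDesc {m : ℕ} (c : Fin m → Q) {x : Q} {V : Type*} [AddCommGroup V] [Module k V]
    (φ : ∀ j, R.Alg (c j) x →ₗ[k] V) : (R.projSum c).obj x →ₗ[k] V :=
  BoundRep.desc (fun j => R.proj (c j)) φ

section

variable {m : ℕ} {c : Fin m → Q} {x : Q}

theorem projSum_ext {p q : (R.projSum c).obj x} (hpq : ∀ j, R.coord c j x p = R.coord c j x q) :
    p = q :=
  DFinsupp.ext hpq

theorem coord_map {y : Q} (α : x ⟶ y) (p : (R.projSum c).obj x) (j : Fin m) :
    R.coord c j y ((R.projSum c).map α p) = R.mul (R.arrow α) (R.coord c j x p) := rfl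

theorem map_incl {y : Q} (α : x ⟶ y) (j : Fin m) (f : R.Alg (c j) x) :
    (R.projSum c).map α (R.incl c j x f) = R.incl c j y (R.mul (R.arrow α) f) :=
  BoundRep.map_summand (fun j => R.proj (c j)) α j f

theorem coord_incl_self (j : Fin m) (f : R.Alg (c j) x) : R.coord c j x (R.incl c j x f) = f :=
  BoundRep.component_summand_self (fun j => R.proj (c j)) j f

theorem coord_incl_ne {j l : Fin m} (hjl : l ≠ j) (f : R.Alg (c l) x) :
    R.coord c j x (R.incl c l x f) = 0 :=
  BoundRep.component_summand_ne (fun j => R.proj (c j)) hjl f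

theorem sum_incl_coord (p : (R.projSum c).obj x) : ∑ j, R.incl c j x (R.coord c j x p) = p :=
  BoundRep.sum_summand_component (fun j => R.proj (c j)) p

theorem projDesc_incl {V : Type*} [AddCommGroup V] [Module k V]
    (φ : ∀ j, R.Alg (c j) x →ₗ[k] V) (j : Fin m) (f : R.Alg (c j) x) :
    R.projDesc c φ (R.incl c j x f) = φ j f :=
  BoundRep.desc_summand (fun j => R.proj (c j)) φ j f

theorem projSum_hom_ext {V : Type*} [AddCommGroup V] [Module k V]
    {f g : (R.projSum c).obj x →ₗ[k] V} (hfg : ∀ j p, f (R.incl c j x p) = g (R.incl c j x p)) :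
    f = g :=
  BoundRep.directSum_ext (fun j => R.proj (c j)) hfg

end

namespace IsGraded

variable (h : R.IsGraded)

/-- The projection onto the part of degree `n` of a direct sum of projective modules. -/
def sumPart (n : ℕ) {m : ℕ} (c : Fin m → Q) (x : Q) :
    (R.projSum c).obj x →ₗ[k] (R.projSum c).obj x :=
  DFinsupp.mapRange.linearMap fun j => (h.part n : R.Alg (c j) x →ₗ[k] R.Alg (c j) x)

variable {m : ℕ} (c : Fin m → Q)

theorem coord_sumPart (n : ℕ) {x : Q} (p : (R.projSum c).obj x) (j : Fin m) :
    R.coord c j x (h.sumPart n c x p) = h.part n (R.coord c j x p) := rfl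

theorem sumPart_incl (n : ℕ) {x : Q} (j : Fin m) (f : R.Alg (c j) x) :
    h.sumPart n c x (R.incl c j x f) = R.incl c j x (h.part n f) :=
  BoundRep.mapRange_summand (fun j => R.proj (c j))
    (fun j => (h.part n : R.Alg (c j) x →ₗ[k] R.Alg (c j) x)) j f

theorem sumPart_map (n : ℕ) {x y : Q} (α : x ⟶ y) (p : (R.projSum c).obj x) :
    h.sumPart (n + 1) c y ((R.projSum c).map α p) = (R.projSum c).map α (h.sumPart n c x p) := by
  apply projSum_ext
  intro j
  rw [coord_sumPart, coord_map, coord_map, coord_sumPart, part_arrow_mul]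

theorem sumPart_sumPart (n : ℕ) {x : Q} (p : (R.projSum c).obj x) :
    h.sumPart n c x (h.sumPart n c x p) = h.sumPart n c x p := by
  apply projSum_ext
  intro j
  rw [coord_sumPart, coord_sumPart, part_part_self]

theorem exists_sum_sumPart {x : Q} (p : (R.projSum c).obj x) :
    ∃ N : ℕ, ∑ n ∈ Finset.range N, h.sumPart n c x p = p := by
  choose N hN using fun j : Fin m => h.exists_sum_part (R.coord c j x p)
  refine ⟨Finset.univ.sup N, projSum_ext fun j => ?_⟩
  rw [map_sum]
  simp only [coord_sumPart]
  conv_rhs => rw [← hN j]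
  refine (Finset.sum_subset (Finset.range_subset_range.2
    (Finset.le_sup (f := N) (Finset.mem_univ j))) fun n _ hn => ?_).symm
  rw [← hN j, map_sum]
  refine Finset.sum_eq_zero fun l hl => h.part_part_ne ?_ _
  rintro rfl
  exact hn hl

/-- The submodule `J (P_{c 1} ⊕ ⋯ ⊕ P_{c m})` consists of the elements without component of degree
zero. -/
theorem mem_rad_projSum {x : Q} (p : (R.projSum c).obj x) :
    p ∈ (R.projSum c).rad x ↔ h.sumPart 0 c x p = 0 := by
  constructor
  · intro hp
    induction hp using Submodule.iSup_induction' with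
    | zero => rw [map_zero]
    | add _ _ _ _ h₁ h₂ => rw [map_add, h₁, h₂, add_zero]
    | mem α p hp =>
      obtain ⟨q, rfl⟩ := hp
      apply projSum_ext
      intro j
      rw [coord_sumPart, coord_map, part_zero_arrow_mul, map_zero]
  · intro hp
    rw [← sum_incl_coord p]
    refine sum_mem fun j _ => ?_
    have hj := congrArg (R.coord c j x) hp
    rw [coord_sumPart, map_zero] at hj
    refine h.mul_arrow_induction (P := fun f => R.incl c j x f ∈ (R.projSum c).rad x) hj ?_ ?_ ?_
    · rw [map_zero]
      exact zero_mem _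
    · intro f g hf hg
      rw [map_add]
      exact add_mem hf hg
    · intro y α f
      rw [← map_incl]
      exact BoundRep.map_mem_rad (R.projSum c) α _

-- Homogeneity of `d` is a condition on homogeneous elements only. Decomposing `p`, its component of
-- degree n is the only one whose image reaches degree n + 1.
variable {c} in
theorem sumPart_of_isHomogeneous {m' : ℕ} {c' : Fin m' → Q}
    {d : (R.projSum c).Hom (R.projSum c')} (hd : R.IsHomogeneousOfDegreeOne d) (n : ℕ) (x : Q)
    (p : (R.projSum c).obj x) :
    h.sumPart (n + 1) c' x (d.app x p) = d.app x (h.sumPart n c x p) := by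
  have hc : ∀ l j, R.coord c' j x (d.app x (h.sumPart l c x p)) ∈ R.algDeg (l + 1) (c' j) x :=
    fun l => hd l x _ fun j => h.part_mem_algDeg l _
  obtain ⟨N, hN⟩ := h.exists_sum_sumPart c p
  have hs : ∀ j, h.part (n + 1) (R.coord c' j x (d.app x p)) =
      ∑ l ∈ Finset.range N, h.part (n + 1) (R.coord c' j x (d.app x (h.sumPart l c x p))) := by
    intro j
    conv_lhs => rw [← hN, map_sum, map_sum, map_sum]
  apply projSum_ext
  intro j
  rw [coord_sumPart, hs]
  by_cases hn : n < N
  · rw [Finset.sum_eq_single_of_mem n (Finset.mem_range.2 hn)]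
    · exact h.part_of_mem (hc n j)
    · exact fun l _ hl => h.part_of_mem_ne (hc l j) (by omega)
  -- Beyond the last component of `p` both sides vanish.
  · have hz : h.sumPart n c x p = 0 := by
      rw [← hN, map_sum]
      refine Finset.sum_eq_zero fun l hl => projSum_ext fun j => ?_
      rw [coord_sumPart, coord_sumPart, part_part_ne, map_zero]
      rw [Finset.mem_range] at hl
      omega
    rw [hz, map_zero, map_zero]
    refine Finset.sum_eq_zero fun l hl => h.part_of_mem_ne (hc l j) ?_
    rw [Finset.mem_range] at hl
    omega

end IsGraded

end PathIdeal

/-! ### Modules on which the arrows act as zero -/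

namespace BoundRep

variable {k : Type w} [Field k] {Q : Type u} [Quiver.{v + 1} Q] {R : PathIdeal k Q}

/-- On a simple top all arrows act as zero. -/
theorem top_map (M : BoundRep.{u, v, w, w'} R) {x y : Q} (α : x ⟶ y) (m : M.top.obj x) :
    M.top.map α m = 0 := by
  obtain ⟨m, rfl⟩ := Submodule.mkQ_surjective _ m
  exact (Submodule.Quotient.mk_eq_zero _).2 (M.map_mem_rad α m)

theorem Hom.app_of_mem_rad {M : BoundRep.{u, v, w, w'} R} {N : BoundRep.{u, v, w, w''} R}
    (f : M.Hom N) (hN : ∀ {x y : Q} (α : x ⟶ y) (n : N.obj x), N.map α n = 0) {x : Q}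
    {m : M.obj x} (hm : m ∈ M.rad x) : f.app x m = 0 := by
  induction hm using Submodule.iSup_induction' with
  | zero => rw [map_zero]
  | add _ _ _ _ h₁ h₂ => rw [map_add, h₁, h₂, add_zero]
  | mem α p hp =>
    obtain ⟨q, rfl⟩ := hp
    rw [f.naturality, hN]

end BoundRep

/-! ### Elements of degree zero and one -/

namespace PathIdeal.IsGraded

variable {k : Type w} [Field k] {Q : Type u} [Quiver.{v + 1} Q] {R : PathIdeal k Q}
  (h : R.IsGraded)

/-- Λ_0 e_z is spanned by e_z at the vertex z and is zero at the other vertices. -/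
theorem part_zero_induction {z : Q} {P : ∀ s, R.Alg z s → Prop}
    (hzero : ∀ s, P s 0) (hone : ∀ c : k, P z (c • R.cls (PathSpace.one z))) (s : Q)
    (f : R.Alg z s) : P s (h.part 0 f) := by
  by_cases hzs : z = s
  · subst hzs
    obtain ⟨c, hc⟩ := h.exists_part_zero_eq f
    rw [hc]
    exact hone c
  · rw [h.part_zero_of_ne hzs]
    exact hzero s

theorem part_one_induction {z s : Q} {P : R.Alg z s → Prop} (hzero : P 0)
    (hadd : ∀ f g, P f → P g → P (f + g)) (hsmul : ∀ (c : k) f, P f → P (c • f))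
    (harrow : ∀ α : z ⟶ s, P (R.arrow α)) (f : R.Alg z s) : P (h.part 1 f) := by
  obtain ⟨γ, hγ, hγf⟩ := h.part_mem_algDeg 1 f
  rw [← hγf]
  refine PathSpace.deg_succ_induction (P := fun γ => P (R.cls γ)) hγ ?_ ?_ ?_
  · rwa [map_zero]
  · intro _ _ h₁ h₂
    rw [map_add]
    exact hadd _ _ h₁ h₂
  · intro y α γ hγ
    by_cases hzy : z = y
    · subst hzy
      rw [PathSpace.deg_zero_self hγ, map_smul, map_smul, PathSpace.mul_one]
      exact hsmul _ _ (harrow α)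
    · rw [PathSpace.deg_zero_of_ne hzy hγ, map_zero, map_zero]
      exact hzero

end PathIdeal.IsGraded

/-! ### The differential on sums of projectives and under morphisms -/

namespace GradedOpRep

variable {k : Type w} [Field k] {Q : Type u} [Quiver.{v + 1} Q] [Quiver.LocallyFinite Q]
  {R : PathIdeal k Q} (G : GradedOpRep.{u, v, w, w''} k Q)

theorem codiff_incl {m : ℕ} (c : Fin m → Q) (n : ℕ)
    (φ : ∀ s, (R.projSum c).obj s →ₗ[k] G.obj n s) (s : Q) (j : Fin m) (u : R.Alg (c j) s) :
    G.codiff (R.projSum c) n φ s (R.incl c j s u) =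
      G.algCodiff (c j) n (fun s => φ s ∘ₗ R.incl c j s) s u := by
  rw [codiff_apply, algCodiff_apply]
  exact Finset.sum_congr rfl fun α _ => by rw [PathIdeal.map_incl, LinearMap.comp_apply]

/-- This is the commutation of the two differentials of the bicomplex built from a resolution. -/
theorem codiff_comp_hom {M : BoundRep.{u, v, w, w'} R} {N : BoundRep.{u, v, w, i} R} (d : M.Hom N)
    (n : ℕ) (φ : ∀ s, N.obj s →ₗ[k] G.obj n s) :
    G.codiff M n (fun s => φ s ∘ₗ d.app s) = fun s => G.codiff N n φ s ∘ₗ d.app s := by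
  funext s
  ext u
  rw [LinearMap.comp_apply, codiff_apply, codiff_apply]
  exact Finset.sum_congr rfl fun α _ => by rw [LinearMap.comp_apply, d.naturality]

end GradedOpRep

/-! ### Exactness of the strands of fixed degree in Λ -/

namespace PathIdeal

variable {k : Type w} [Field k] {Q : Type u} [Quiver.{v + 1} Q] [Quiver.LocallyFinite Q]
  {R : PathIdeal k Q}

namespace IsGraded

variable (h : R.IsGraded) (G : GradedOpRep.{u, v, w, w''} k Q)

/-- The graded complex `∏ₛ Hom(e_s Λ_* e_z, G_*(s))` is exact at `∏ₛ Hom(e_s Λ_j e_z, Gₙ₊₁(s))`,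
for all `z`. -/
def ExactAt (j n : ℕ) : Prop :=
  ∀ (z : Q) (φ : ∀ s, R.Alg z s →ₗ[k] G.obj (n + 1) s), (∀ s f, φ s (h.part j f) = φ s f) →
    G.algCodiff z (n + 1) φ = 0 → ∃ ψ : ∀ s, R.Alg z s →ₗ[k] G.obj n s,
      (∀ s f, ψ s (h.part (j + 1) f) = ψ s f) ∧ G.algCodiff z n ψ = φ

variable {G}

/-- The complex of a direct sum of projectives is the product of the complexes of its summands, so
the equation is solved on each summand. -/
theorem exists_codiff_projSum {j n : ℕ} (hE : h.ExactAt G j n) {m : ℕ} (c : Fin m → Q)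
    (φ : ∀ s, (R.projSum c).obj s →ₗ[k] G.obj (n + 1) s)
    (hφ : ∀ s p, φ s (h.sumPart j c s p) = φ s p) (h0 : G.codiff (R.projSum c) (n + 1) φ = 0) :
    ∃ ψ : ∀ s, (R.projSum c).obj s →ₗ[k] G.obj n s,
      (∀ s p, ψ s (h.sumPart (j + 1) c s p) = ψ s p) ∧ G.codiff (R.projSum c) n ψ = φ := by
  have hl := fun l => hE (c l) (fun s => φ s ∘ₗ R.incl c l s)
    (fun s f => by rw [LinearMap.comp_apply, LinearMap.comp_apply, ← h.sumPart_incl, hφ])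
    (by
      funext s
      refine LinearMap.ext fun u => ?_
      rw [← GradedOpRep.codiff_incl, h0]
      rfl)
  choose ψ hψ₁ hψ₂ using hl
  refine ⟨fun s => R.projDesc c fun l => ψ l s, fun s p => ?_, ?_⟩
  · refine LinearMap.congr_fun (f := R.projDesc c (fun l => ψ l s) ∘ₗ h.sumPart (j + 1) c s)
      (projSum_hom_ext fun l f => ?_) p
    rw [LinearMap.comp_apply, h.sumPart_incl, projDesc_incl, projDesc_incl, hψ₁]
  · funext s
    refine projSum_hom_ext fun l f => ?_
    rw [GradedOpRep.codiff_incl]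
    have : (fun s => R.projDesc c (fun l => ψ l s) ∘ₗ R.incl c l s) = ψ l := by
      funext s
      refine LinearMap.ext fun f => ?_
      rw [LinearMap.comp_apply, projDesc_incl]
    rw [this, hψ₂]
    rfl

section

variable (hG : G.IsQuadraticallyPresented R)
include hG

/-- An element of positive degree is a sum of products ᾱf. The cocycle condition at f is a relation
∑ αᵒ φ(ᾱf) = 0 in degree one of `G`, where there are no nontrivial relations, so each φ(ᾱf)
vanishes. -/
theorem eq_zero_of_codiff {z : Q} {φ : ∀ s, R.Alg z s →ₗ[k] G.obj 0 s}
    (h0 : G.algCodiff z 0 φ = 0) (s : Q) (f : R.Alg z s) (hf : h.part 0 f = 0) : φ s f = 0 := by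
  refine h.mul_arrow_induction (P := fun f => φ s f = 0) hf (map_zero _) ?_ ?_
  · intro f g hf hg
    rw [map_add, hf, hg, add_zero]
  · intro y α f
    refine hG.eq_zero_of_sum y (fun α => φ α.1 (R.mul (R.arrow α.2) f)) ?_ ⟨s, α⟩
    rw [← G.algCodiff_apply, h0]
    rfl

/-- A family supported on Λ_0 e_z is determined by its value at e_z. That value is some ∑ αᵒ y_α,
because `G` is generated by arrows, and ᾱ ↦ y_α is the required preimage. -/
theorem exactAt_zero (n : ℕ) : h.ExactAt G 0 n := by
  classical
  intro z φ hφ _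
  obtain ⟨y, hy⟩ := hG.exists_sum_eq n z (φ z (R.cls (PathSpace.one z)))
  have hinj : ∀ s, Function.Injective fun α : z ⟶ s => α.toPath := by
    intro s α β hαβ
    exact Quiver.Path.hom_heq_of_cons_eq_cons hαβ |>.eq
  -- Prescribed on arrows and zero on all other paths; it descends to Λ because elements of R have
  -- no component of degree one.
  let ψ₀ : ∀ s, PathSpace k z s →ₗ[k] G.obj n s := fun s => Finsupp.linearCombination k
    (Function.extend (fun α : z ⟶ s => α.toPath) (fun α => y ⟨s, α⟩) 0)
  have hψ₀ : ∀ s γ, PathSpace.part 1 γ = 0 → ψ₀ s γ = 0 := by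
    intro s γ hγ
    refine Finset.sum_eq_zero fun p _ => ?_
    by_cases hp : ∃ α : z ⟶ s, α.toPath = p
    · obtain ⟨α, rfl⟩ := hp
      have := DFunLike.congr_fun hγ α.toPath
      rw [PathSpace.part_apply, if_pos (show α.toPath.length = 1 from rfl)] at this
      simp [this]
    · simp only [LinearMap.smulRight_apply, LinearMap.id_apply]
      rw [Function.extend_apply' _ _ _ hp, Pi.zero_apply, smul_zero]
  let ψ : ∀ s, R.Alg z s →ₗ[k] G.obj n s := fun s => Submodule.liftQ _ (ψ₀ s) fun ρ hρ =>
    hψ₀ s ρ (h.part_eq_zero (by omega) hρ)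
  have hψ : ∀ s (α : z ⟶ s), ψ s (R.arrow α) = y ⟨s, α⟩ := by
    intro s α
    change ψ₀ s (PathSpace.arrow α) = _
    simp only [ψ₀, PathSpace.arrow, Finsupp.linearCombination_single, one_smul]
    exact (hinj s).extend_apply _ _ α
  have hψ₁ : ∀ s f, ψ s (h.part 1 f) = ψ s f := by
    intro s f
    rw [eq_comm, ← sub_eq_zero, ← map_sub]
    obtain ⟨γ, rfl⟩ := Submodule.mkQ_surjective _ f
    refine hψ₀ s (γ - PathSpace.part 1 γ) ?_
    rw [map_sub, PathSpace.part_of_mem_deg (PathSpace.part_mem_deg 1 γ), sub_self]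
  refine ⟨ψ, hψ₁, ?_⟩
  funext s
  refine LinearMap.ext fun f => ?_
  have hz : G.algCodiff z n ψ s f = G.algCodiff z n ψ s (h.part 0 f) := by
    simp only [G.algCodiff_apply]
    refine Finset.sum_congr rfl fun α _ => ?_
    rw [← hψ₁, h.part_arrow_mul]
  rw [hz, ← hφ]
  refine h.part_zero_induction (P := fun s f => G.algCodiff z n ψ s f = φ s f) ?_ ?_ s f
  · intro s
    rw [map_zero, map_zero]
  · intro c
    rw [map_smul, map_smul, ← hy, G.algCodiff_apply]
    refine congrArg _ (Finset.sum_congr rfl fun α _ => ?_)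
    rw [mul_one, hψ]

/-- The cocycle condition at e_z reads ∑ αᵒ φ(ᾱ) = 0. The quadratic presentation of `G` explains
this relation by some ψ whose differential agrees with φ on arrows; restricting ψ to degree two
makes the differential vanish outside degree one. -/
theorem exactAt_one (n : ℕ) : h.ExactAt G 1 n := by
  intro z φ hφ h0
  obtain ⟨ψ, hψ⟩ := hG.exists_of_sum n z (fun α => φ α.1 (R.arrow α.2)) (by
    have := LinearMap.congr_fun (congrFun h0 z) (R.cls (PathSpace.one z))
    rw [G.algCodiff_apply] at this
    simp only [mul_one] at this
    exact this)
  refine ⟨fun s => ψ s ∘ₗ h.part 2, fun s f => ?_, ?_⟩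
  · rw [LinearMap.comp_apply, LinearMap.comp_apply, h.part_part_self]
  · funext s
    refine LinearMap.ext fun f => ?_
    have hz : ∀ f, G.algCodiff z n (fun s => ψ s ∘ₗ h.part 2) s f =
        G.algCodiff z n ψ s (h.part 1 f) := by
      intro f
      simp only [G.algCodiff_apply]
      exact Finset.sum_congr rfl fun α _ => by rw [LinearMap.comp_apply, h.part_arrow_mul]
    rw [hz, ← hφ]
    refine h.part_one_induction (P := fun f => G.algCodiff z n ψ s f = φ s f) ?_ ?_ ?_ ?_ f
    · rw [map_zero, map_zero]
    · intro f g hf hg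
      rw [map_add, map_add, hf, hg]
    · intro c f hf
      rw [map_smul, map_smul, hf]
    · exact fun α => hψ ⟨s, α⟩

end

end IsGraded

end PathIdeal

/-- `g` factors through the range of `f`, and over a field the factor extends to `V`. -/
theorem LinearMap.exists_comp_eq_of_ker_le_ker {k U V W : Type*} [Field k] [AddCommGroup U]
    [Module k U] [AddCommGroup V] [Module k V] [AddCommGroup W] [Module k W] (f : U →ₗ[k] V)
    (g : U →ₗ[k] W) (hfg : LinearMap.ker f ≤ LinearMap.ker g) : ∃ e : V →ₗ[k] W, e ∘ₗ f = g := by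
  obtain ⟨e, he⟩ := LinearMap.exists_extend
    ((LinearMap.ker f).liftQ g hfg ∘ₗ f.quotKerEquivRange.symm.toLinearMap)
  refine ⟨e, LinearMap.ext fun u => ?_⟩
  have := LinearMap.congr_fun he ⟨f u, u, rfl⟩
  simp only [LinearMap.comp_apply, Submodule.subtype_apply, LinearEquiv.coe_coe] at this
  rw [LinearMap.comp_apply, this, LinearMap.quotKerEquivRange_symm_apply_image f u ⟨u, rfl⟩]
  rfl

namespace PathIdeal

variable {k : Type w} [Field k] {Q : Type u} [Quiver.{v + 1} Q] {R : PathIdeal k Q}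

/-! ### The simple modules `S_a` -/

variable (R) in
/-- The projection from `P_a` onto `S_a`. -/
def toSimple (a x : Q) : R.Alg a x →ₗ[k] (R.simple a).obj x := ((R.proj a).rad x).mkQ

theorem toSimple_surjective (a x : Q) : Function.Surjective (R.toSimple a x) :=
  Submodule.mkQ_surjective ((R.proj a).rad x)

namespace IsGraded

variable (h : R.IsGraded)

theorem mem_rad_proj {a x : Q} (f : R.Alg a x) :
    f ∈ (show Submodule k (R.Alg a x) from (R.proj a).rad x) ↔ h.part 0 f = 0 := by
  constructor
  · intro hf
    refine Submodule.iSup_induction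
      (fun α : Quiver.Costar x => LinearMap.range ((R.proj a).map α.2))
      (motive := fun f : R.Alg a x => h.part 0 f = 0) hf ?_ (map_zero _) ?_
    · rintro α _ ⟨g, rfl⟩
      exact h.part_zero_arrow_mul α.2 g
    · intro (f : R.Alg a x) (g : R.Alg a x) hf hg
      exact (map_add (h.part 0) f g).trans (by rw [hf, hg, add_zero])
  · intro hf
    refine h.mul_arrow_induction hf (zero_mem _) (fun _ _ => add_mem) fun α f => ?_
    exact BoundRep.map_mem_rad (R.proj a) α f

theorem toSimple_eq_zero {a x : Q} {f : R.Alg a x} : R.toSimple a x f = 0 ↔ h.part 0 f = 0 :=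
  (Submodule.Quotient.mk_eq_zero _).trans (h.mem_rad_proj f)

theorem toSimple_part (a x : Q) (f : R.Alg a x) :
    R.toSimple a x (h.part 0 f) = R.toSimple a x f := by
  rw [← sub_eq_zero, ← map_sub, h.toSimple_eq_zero, map_sub, h.part_part_self, sub_self]

include h in
theorem toSimple_one_ne_zero (a : Q) : R.toSimple a a (R.cls (PathSpace.one a)) ≠ 0 := by
  rw [Ne, h.toSimple_eq_zero, h.part_one]
  exact h.cls_one_ne_zero a

include h in
theorem simple_eq_zero_of_ne {a x : Q} (hax : a ≠ x) (s : (R.simple a).obj x) : s = 0 := by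
  obtain ⟨f, rfl⟩ := toSimple_surjective a x s
  rw [h.toSimple_eq_zero, h.part_zero_of_ne hax]

include h in
theorem exists_simple_eq_smul {a : Q} (s : (R.simple a).obj a) :
    ∃ c : k, s = c • R.toSimple a a (R.cls (PathSpace.one a)) := by
  obtain ⟨f, rfl⟩ := toSimple_surjective a a s
  obtain ⟨c, hc⟩ := h.exists_part_zero_eq f
  exact ⟨c, by rw [← h.toSimple_part, hc, map_smul]⟩

include h in
theorem isSimple_simple (a : Q) : (R.simple a).IsSimple := by
  refine ⟨⟨a, _, _, h.toSimple_one_ne_zero a⟩, fun N _ => ?_⟩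
  by_cases hN : N a = ⊥
  · refine Or.inl fun x => ?_
    by_cases hax : a = x
    · exact hax ▸ hN
    · exact (Submodule.eq_bot_iff _).2 fun s _ => h.simple_eq_zero_of_ne hax s
  · refine Or.inr fun x => ?_
    by_cases hax : a = x
    · subst hax
      obtain ⟨s, hs, hs0⟩ := (Submodule.ne_bot_iff _).1 hN
      obtain ⟨c, rfl⟩ := h.exists_simple_eq_smul s
      have hc : c ≠ 0 := by
        rintro rfl
        exact hs0 (zero_smul _ _)
      refine (Submodule.eq_top_iff').2 fun t => ?_
      obtain ⟨d, rfl⟩ := h.exists_simple_eq_smul t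
      have := Submodule.smul_mem _ (d * c⁻¹) hs
      rwa [smul_smul, inv_mul_cancel_right₀ hc] at this
    · refine (Submodule.eq_top_iff').2 fun s => ?_
      rw [h.simple_eq_zero_of_ne hax s]
      exact zero_mem _

theorem sumPart_sumPart_ne {m n : ℕ} (hmn : n ≠ m) {l : ℕ} (c : Fin l → Q) {x : Q}
    (p : (R.projSum c).obj x) : h.sumPart m c x (h.sumPart n c x p) = 0 := by
  apply projSum_ext
  intro j
  rw [coord_sumPart, coord_sumPart, h.part_part_ne hmn, map_zero]

/-! ### Exactness from linear resolutions -/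

variable [Quiver.LocallyFinite Q] {G : GradedOpRep.{u, v, w, w''} k Q}
  (hG : G.IsQuadraticallyPresented R)
include hG

/-- The bicomplex has terms ∏ₛ Hom(P^{-n}(s), Gₘ(s)) for a linear resolution of S_a. Precomposition
with the resolution and the Koszul differential both lower the internal degree by one, so the chase
applies in degrees j + 1, j + 2, j + 3. -/
theorem exactAt_add_two {j : ℕ} (hE : ∀ n, h.ExactAt G (j + 1) n)
    (hK : ∀ a, R.HasLinearProjectiveResolution (R.simple a)) (n : ℕ) : h.ExactAt G (j + 2) n := by
  classical
  intro a φ hφ hφ0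
  obtain ⟨m, c, d, ε, hε, hε0, hd, -, -, hlin⟩ := hK a
  have hεrad : ∀ {x} {p : (R.projSum (c 0)).obj x}, h.sumPart 0 (c 0) x p = 0 → ε.app x p = 0 :=
    fun hp => ε.app_of_mem_rad (fun α s => BoundRep.top_map _ α s) ((h.mem_rad_projSum _ _).2 hp)
  -- If no summand of P^0 were P_a, then P^0 would have no degree-zero part at the vertex a, so ε
  -- would vanish there and could not hit the generator of S_a.
  obtain ⟨i, hi⟩ : ∃ i, c 0 i = a := by
    by_contra hc
    push Not at hc
    obtain ⟨p, hp⟩ := hε a (R.toSimple a a (R.cls (PathSpace.one a)))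
    apply h.toSimple_one_ne_zero a
    rw [← hp, hεrad]
    refine projSum_ext fun j => ?_
    rw [coord_sumPart, h.part_zero_of_ne (hc j), map_zero]
  subst hi
  let C : ℕ → ℕ → Type _ := fun n m => ∀ s, (R.projSum (c n)).obj s →ₗ[k] G.obj m s
  -- The families that vanish on all homogeneous components of degree other than `l`.
  let D (l n m : ℕ) : Submodule k (C n m) :=
    { carrier := {φ | ∀ s p, φ s (h.sumPart l (c n) s p) = φ s p}
      zero_mem' := fun s p => rfl
      add_mem' := fun hφ hψ s p => congrArg₂ (· + ·) (hφ s p) (hψ s p)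
      smul_mem' := fun t φ hφ s p => congrArg (t • ·) (hφ s p) }
  let p (n m : ℕ) : C n m →ₗ[k] C (n + 1) m :=
    { toFun := fun φ s => φ s ∘ₗ (d n).app s
      map_add' := fun _ _ => rfl
      map_smul' := fun _ _ => rfl }
  have key := exact_of_bicomplex (C := C) (fun n m => G.codiff (R.projSum (c n)) m) p
    (fun n m φ => G.codiff_comp_hom (d n) m φ)
    (fun n m φ => hG.codiff_codiff _ m φ)
    (fun n m φ => by
      funext s
      refine LinearMap.ext fun q => ?_
      exact (congrArg (φ s) ((hd n s).apply_apply_eq_zero q)).trans (map_zero _))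
    (D (j + 1)) (D (j + 2)) (D (j + 3))
    (fun n m φ hφ s q => by
      change φ s ((d n).app s (h.sumPart _ _ s q)) = φ s ((d n).app s q)
      rw [← h.sumPart_of_isHomogeneous (hlin n)]
      exact hφ s _)
    (fun n m φ hφ s q => by
      change G.codiff _ m φ s _ = G.codiff _ m φ s _
      simp only [G.codiff_apply, ← h.sumPart_map]
      exact Finset.sum_congr rfl fun α _ => congrArg _ (hφ _ _))
    (fun n φ hφ h0 => by
      funext s
      refine LinearMap.ext fun q => ?_
      rw [← hφ s q]
      refine LinearMap.congr_fun (f := φ s ∘ₗ h.sumPart (j + 1) (c n) s) (g := 0)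
        (projSum_hom_ext fun l f => ?_) q
      rw [LinearMap.comp_apply, h.sumPart_incl]
      refine h.eq_zero_of_codiff hG (φ := fun s => φ s ∘ₗ R.incl (c n) l s) ?_ s _
        (h.part_part_ne (by omega) f)
      funext s
      refine LinearMap.ext fun f => ?_
      rw [← G.codiff_incl]
      exact LinearMap.congr_fun (congrFun h0 s) _)
    (fun n m φ hφ h0 => h.exists_codiff_projSum (hE m) (c n) φ hφ h0)
    (fun m φ hφ h0 => by
      funext s
      refine LinearMap.ext fun q => ?_
      rw [← hφ s q]
      -- Components of positive degree j + 2 lie in the radical, so ε kills them and they are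
      -- boundaries; this is why the resolved simple module does not enter the chase.
      obtain ⟨q', hq'⟩ := (hε0 s _).1 (hεrad (h.sumPart_sumPart_ne (n := j + 2) (by omega) (c 0) q))
      rw [← hq']
      exact LinearMap.congr_fun (congrFun h0 s) q')
    (fun n m φ hφ h0 => by
      have hk : ∀ s, LinearMap.ker ((d n).app s) ≤ LinearMap.ker (φ s) := by
        intro s q hq
        obtain ⟨q', rfl⟩ := (hd n s q).1 hq
        exact LinearMap.congr_fun (congrFun h0 s) q'
      choose e he using fun s => LinearMap.exists_comp_eq_of_ker_le_ker _ _ (hk s)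
      -- The linear factor `e` need not be homogeneous. Cutting it down to degree j + 3 is harmless,
      -- since `d n` raises degrees by one and `φ` lives in degree j + 2.
      refine ⟨fun s => e s ∘ₗ h.sumPart (j + 3) (c n) s, fun s q => ?_, ?_⟩
      · rw [LinearMap.comp_apply, LinearMap.comp_apply, h.sumPart_sumPart]
      · funext s
        refine LinearMap.ext fun q => ?_
        change e s (h.sumPart (j + 3) (c n) s ((d n).app s q)) = φ s q
        rw [h.sumPart_of_isHomogeneous (hlin n), ← LinearMap.comp_apply, he]
        exact hφ s q) n
  -- Extended by zero to the other summands of P^0, φ remains a cocycle; a preimage on P^0 is then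
  -- restricted to the summand P_a.
  obtain ⟨e, he, hre⟩ := key (fun s => φ s ∘ₗ R.coord (c 0) i s)
    (fun s q => by
      rw [LinearMap.comp_apply, LinearMap.comp_apply, coord_sumPart, hφ])
    (by
      funext s
      refine projSum_hom_ext fun l f => ?_
      rw [G.codiff_incl]
      by_cases hl : l = i
      · subst hl
        have : (fun s => (φ s ∘ₗ R.coord (c 0) l s) ∘ₗ R.incl (c 0) l s) = φ := by
          funext s
          refine LinearMap.ext fun f => ?_
          rw [LinearMap.comp_apply, LinearMap.comp_apply, coord_incl_self]
        rw [this, hφ0]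
        rfl
      · have : (fun s => (φ s ∘ₗ R.coord (c 0) i s) ∘ₗ R.incl (c 0) l s) = 0 := by
          funext s
          refine LinearMap.ext fun f => ?_
          rw [LinearMap.comp_apply, LinearMap.comp_apply, coord_incl_ne hl, map_zero]
          rfl
        rw [this, map_zero]
        rfl)
  refine ⟨fun s => e s ∘ₗ R.incl (c 0) i s, fun s f => ?_, ?_⟩
  · rw [LinearMap.comp_apply, LinearMap.comp_apply, ← h.sumPart_incl]
    exact he s _
  · funext s
    refine LinearMap.ext fun f => ?_
    rw [← G.codiff_incl]
    refine (LinearMap.congr_fun (congrFun hre s) _).trans ?_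
    rw [LinearMap.comp_apply, coord_incl_self]

theorem exactAt_of_isKoszul (hK : R.IsKoszul) (j n : ℕ) : h.ExactAt G j n := by
  match j with
  | 0 => exact h.exactAt_zero hG n
  | j + 1 =>
    induction j generalizing n with
    | zero => exact h.exactAt_one hG n
    | succ j ih => exact h.exactAt_add_two hG ih (fun a => hK _ (h.isSimple_simple a)) n

-- The equation is solved for each homogeneous component of φ. The j-th solution lives in degree j +
-- 1 of e_s Λ e_z, so only finitely many of them are nonzero at each s and they can be added.
omit hG in
theorem exists_algCodiff_eq (hE : ∀ j n, h.ExactAt G j n) (hfin : R.IsLocallyFiniteDimensional)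
    (z : Q) (n : ℕ) (φ : ∀ s, R.Alg z s →ₗ[k] G.obj (n + 1) s)
    (hφ : G.algCodiff z (n + 1) φ = 0) :
    ∃ ψ : ∀ s, R.Alg z s →ₗ[k] G.obj n s, G.algCodiff z n ψ = φ := by
  -- The components of a cocycle are cocycles, as left multiplication by arrows shifts the degree;
  -- for j = 0 products with arrows have no component at all.
  have hpart : ∀ j, G.algCodiff z (n + 1) (fun s => φ s ∘ₗ h.part j) = 0 := by
    intro j
    funext s
    refine LinearMap.ext fun f => ?_
    rw [G.algCodiff_apply]
    cases j with
    | zero =>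
      refine Finset.sum_eq_zero fun α _ => ?_
      rw [LinearMap.comp_apply, h.part_zero_arrow_mul, map_zero, map_zero]
    | succ j =>
      have := LinearMap.congr_fun (congrFun hφ s) (h.part j f)
      rw [G.algCodiff_apply] at this
      simp only [← h.part_arrow_mul] at this
      exact this
  choose ψ hψ₁ hψ₂ using fun j => hE j n z (fun s => φ s ∘ₗ h.part j)
    (fun s f => by rw [LinearMap.comp_apply, LinearMap.comp_apply, h.part_part_self]) (hpart j)
  choose N hN using fun s => h.exists_part_eq_zero hfin z s
  have hψN : ∀ s M, N s ≤ M → ∑ j ∈ Finset.range M, ψ j s = ∑ j ∈ Finset.range (N s), ψ j s := by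
    intro s M hM
    refine (Finset.sum_subset (Finset.range_subset_range.2 hM) fun j _ hj => ?_).symm
    refine LinearMap.ext fun f => ?_
    rw [← hψ₁, hN s (j + 1), map_zero, LinearMap.zero_apply]
    rw [Finset.mem_range] at hj
    omega
  refine ⟨fun s => ∑ j ∈ Finset.range (N s), ψ j s, ?_⟩
  funext s
  refine LinearMap.ext fun f => ?_
  obtain ⟨L, hL⟩ := h.exists_sum_part f
  -- A common cutoff, past the components of `f` and past the truncations at all endpoints of the
  -- arrows from `s`.
  let M := max L (max (N s) (Finset.univ.sup fun α : Quiver.Star s => N α.1))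
  have hM : ∀ α : Quiver.Star s, N α.1 ≤ M := fun α =>
    (Finset.le_sup (f := fun α : Quiver.Star s => N α.1) (Finset.mem_univ α)).trans
      ((le_max_right _ _).trans (le_max_right _ _))
  have hfM : ∑ j ∈ Finset.range M, h.part j f = f := by
    conv_rhs => rw [← hL]
    refine (Finset.sum_subset (Finset.range_subset_range.2 (le_max_left _ _))
      fun j _ hj => ?_).symm
    rw [← hL, map_sum]
    refine Finset.sum_eq_zero fun l hl => h.part_part_ne ?_ _
    rintro rfl
    exact hj hl
  rw [G.algCodiff_apply]
  calc _ = ∑ α : Quiver.Star s, ∑ j ∈ Finset.range M,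
        G.map n α.2 (ψ j α.1 (R.mul (R.arrow α.2) f)) := by
        refine Finset.sum_congr rfl fun α _ => ?_
        rw [← hψN α.1 M (hM α), LinearMap.sum_apply, map_sum]
    _ = ∑ j ∈ Finset.range M, φ s (h.part j f) := by
        rw [Finset.sum_comm]
        refine Finset.sum_congr rfl fun j _ => ?_
        rw [← G.algCodiff_apply, hψ₂, LinearMap.comp_apply]
    _ = φ s f := by rw [← map_sum, hfM]

end IsGraded

end PathIdeal

/-! ### Opposite paths and locally finite quivers -/

namespace Quiver.Path

variable {Q : Type u} [Quiver.{v + 1} Q]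

/-- A path read backwards as a path in the opposite quiver. -/
def opPath {x : Q} : ∀ {y : Q}, Quiver.Path x y → Quiver.Path (Opposite.op y) (Opposite.op x)
  | _, .nil => .nil
  | _, .cons p e => (Quiver.Hom.toPath e.op).comp p.opPath

theorem opPath_comp {x y z : Q} (p : Quiver.Path x y) (q : Quiver.Path y z) :
    (p.comp q).opPath = q.opPath.comp p.opPath := by
  induction q with
  | nil => simp [opPath]
  | cons q e ih => simp [opPath, ih]

theorem unopPath_opPath {x y : Q} (p : Quiver.Path x y) : p.opPath.unopPath = p := by
  induction p with
  | nil => rfl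
  | cons p e ih => rw [opPath, unopPath_comp, ih]; rfl

theorem opPath_unopPath {a b : Qᵒᵖ} (p : Quiver.Path a b) : p.unopPath.opPath = p := by
  induction p with
  | nil => rfl
  | cons p e ih => rw [unopPath, opPath_comp, ih]; rfl

theorem unopPath_injective {a b : Qᵒᵖ} :
    Function.Injective (unopPath : Quiver.Path a b → Quiver.Path b.unop a.unop) :=
  Function.LeftInverse.injective opPath_unopPath

theorem length_unopPath {a b : Qᵒᵖ} (p : Quiver.Path a b) : p.unopPath.length = p.length := by
  induction p with
  | nil => rfl
  | cons p e ih => rw [unopPath, length_comp, ih, length_cons, add_comm]; rfl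

end Quiver.Path

namespace Quiver.LocallyFinite

variable {Q : Type u} [Quiver.{v + 1} Q] [Quiver.LocallyFinite Q]

instance opposite : Quiver.LocallyFinite Qᵒᵖ where
  finite_star x :=
    have := Quiver.LocallyFinite.finite_costar x.unop
    Finite.of_surjective (α := Quiver.Costar x.unop) (fun α => ⟨Opposite.op α.1, α.2.op⟩)
      fun α => ⟨⟨α.1.unop, α.2.unop⟩, rfl⟩
  finite_costar x :=
    have := Quiver.LocallyFinite.finite_star x.unop
    Finite.of_surjective (α := Quiver.Star x.unop) (fun α => ⟨Opposite.op α.1, α.2.op⟩)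
      fun α => ⟨⟨α.1.unop, α.2.unop⟩, rfl⟩

theorem finite_paths_to (n : ℕ) (y : Q) :
    Finite {p : Σ x : Q, Quiver.Path x y // p.2.length = n} := by
  induction n generalizing y with
  | zero =>
    refine @Finite.of_subsingleton _ ⟨?_⟩
    rintro ⟨⟨x, p⟩, hp⟩ ⟨⟨x', p'⟩, hp'⟩
    cases p with
    | nil =>
      cases p' with
      | nil => rfl
      | cons p' e => simp at hp'
    | cons p e => simp at hp
  | succ n ih =>
    refine Finite.of_surjective (α := Σ e : Quiver.Costar y,
      {p : Σ x : Q, Quiver.Path x e.1 // p.2.length = n})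
      (fun q => ⟨⟨q.2.1.1, q.2.1.2.cons q.1.2⟩, by simp [q.2.2]⟩) ?_
    rintro ⟨⟨x, p⟩, hp⟩
    cases p with
    | nil => simp at hp
    | cons p e => exact ⟨⟨⟨_, e⟩, ⟨⟨x, p⟩, by simpa using hp⟩⟩, rfl⟩

theorem finite_paths (n : ℕ) (x y : Q) : {p : Quiver.Path x y | p.length = n}.Finite := by
  have := finite_paths_to n y
  refine Set.finite_coe_iff.1 (Finite.of_injective
    (β := {p : Σ x : Q, Quiver.Path x y // p.2.length = n}) (fun p => ⟨⟨x, p.1⟩, p.2⟩) ?_)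
  rintro ⟨p, hp⟩ ⟨q, hq⟩ hpq
  cases hpq
  rfl

theorem finite_paths_from (n : ℕ) (x : Q) :
    Finite {p : Σ y : Q, Quiver.Path x y // p.2.length = n} := by
  have := finite_paths_to n (Opposite.op x)
  refine Finite.of_injective
    (β := {p : Σ a : Qᵒᵖ, Quiver.Path a (Opposite.op x) // p.2.length = n})
    (fun p => ⟨⟨Opposite.op p.1.1, p.1.2.opPath⟩, ?_⟩) ?_
  · rw [← Quiver.Path.length_unopPath, Quiver.Path.unopPath_opPath, p.2]
  · rintro ⟨⟨y, p⟩, hp⟩ ⟨⟨z, q⟩, hq⟩ hpq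
    simp only [Subtype.mk.injEq, Sigma.mk.injEq, Opposite.op.injEq] at hpq
    obtain ⟨rfl, hpq⟩ := hpq
    have := congrArg Quiver.Path.unopPath (eq_of_heq hpq)
    rw [Quiver.Path.unopPath_opPath, Quiver.Path.unopPath_opPath] at this
    subst this
    rfl

end Quiver.LocallyFinite

namespace PathSpace

variable {k : Type w} [Field k] {Q : Type u} [Quiver.{v + 1} Q]

instance finiteDimensional_deg [Quiver.LocallyFinite Q] (n : ℕ) (x y : Q) :
    FiniteDimensional k (deg (k := k) n x y) := by
  rw [deg, Finsupp.supported_eq_span_single]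
  exact FiniteDimensional.span_of_finite k ((Quiver.LocallyFinite.finite_paths n x y).image _)

theorem unop_apply {a b : Qᵒᵖ} (γ : PathSpace k a b) (p : Quiver.Path a b) :
    unop γ p.unopPath = γ p :=
  Finsupp.mapDomain_apply Quiver.Path.unopPath_injective γ p

theorem unop_injective {a b : Qᵒᵖ} :
    Function.Injective (unop : PathSpace k a b →ₗ[k] PathSpace k b.unop a.unop) :=
  Finsupp.mapDomain_injective Quiver.Path.unopPath_injective

theorem unop_surjective {a b : Qᵒᵖ} :
    Function.Surjective (unop : PathSpace k a b →ₗ[k] PathSpace k b.unop a.unop) :=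
  Finsupp.mapDomain_surjective fun p => ⟨p.opPath, p.unopPath_opPath⟩

theorem part_unop (n : ℕ) {a b : Qᵒᵖ} (γ : PathSpace k a b) :
    part n (unop γ) = unop (part n γ) := by
  ext p
  rw [← p.unopPath_opPath, part_apply, unop_apply, unop_apply, part_apply,
    Quiver.Path.length_unopPath]

/-! ### Division of paths by their last arrow -/

/-- The coefficient of an arrow `e` in an element of the path algebra: it sends a path `e p` to `p`
and the other paths to zero. -/
def slice {x y z : Q} (e : y ⟶ z) : PathSpace k x z →ₗ[k] PathSpace k x y :=
  Finsupp.lcomapDomain (fun p => p.cons e) fun _ _ hpq =>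
    eq_of_heq (Quiver.Path.heq_of_cons_eq_cons hpq)

theorem slice_apply {x y z : Q} (e : y ⟶ z) (γ : PathSpace k x z) (p : Quiver.Path x y) :
    slice e γ p = γ (p.cons e) := rfl

theorem arrow_mul_eq_mapDomain {x y z : Q} (e : y ⟶ z) (γ : PathSpace k x y) :
    mul (arrow e) γ = Finsupp.mapDomain (fun p => p.cons e) γ := by
  simp [mul, arrow]

theorem slice_arrow_mul_self {x y z : Q} (e : y ⟶ z) (γ : PathSpace k x y) :
    slice e (mul (arrow e) γ) = γ := by
  ext p
  rw [slice_apply, arrow_mul_eq_mapDomain]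
  exact Finsupp.mapDomain_apply (fun _ _ hpq =>
    eq_of_heq (Quiver.Path.heq_of_cons_eq_cons hpq)) γ p

theorem slice_arrow_mul_ne {x y y' z : Q} {e : y ⟶ z} {e' : y' ⟶ z}
    (hne : (⟨y', e'⟩ : Quiver.Costar z) ≠ ⟨y, e⟩) (γ : PathSpace k x y') :
    slice e (mul (arrow e') γ) = 0 := by
  ext p
  rw [slice_apply, arrow_mul_eq_mapDomain, Finsupp.mapDomain_of_notMem_range]
  · rfl
  · rintro ⟨q, hq⟩
    obtain rfl := Quiver.Path.obj_eq_of_cons_eq_cons hq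
    exact hne (by rw [eq_of_heq (Quiver.Path.hom_heq_of_cons_eq_cons hq)])

theorem slice_mem_deg {n : ℕ} {x y z : Q} (e : y ⟶ z) {γ : PathSpace k x z}
    (hγ : γ ∈ deg (n + 1) x z) : slice e γ ∈ deg n x y := by
  rw [mem_deg_iff] at hγ ⊢
  intro p hp
  rw [slice_apply]
  exact hγ _ (by simpa using hp)

/-- In positive degree the last arrow of each product path is the last arrow of a path in γ. For
trivial paths γ the formula would fail. -/
theorem slice_mul {n : ℕ} {w x y z : Q} (e : y ⟶ z) {γ : PathSpace k x z}
    (hγ : γ ∈ deg (n + 1) x z) (δ : PathSpace k w x) :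
    slice e (mul γ δ) = mul (slice e γ) δ := by
  refine deg_succ_induction (P := fun γ => slice e (mul γ δ) = mul (slice e γ) δ) hγ ?_ ?_ ?_
  · simp
  · intro γ γ' h₁ h₂
    simp only [map_add, LinearMap.add_apply, h₁, h₂]
  · intro y' e' γ _
    rw [mul_assoc]
    by_cases hne : (⟨y', e'⟩ : Quiver.Costar z) = ⟨y, e⟩
    · cases hne
      rw [slice_arrow_mul_self, slice_arrow_mul_self]
    · rw [slice_arrow_mul_ne hne, slice_arrow_mul_ne hne, map_zero, LinearMap.zero_apply]

theorem op_mk_ne {s : Q} {α β : Quiver.Star s} (hαβ : α ≠ β) :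
    (⟨Opposite.op α.1, α.2.op⟩ : Quiver.Costar (Opposite.op s)) ≠ ⟨Opposite.op β.1, β.2.op⟩ := by
  obtain ⟨a, α⟩ := α
  obtain ⟨b, β⟩ := β
  intro h
  apply hαβ
  simp only [Sigma.mk.injEq, Opposite.op.injEq] at h
  obtain ⟨rfl, h⟩ := h
  have h' := congrArg Quiver.Hom.unop (eq_of_heq h)
  simp only [Quiver.Hom.unop_op] at h'
  rw [h']

section

variable [Quiver.LocallyFinite Q]

/-- Together with `sum_arrow_mul_slice`, this says that an element of positive degree in the free
algebra kQᵒ has unique left coefficients with respect to the arrows. -/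
theorem slice_sum_arrow_mul {a : Qᵒᵖ} {s : Q}
    (γ : ∀ α : Quiver.Star s, PathSpace k a (Opposite.op α.1)) (α : Quiver.Star s) :
    slice α.2.op (∑ β : Quiver.Star s, mul (arrow β.2.op) (γ β)) = γ α := by
  rw [map_sum, Finset.sum_eq_single_of_mem α (Finset.mem_univ α), slice_arrow_mul_self]
  exact fun β _ hβ => slice_arrow_mul_ne (op_mk_ne hβ) _

theorem sum_arrow_mul_slice {n : ℕ} {a : Qᵒᵖ} {s : Q} {γ : PathSpace k a (Opposite.op s)}
    (hγ : γ ∈ deg (n + 1) a (Opposite.op s)) :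
    ∑ α : Quiver.Star s, mul (arrow α.2.op) (slice α.2.op γ) = γ := by
  refine deg_succ_induction (P := fun γ =>
    ∑ α : Quiver.Star s, mul (arrow α.2.op) (slice α.2.op γ) = γ) hγ ?_ ?_ ?_
  · simp
  · intro γ γ' h₁ h₂
    simp only [map_add, Finset.sum_add_distrib, h₁, h₂]
  · intro y e γ _
    rw [Finset.sum_eq_single_of_mem (⟨y.unop, e.unop⟩ : Quiver.Star s) (Finset.mem_univ _)]
    · exact congrArg (mul (arrow e)) (slice_arrow_mul_self e γ)
    · intro β _ hβ
      rw [slice_arrow_mul_ne, map_zero]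
      exact op_mk_ne (α := ⟨y.unop, e.unop⟩) (Ne.symm hβ)

end

theorem slice_slice_of_ne {c s : Q} {ρ : PathSpace k (Opposite.op c) (Opposite.op s)}
    (hρ : ρ ∈ deg 2 (Opposite.op c) (Opposite.op s)) (α : Quiver.Star s) (β : Quiver.Star α.1)
    (hβ : c ≠ β.1) : slice β.2.op (slice α.2.op ρ) = 0 :=
  deg_zero_of_ne (fun h => hβ (Opposite.op_injective h)) (slice_mem_deg _ (slice_mem_deg _ hρ))

/-- Dividing an element of degree two by two arrows leaves a multiple of the trivial path, namely
one coefficient. -/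
theorem slice_slice_self {y z s : Q} (β : y ⟶ z) (α : s ⟶ y)
    {ρ : PathSpace k (Opposite.op z) (Opposite.op s)}
    (hρ : ρ ∈ deg 2 (Opposite.op z) (Opposite.op s)) :
    slice β.op (slice α.op ρ) = unop ρ (α.toPath.cons β) • one (Opposite.op z) := by
  rw [deg_zero_self (slice_mem_deg _ (slice_mem_deg _ hρ)), slice_apply, slice_apply,
    ← unop_apply ρ]
  rfl

/-- The pairing for which the paths are an orthonormal basis is symmetric. -/
theorem sum_mul_eq_linearCombination {x y : Q} (τ σ : PathSpace k x y) :
    (τ.sum fun p c => c * σ p) = Finsupp.linearCombination k (⇑τ) σ := by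
  classical
  induction σ using Finsupp.induction_linear with
  | zero => simp
  | add _ _ h₁ h₂ => rw [map_add, ← h₁, ← h₂, ← Finsupp.sum_add]; simp [mul_add]
  | single q d =>
    rw [Finsupp.linearCombination_single, Finsupp.sum, Finset.sum_eq_single q]
    · simp [mul_comm]
    · intro p _ hp
      simp [Finsupp.single_eq_of_ne hp]
    · intro hq
      simp [Finsupp.notMem_support_iff.1 hq]

end PathSpace

/-! ### Linear forms as pairings with homogeneous elements -/

namespace PathSpace

variable {k : Type w} [Field k] {Q : Type u} [Quiver.{v + 1} Q]

theorem unop_mem_deg {n : ℕ} {a b : Qᵒᵖ} {γ : PathSpace k a b} (hγ : γ ∈ deg n a b) :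
    unop γ ∈ deg n b.unop a.unop := by
  rw [← part_of_mem_deg hγ, ← part_unop]
  exact part_mem_deg n _

theorem linearCombination_part {n : ℕ} {x y : Q} {τ : PathSpace k x y} (hτ : τ ∈ deg n x y)
    (σ : PathSpace k x y) :
    Finsupp.linearCombination k (⇑τ) (part n σ) = Finsupp.linearCombination k (⇑τ) σ := by
  induction σ using Finsupp.induction_linear with
  | zero => simp
  | add _ _ h₁ h₂ => rw [map_add, map_add, map_add, h₁, h₂]
  | single p c =>
    by_cases hp : p.length = n
    · rw [part_of_mem_deg (hp ▸ single_mem_deg p c)]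
    · rw [part_of_mem_deg_ne (single_mem_deg p c) hp, map_zero, Finsupp.linearCombination_single,
        mem_deg_iff.1 hτ p hp, smul_zero]

/-- A linear form on the part of degree `n` is the pairing with an element of degree `n`. -/
theorem exists_linearCombination_eq [Quiver.LocallyFinite Q] (n : ℕ) {x y : Q}
    (l : PathSpace k x y →ₗ[k] k) :
    ∃ ρ ∈ deg (k := k) n (Opposite.op y) (Opposite.op x),
      ∀ σ, Finsupp.linearCombination k (⇑(unop ρ)) σ = l (part n σ) := by
  classical
  -- The values of the form on paths of length `n` are the coefficients of `ρ`; there are finitely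
  -- many by local finiteness of the quiver.
  have hfin : (Function.support fun p : Quiver.Path (Opposite.op y) (Opposite.op x) =>
      if p.length = n then l (Finsupp.single p.unopPath 1) else 0).Finite :=
    (Quiver.LocallyFinite.finite_paths n _ _).subset fun p hp => by
      by_contra h
      exact hp (if_neg h)
  refine ⟨Finsupp.ofSupportFinite _ hfin, mem_deg_iff.2 fun p hp => if_neg hp, fun σ => ?_⟩
  induction σ using Finsupp.induction_linear with
  | zero => simp
  | add _ _ h₁ h₂ => simp only [map_add, h₁, h₂]
  | single p c =>
    rw [Finsupp.linearCombination_single, ← p.unopPath_opPath, unop_apply,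
      Finsupp.ofSupportFinite_coe, ← Quiver.Path.length_unopPath, p.unopPath_opPath]
    split_ifs with hp
    · rw [part_of_mem_deg (hp ▸ single_mem_deg p c), ← map_smul, Finsupp.smul_single_one]
    · rw [part_of_mem_deg_ne (single_mem_deg p c) hp, map_zero, smul_zero]

end PathSpace

namespace PathIdeal

variable {k : Type w} [Field k] {Q : Type u} [Quiver.{v + 1} Q] (R : PathIdeal k Q)

/-! ### The quadratic dual as a graded representation of the opposite quiver -/

theorem finiteDimensional_algDeg [Quiver.LocallyFinite Q] (n : ℕ) (x y : Q) :
    FiniteDimensional k (R.algDeg n x y) := by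
  unfold algDeg
  infer_instance

/-- The graded left `Λ^!`-module `Λ^! e_b` as a graded representation of the opposite quiver. -/
def dualRep (b : Q) : GradedOpRep.{u, v, w, max u (v + 1) w} k Q where
  obj n s := R.quadraticDual.algDeg n (Opposite.op b) (Opposite.op s)
  addCommGroup _ _ := Submodule.addCommGroup _
  module _ _ := Submodule.module _
  map n _ _ α := R.quadraticDual.arrowMulDeg n (Opposite.op b) α.op

/-- The elements of `Λ^! e_b` as elements of the quadratic dual. -/
def dualRepVal (b : Q) (n : ℕ) (s : Q) :
    (R.dualRep b).obj n s →ₗ[k] R.quadraticDual.Alg (Opposite.op b) (Opposite.op s) :=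
  (R.quadraticDual.algDeg n (Opposite.op b) (Opposite.op s)).subtype

variable {R}

theorem dualRepVal_injective {b : Q} {n : ℕ} {s : Q} :
    Function.Injective (R.dualRepVal b n s) := Subtype.val_injective

theorem dualRepVal_map {b : Q} {n : ℕ} {s t : Q} (α : s ⟶ t) (x : (R.dualRep b).obj n t) :
    R.dualRepVal b (n + 1) s ((R.dualRep b).map n α x) =
      R.quadraticDual.mul (R.quadraticDual.arrow α.op) (R.dualRepVal b n t x) := rfl

theorem exists_cls_eq_dualRepVal {b : Q} {n : ℕ} {s : Q} (x : (R.dualRep b).obj n s) :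
    ∃ γ ∈ PathSpace.deg n (Opposite.op b) (Opposite.op s),
      R.quadraticDual.cls γ = R.dualRepVal b n s x := x.2

theorem exists_dualRepVal_eq {b : Q} {n : ℕ} {s : Q}
    {γ : PathSpace k (Opposite.op b) (Opposite.op s)}
    (hγ : γ ∈ PathSpace.deg n (Opposite.op b) (Opposite.op s)) :
    ∃ x, R.dualRepVal b n s x = R.quadraticDual.cls γ :=
  ⟨⟨_, γ, hγ, rfl⟩, rfl⟩

variable (R) in
/-- The projection of the quadratic dual onto its part of degree `n`. -/
def dualRepPart (b : Q) (n : ℕ) (s : Q) :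
    R.quadraticDual.Alg (Opposite.op b) (Opposite.op s) →ₗ[k] (R.dualRep b).obj n s :=
  (R.quadraticDual_isQuadratic.isGraded.part n).codRestrict
    (R.quadraticDual.algDeg n (Opposite.op b) (Opposite.op s))
    fun f => R.quadraticDual_isQuadratic.isGraded.part_mem_algDeg n f

theorem dualRepVal_part {b : Q} {n : ℕ} {s : Q}
    (f : R.quadraticDual.Alg (Opposite.op b) (Opposite.op s)) :
    R.dualRepVal b n s (R.dualRepPart b n s f) =
      R.quadraticDual_isQuadratic.isGraded.part n f := rfl

theorem mem_quadraticDual {c s : Q} {ρ : PathSpace k (Opposite.op c) (Opposite.op s)}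
    (hρ : ρ ∈ PathSpace.deg 2 (Opposite.op c) (Opposite.op s))
    (hρR : ∀ σ ∈ R.carrier s c, Finsupp.linearCombination k (⇑(PathSpace.unop ρ)) σ = 0) :
    ρ ∈ R.quadraticDual.carrier (Opposite.op c) (Opposite.op s) := by
  refine Submodule.subset_span ⟨_, _, PathSpace.one _, ρ, PathSpace.one _,
    ⟨hρ, fun σ hσ _ => ?_⟩, by simp⟩
  rw [PathSpace.sum_mul_eq_linearCombination]
  exact hρR σ hσ

section

variable [Quiver.LocallyFinite Q]

/-- The slices reassemble to ρ, so the sum is the product of the class of ρ with x, and this class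
is zero in Λ^!. -/
theorem sum_mul_slice_slice {a : Qᵒᵖ} {s c : Q} {ρ : PathSpace k (Opposite.op c) (Opposite.op s)}
    (hρ : ρ ∈ PathSpace.deg 2 (Opposite.op c) (Opposite.op s))
    (hρR : ρ ∈ R.quadraticDual.carrier (Opposite.op c) (Opposite.op s))
    (x : R.quadraticDual.Alg a (Opposite.op c)) :
    ∑ α : Quiver.Star s, ∑ β : Quiver.Star α.1,
      R.quadraticDual.mul (R.quadraticDual.arrow α.2.op)
        (R.quadraticDual.mul (R.quadraticDual.arrow β.2.op)
          (R.quadraticDual.mul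
            (R.quadraticDual.cls (PathSpace.slice β.2.op (PathSpace.slice α.2.op ρ))) x)) = 0 := by
  have h0 : R.quadraticDual.cls ρ = 0 := (Submodule.Quotient.mk_eq_zero _).2 hρR
  have : R.quadraticDual.mul (R.quadraticDual.cls ρ) x = 0 := by
    rw [h0, map_zero, LinearMap.zero_apply]
  rw [← this]
  conv_rhs => rw [← PathSpace.sum_arrow_mul_slice hρ]
  rw [map_sum, map_sum, LinearMap.sum_apply]
  refine Finset.sum_congr rfl fun α _ => ?_
  conv_rhs => rw [← PathSpace.sum_arrow_mul_slice (PathSpace.slice_mem_deg α.2.op hρ)]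
  rw [map_sum, map_sum, map_sum, LinearMap.sum_apply]
  refine Finset.sum_congr rfl fun β _ => ?_
  rw [← mul_assoc, ← mul_assoc, arrow, arrow, mul_cls, mul_cls, PathSpace.mul_assoc]

variable (h : R.IsGraded)
include h

/-- The double differential at u is the sum of αᵒβᵒ φ(βαu) over paths of length two. In a basis of
Λ^!_n e_b, the coordinates of γ ↦ φ(γu) are linear forms vanishing on R; restricted to degree two
they are pairings with elements of R^!. The sum is therefore a combination of products with
relations of Λ^!. -/
theorem dualRep_codiff_codiff (b : Q) (M : BoundRep.{u, v, w, w'} R) (n : ℕ)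
    (φ : ∀ s, M.obj s →ₗ[k] (R.dualRep b).obj n s) :
    (R.dualRep b).codiff M (n + 1) ((R.dualRep b).codiff M n φ) = 0 := by
  classical
  funext s
  refine LinearMap.ext fun u => dualRepVal_injective ?_
  rw [GradedOpRep.codiff_apply, map_sum]
  have hfd : ∀ y, FiniteDimensional k ((R.dualRep b).obj n y) := fun y =>
    R.quadraticDual.finiteDimensional_algDeg n _ _
  let ι : Q → Type := fun y => Fin (Module.finrank k ((R.dualRep b).obj n y))
  let B : ∀ y, Module.Basis (ι y) k ((R.dualRep b).obj n y) := fun y =>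
    Module.finBasis k ((R.dualRep b).obj n y)
  -- The map γ ↦ φ(γu) on the path algebra; it kills R because M is a Λ-module.
  let χ : ∀ y, PathSpace k s y →ₗ[k] (R.dualRep b).obj n y := fun y =>
    φ y ∘ₗ (PathSpace.eval M.map).flip u
  have hχR : ∀ y, ∀ σ ∈ R.carrier s y, χ y σ = 0 := by
    intro y σ hσ
    simp only [χ, LinearMap.comp_apply, LinearMap.flip_apply, M.eval_eq_zero σ hσ,
      LinearMap.zero_apply, map_zero]
  choose ρ hρ hρχ using fun y i => PathSpace.exists_linearCombination_eq 2 ((B y).coord i ∘ₗ χ y)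
  have hρR : ∀ y i, ρ y i ∈ R.quadraticDual.carrier (Opposite.op y) (Opposite.op s) :=
    fun y i => mem_quadraticDual (hρ y i) fun σ hσ => by
      rw [hρχ, LinearMap.comp_apply, hχR y _ (h.part_mem 2 hσ), map_zero]
  -- The endpoints of the paths of length two from `s`: summing over this fixed finite set lets the
  -- relation be moved outside the sum over paths.
  let Y : Finset Q := Finset.univ.image fun t : Σ α : Quiver.Star s, Quiver.Star α.1 => t.2.1
  have key : ∀ (α : Quiver.Star s) (β : Quiver.Star α.1),
      R.dualRepVal b n β.1 (φ β.1 (M.map β.2 (M.map α.2 u))) =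
        ∑ t ∈ Y.sigma fun y => (Finset.univ : Finset (ι y)), R.quadraticDual.mul
          (R.quadraticDual.cls (PathSpace.slice β.2.op (PathSpace.slice α.2.op (ρ t.1 t.2))))
          (R.dualRepVal b n t.1 (B t.1 t.2)) := by
    intro α β
    rw [Finset.sum_sigma, Finset.sum_eq_single_of_mem β.1
      (Finset.mem_image.2 ⟨⟨α, β⟩, Finset.mem_univ _, rfl⟩)]
    · have hφ : φ β.1 (M.map β.2 (M.map α.2 u)) =
          χ β.1 (Finsupp.single (α.2.toPath.cons β.2) 1) := by
        simp [χ, PathSpace.eval, Quiver.Path.eval, Quiver.Hom.toPath]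
      rw [hφ, ← (B β.1).sum_repr (χ β.1 _), map_sum]
      refine Finset.sum_congr rfl fun i _ => ?_
      have hc := hρχ β.1 i (Finsupp.single (α.2.toPath.cons β.2) 1)
      have h2 : (Finsupp.single (α.2.toPath.cons β.2) 1 : PathSpace k s β.1) ∈
          PathSpace.deg 2 s β.1 := PathSpace.single_mem_deg _ _
      rw [Finsupp.linearCombination_single, one_smul, PathSpace.part_of_mem_deg h2] at hc
      rw [PathSpace.slice_slice_self β.2 α.2 (hρ _ i), hc, map_smul, map_smul, map_smul,
        LinearMap.smul_apply, one_mul]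
      rfl
    · intro y _ hy
      refine Finset.sum_eq_zero fun i _ => ?_
      rw [PathSpace.slice_slice_of_ne (hρ y i) α β hy, map_zero, map_zero, LinearMap.zero_apply]
  calc _ = ∑ α : Quiver.Star s, ∑ β : Quiver.Star α.1,
        ∑ t ∈ Y.sigma fun y => (Finset.univ : Finset (ι y)),
        R.quadraticDual.mul (R.quadraticDual.arrow α.2.op)
          (R.quadraticDual.mul (R.quadraticDual.arrow β.2.op) (R.quadraticDual.mul
            (R.quadraticDual.cls (PathSpace.slice β.2.op (PathSpace.slice α.2.op (ρ t.1 t.2))))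
            (R.dualRepVal b n t.1 (B t.1 t.2)))) := by
        refine Finset.sum_congr rfl fun α _ => ?_
        rw [dualRepVal_map, GradedOpRep.codiff_apply, map_sum, map_sum]
        refine Finset.sum_congr rfl fun β _ => ?_
        rw [dualRepVal_map, key, map_sum, map_sum]
    _ = 0 := by
        rw [Finset.sum_congr rfl fun α _ => Finset.sum_comm, Finset.sum_comm]
        exact Finset.sum_eq_zero fun t _ => sum_mul_slice_slice (hρ _ _) (hρR _ _) _

/-- Writing σ = ∑ αᵒσ_α, the relation σ should come from relations of length two at its left end. By
linearity only the generators ζρδ matter: a nontrivial path ζ contributes nothing to the classes of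
the slices, and for trivial ζ the element ρ, being orthogonal to R, is a linear form on Λ from which
ψ is built. -/
theorem exists_of_mem_quadraticDual (b : Qᵒᵖ) (s : Q)
    {σ : PathSpace k b (Opposite.op s)} (hσ : σ ∈ R.quadraticDual.carrier b (Opposite.op s)) :
    ∃ ψ : ∀ y, R.Alg s y →ₗ[k] R.quadraticDual.Alg b (Opposite.op y), ∀ α : Quiver.Star s,
      ∑ β : Quiver.Star α.1, R.quadraticDual.mul (R.quadraticDual.arrow β.2.op)
        (ψ β.1 (R.mul (R.arrow β.2) (R.arrow α.2))) =
          R.quadraticDual.cls (PathSpace.slice α.2.op σ) := by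
  classical
  induction hσ using Submodule.span_induction with
  | zero => exact ⟨0, by simp⟩
  | add σ τ _ _ h₁ h₂ =>
    obtain ⟨ψ, hψ⟩ := h₁
    obtain ⟨θ, hθ⟩ := h₂
    refine ⟨ψ + θ, fun α => ?_⟩
    rw [map_add, map_add, ← hψ, ← hθ, ← Finset.sum_add_distrib]
    refine Finset.sum_congr rfl fun β _ => ?_
    rw [Pi.add_apply, LinearMap.add_apply, map_add]
  | smul c σ _ h =>
    obtain ⟨ψ, hψ⟩ := h
    refine ⟨c • ψ, fun α => ?_⟩
    rw [map_smul, map_smul, ← hψ, Finset.smul_sum]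
    refine Finset.sum_congr rfl fun β _ => ?_
    rw [Pi.smul_apply, LinearMap.smul_apply, map_smul]
  | mem σ h =>
    obtain ⟨b', c', ζ, ρ, δ, ⟨hρ, hρR⟩, rfl⟩ := h
    induction ζ using Finsupp.induction_linear with
    | zero => exact ⟨0, by simp⟩
    | add ζ ζ' h₁ h₂ =>
      obtain ⟨ψ, hψ⟩ := h₁
      obtain ⟨θ, hθ⟩ := h₂
      refine ⟨ψ + θ, fun α => ?_⟩
      rw [map_add, LinearMap.add_apply, map_add, map_add, ← hψ, ← hθ, ← Finset.sum_add_distrib]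
      refine Finset.sum_congr rfl fun β _ => ?_
      rw [Pi.add_apply, LinearMap.add_apply, map_add]
    | single p a =>
      cases p with
      | cons p e =>
        -- When ζ = e p, each slice is zero or a multiple of p ρ δ, which already lies in R^!; so ψ
        -- = 0 works.
        refine ⟨0, fun α => ?_⟩
        have he : (Finsupp.single (p.cons e) a : PathSpace k c' (Opposite.op s)) =
            PathSpace.mul (PathSpace.arrow e) (Finsupp.single p a) := by
          rw [PathSpace.arrow, PathSpace.mul_single, _root_.one_mul]
          rfl
        have hz : ∀ β : Quiver.Star α.1, R.quadraticDual.mul (R.quadraticDual.arrow β.2.op)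
            ((0 : ∀ y, R.Alg s y →ₗ[k] R.quadraticDual.Alg b (Opposite.op y)) β.1
              (R.mul (R.arrow β.2) (R.arrow α.2))) = 0 := fun β => by
          rw [Pi.zero_apply, LinearMap.zero_apply, map_zero]
        rw [Finset.sum_eq_zero fun β _ => hz β, he, PathSpace.mul_assoc, eq_comm]
        by_cases hne : (⟨_, e⟩ : Quiver.Costar (Opposite.op s)) = ⟨Opposite.op α.1, α.2.op⟩
        · cases hne
          rw [PathSpace.slice_arrow_mul_self]
          exact (Submodule.Quotient.mk_eq_zero _).2
            (Submodule.subset_span ⟨_, _, _, ρ, δ, ⟨hρ, hρR⟩, rfl⟩)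
        · rw [PathSpace.slice_arrow_mul_ne hne, map_zero]
      | nil =>
        obtain ⟨c⟩ := b'
        have hl : ∀ σ ∈ R.carrier s c,
            Finsupp.linearCombination k (⇑(PathSpace.unop ρ)) σ = 0 := by
          intro σ hσ
          rw [← PathSpace.linearCombination_part (PathSpace.unop_mem_deg hρ),
            ← PathSpace.sum_mul_eq_linearCombination]
          exact hρR _ (h.part_mem 2 hσ) (PathSpace.part_mem_deg 2 σ)
        -- Pairing with ρ, well defined on Λ by orthogonality. The witness is then u ↦ a l(u) δ at
        -- the vertex c and zero elsewhere.
        let l : R.Alg s c →ₗ[k] k := Submodule.liftQ _ _ hl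
        refine ⟨Pi.single c ((a • l).smulRight (R.quadraticDual.cls δ)), fun α => ?_⟩
        have ha : PathSpace.mul (Finsupp.single Quiver.Path.nil a) (PathSpace.mul ρ δ) =
            a • PathSpace.mul ρ δ := by
          rw [← Finsupp.smul_single_one, map_smul, LinearMap.smul_apply]
          exact congrArg (a • ·) (PathSpace.one_mul _)
        rw [ha, map_smul, map_smul, PathSpace.slice_mul _ hρ,
          ← PathSpace.sum_arrow_mul_slice (PathSpace.slice_mem_deg α.2.op hρ), map_sum,
          LinearMap.sum_apply, map_sum, Finset.smul_sum]
        refine Finset.sum_congr rfl fun β _ => ?_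
        rw [PathSpace.mul_assoc, ← mul_cls, ← map_smul]
        refine congrArg _ ?_
        obtain ⟨y, β⟩ := β
        by_cases hy : c = y
        · subst hy
          rw [Pi.single_eq_same, PathSpace.slice_slice_self β α.2 hρ, map_smul,
            LinearMap.smul_apply, PathSpace.one_mul, map_smul, smul_smul]
          have hla : l (R.mul (R.arrow β) (R.arrow α.2)) =
              PathSpace.unop ρ (α.2.toPath.cons β) := by
            rw [arrow, arrow, mul_cls, PathSpace.arrow, PathSpace.arrow, PathSpace.mul_single,
              _root_.mul_one]
            change Finsupp.linearCombination k (⇑(PathSpace.unop ρ)) (Finsupp.single _ 1) = _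
            rw [Finsupp.linearCombination_single, one_smul]
            rfl
          rw [← hla]
          rfl
        · rw [Pi.single_eq_of_ne (Ne.symm hy), PathSpace.slice_slice_of_ne hρ α ⟨y, β⟩ hy,
            map_zero, LinearMap.zero_apply, LinearMap.zero_apply, map_zero, smul_zero]

/-- Relations among left multiples by arrows are lifted to kQᵒ, where coefficients are unique. In
degree one the lift is zero since R^! begins in degree two; in higher degree it lies in R^! and the
preceding lemma applies. -/
theorem isQuadraticallyPresented_dualRep (b : Q) :
    (R.dualRep b).IsQuadraticallyPresented R where
  codiff_codiff M n φ := dualRep_codiff_codiff h b M n φ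
  eq_zero_of_sum s x hx := by
    choose γ hγ hγx using fun α => exists_cls_eq_dualRepVal (x α)
    have h0 := congrArg (R.dualRepVal b 1 s) hx
    rw [map_sum, map_zero] at h0
    simp only [dualRepVal_map, ← hγx, arrow, mul_cls, ← map_sum] at h0
    have h1 := R.quadraticDual_isQuadratic.isGraded.part_eq_zero (n := 1) (by omega)
      ((Submodule.Quotient.mk_eq_zero _).1 h0)
    rw [PathSpace.part_of_mem_deg
      (sum_mem fun α _ => PathSpace.arrow_mul_mem_deg _ (hγ α))] at h1
    intro α
    apply dualRepVal_injective
    rw [← hγx, ← PathSpace.slice_sum_arrow_mul γ α, h1, map_zero, map_zero, map_zero]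
  exists_of_sum n s x hx := by
    choose γ hγ hγx using fun α => exists_cls_eq_dualRepVal (x α)
    have h0 := congrArg (R.dualRepVal b (n + 2) s) hx
    rw [map_sum, map_zero] at h0
    simp only [dualRepVal_map, ← hγx, arrow, mul_cls, ← map_sum] at h0
    obtain ⟨ψ, hψ⟩ := exists_of_mem_quadraticDual h (Opposite.op b) s
      ((Submodule.Quotient.mk_eq_zero _).1 h0)
    have hB := R.quadraticDual_isQuadratic.isGraded
    -- The values of ψ need not be homogeneous; since the slices are, passing to degree n in ψ
    -- preserves the equation.
    refine ⟨fun y => R.dualRepPart b n y ∘ₗ ψ y, fun α => dualRepVal_injective ?_⟩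
    have hα := congrArg (hB.part (n + 1)) (hψ α)
    rw [PathSpace.slice_sum_arrow_mul, hγx, ← hγx, hB.part_cls,
      PathSpace.part_of_mem_deg (hγ α), hγx, map_sum] at hα
    rw [← hα, GradedOpRep.algCodiff_apply, map_sum]
    refine Finset.sum_congr rfl fun β _ => ?_
    rw [dualRepVal_map, LinearMap.comp_apply, dualRepVal_part, hB.part_arrow_mul]
  exists_sum_eq n s x := by
    obtain ⟨γ, hγ, hγx⟩ := exists_cls_eq_dualRepVal x
    choose y hy using fun α : Quiver.Star s =>
      exists_dualRepVal_eq (R := R) (PathSpace.slice_mem_deg α.2.op hγ)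
    refine ⟨y, dualRepVal_injective ?_⟩
    rw [map_sum, ← hγx]
    conv_rhs => rw [← PathSpace.sum_arrow_mul_slice hγ]
    rw [map_sum]
    refine Finset.sum_congr rfl fun α _ => ?_
    rw [dualRepVal_map, hy]
    rfl

end

end PathIdeal

/-! ### The action of `Λ` on a module -/

theorem Quiver.Path.eval_comp {k : Type w} [Field k] {Q : Type u} [Quiver.{v + 1} Q]
    {M : Q → Type w'} [∀ x, AddCommGroup (M x)] [∀ x, Module k (M x)]
    (f : ∀ {x y : Q}, (x ⟶ y) → M x →ₗ[k] M y) {x y z : Q} (p : Quiver.Path x y)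
    (q : Quiver.Path y z) : (p.comp q).eval f = q.eval f ∘ₗ p.eval f := by
  induction q with
  | nil => rfl
  | cons q e ih => rw [Quiver.Path.comp_cons, Quiver.Path.eval, ih]; rfl

theorem PathSpace.eval_mul {k : Type w} [Field k] {Q : Type u} [Quiver.{v + 1} Q]
    {M : Q → Type w'} [∀ x, AddCommGroup (M x)] [∀ x, Module k (M x)]
    (f : ∀ {x y : Q}, (x ⟶ y) → M x →ₗ[k] M y) {x y z : Q} (γ : PathSpace k y z)
    (δ : PathSpace k x y) (m : M x) :
    PathSpace.eval f (PathSpace.mul γ δ) m = PathSpace.eval f γ (PathSpace.eval f δ m) := by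
  induction γ using Finsupp.induction_linear with
  | zero => simp
  | add _ _ h₁ h₂ => simp only [map_add, LinearMap.add_apply, h₁, h₂]
  | single p c =>
    induction δ using Finsupp.induction_linear with
    | zero => simp
    | add _ _ h₁ h₂ => simp only [map_add, LinearMap.add_apply, h₁, h₂]
    | single q d =>
      rw [mul_single]
      simp only [PathSpace.eval, Finsupp.linearCombination_single, LinearMap.smul_apply,
        Quiver.Path.eval_comp, LinearMap.comp_apply, map_smul, smul_smul, mul_comm c d]

namespace BoundRep

variable {k : Type w} [Field k] {Q : Type u} [Quiver.{v + 1} Q] {R : PathIdeal k Q}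
  (M : BoundRep.{u, v, w, w'} R)

/-- The action of `Λ` on a module. -/
def act {x y : Q} : R.Alg x y →ₗ[k] M.obj x →ₗ[k] M.obj y :=
  Submodule.liftQ _ (PathSpace.eval M.map) M.eval_eq_zero

theorem act_mul {x y z : Q} (f : R.Alg y z) (g : R.Alg x y) (m : M.obj x) :
    M.act (R.mul f g) m = M.act f (M.act g m) := by
  obtain ⟨γ, rfl⟩ := Submodule.mkQ_surjective _ f
  obtain ⟨δ, rfl⟩ := Submodule.mkQ_surjective _ g
  exact PathSpace.eval_mul M.map γ δ m

theorem act_arrow {x y : Q} (α : x ⟶ y) (m : M.obj x) : M.act (R.arrow α) m = M.map α m := by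
  change PathSpace.eval M.map (PathSpace.arrow α) m = _
  simp [PathSpace.eval, PathSpace.arrow, Quiver.Hom.toPath, Quiver.Path.eval]

theorem act_one {x : Q} (m : M.obj x) : M.act (R.cls (PathSpace.one x)) m = m := by
  change PathSpace.eval M.map (PathSpace.one x) m = _
  simp [PathSpace.eval, PathSpace.one, Quiver.Path.eval]

variable {M} in
theorem Hom.app_act {N : BoundRep.{u, v, w, w''} R} (φ : M.Hom N) {x y : Q} (f : R.Alg x y)
    (m : M.obj x) : φ.app y (M.act f m) = N.act f (φ.app x m) := by
  obtain ⟨γ, rfl⟩ := Submodule.mkQ_surjective _ f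
  exact (PathSpace.eval_natural M.map N.map φ.app (fun α m => (φ.naturality α m).symm) γ m).symm

variable {M} in
theorem act_eq_zero (hM : ∀ {x y : Q} (α : x ⟶ y) (m : M.obj x), M.map α m = 0)
    (h : R.IsGraded) {x y : Q} {f : R.Alg x y} (hf : h.part 0 f = 0) (m : M.obj x) :
    M.act f m = 0 := by
  refine h.mul_arrow_induction (P := fun f => M.act f m = 0) hf ?_ ?_ ?_
  · rw [map_zero, LinearMap.zero_apply]
  · intro f g hf hg
    rw [map_add, LinearMap.add_apply, hf, hg, add_zero]
  · intro z α f
    rw [act_mul, act_arrow, hM]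

variable {M} in
theorem act_part_zero (hM : ∀ {x y : Q} (α : x ⟶ y) (m : M.obj x), M.map α m = 0)
    (h : R.IsGraded) {x y : Q} (f : R.Alg x y) (m : M.obj x) :
    M.act (h.part 0 f) m = M.act f m := by
  rw [← sub_eq_zero, ← LinearMap.sub_apply, ← map_sub]
  exact act_eq_zero hM h (by rw [map_sub, h.part_part_self, sub_self]) m

end BoundRep

namespace PathIdeal

variable {k : Type w} [Field k] {Q : Type u} [Quiver.{v + 1} Q] (R : PathIdeal k Q)

/-! ### The part of degree zero of the quadratic dual -/

variable {R} in
theorem dualRep_zero_of_ne {a x : Q} (hax : a ≠ x) (f : (R.dualRep a).obj 0 x) : f = 0 := by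
  apply dualRepVal_injective
  obtain ⟨γ, hγ, hγf⟩ := exists_cls_eq_dualRepVal f
  rw [← hγf, PathSpace.deg_zero_of_ne (fun h => hax (Opposite.op_injective h)) hγ, map_zero,
    map_zero]

theorem finrank_dualRep_zero (a : Q) : Module.finrank k ((R.dualRep a).obj 0 a) = 1 := by
  obtain ⟨e, he⟩ := exists_dualRepVal_eq (R := R) (PathSpace.one_mem_deg (Opposite.op a))
  refine finrank_eq_one e ?_ fun f => ?_
  · rintro rfl
    rw [map_zero] at he
    exact R.quadraticDual_isQuadratic.isGraded.cls_one_ne_zero _ he.symm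
  · obtain ⟨γ, hγ, hγf⟩ := exists_cls_eq_dualRepVal f
    refine ⟨γ Quiver.Path.nil, dualRepVal_injective ?_⟩
    rw [map_smul, he, ← hγf, ← map_smul, ← PathSpace.deg_zero_self hγ]

variable {R} in
-- Both sides are one-dimensional at a and zero elsewhere.
theorem IsGraded.exists_simple_equiv (h : R.IsGraded) (a x : Q) :
    Nonempty ((R.simple a).obj x ≃ₗ[k] (R.dualRep a).obj 0 x) := by
  by_cases hax : a = x
  · subst hax
    have h₁ : Module.finrank k ((R.simple a).obj a) = 1 :=
      finrank_eq_one _ (h.toSimple_one_ne_zero a) fun s => by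
        obtain ⟨c, hc⟩ := h.exists_simple_eq_smul s
        exact ⟨c, hc.symm⟩
    have h₂ := R.finrank_dualRep_zero a
    have := Module.finite_of_finrank_eq_succ h₁
    have := Module.finite_of_finrank_eq_succ h₂
    exact ⟨LinearEquiv.ofFinrankEq _ _ (h₁.trans h₂.symm)⟩
  · refine ⟨LinearEquiv.ofBijective 0 ⟨fun s t _ => ?_, fun f => ⟨0, ?_⟩⟩⟩
    · rw [h.simple_eq_zero_of_ne hax s, h.simple_eq_zero_of_ne hax t]
    · rw [dualRep_zero_of_ne hax f, map_zero]

/-- Λ^!_n e_a lives only at the ends of the finitely many opposite paths of length n starting at a.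
-/
theorem finite_nontrivial_dualRep [Quiver.LocallyFinite Q] (a : Q) (n : ℕ) :
    {x | Nontrivial ((R.dualRep a).obj n x)}.Finite := by
  have := Quiver.LocallyFinite.finite_paths_from n (Opposite.op a)
  refine (Set.finite_range fun p : {p : Σ y : Qᵒᵖ, Quiver.Path (Opposite.op a) y //
    p.2.length = n} => p.1.1.unop).subset fun x hx => ?_
  obtain ⟨f, hf⟩ := @exists_ne _ hx 0
  by_contra hp
  apply hf
  apply dualRepVal_injective
  obtain ⟨γ, hγ, hγf⟩ := exists_cls_eq_dualRepVal f
  have : γ = 0 := by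
    ext p
    exact PathSpace.mem_deg_iff.1 hγ p fun hl => hp ⟨⟨⟨_, p⟩, hl⟩, rfl⟩
  rw [← hγf, this, map_zero, map_zero]

/-! ### The modules `T_a^n` as spaces of linear maps -/

/-- The components of an element of `T_a^n`. -/
def coresCoord (a : Q) (n : ℕ) (x z : Q) :
    (R.coresObj a n).obj z →ₗ[k] Module.Dual k (R.Alg z x) ⊗[k] (R.dualRep a).obj n x :=
  BoundRep.component (R.coresSummand a n) x z

/-- The inclusions of the summands of `T_a^n`. -/
def coresIncl (a : Q) (n : ℕ) (x z : Q) :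
    Module.Dual k (R.Alg z x) ⊗[k] (R.dualRep a).obj n x →ₗ[k] (R.coresObj a n).obj z :=
  BoundRep.summand (R.coresSummand a n) x z

/-- An element `∑ f ⊗ b` of `T_a^n` as a family of linear maps `u ↦ ∑ f(u) b`. -/
def coresToHom (a : Q) (n : ℕ) (z : Q) :
    (R.coresObj a n).obj z →ₗ[k] ∀ x, R.Alg z x →ₗ[k] (R.dualRep a).obj n x :=
  LinearMap.pi fun x => dualTensorHom k (R.Alg z x) ((R.dualRep a).obj n x) ∘ₗ R.coresCoord a n x z

variable {R}

theorem coresToHom_incl_self (a : Q) (n : ℕ) (z x : Q)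
    (t : Module.Dual k (R.Alg z x) ⊗[k] (R.dualRep a).obj n x) :
    R.coresToHom a n z (R.coresIncl a n x z t) x = dualTensorHom k (R.Alg z x) _ t :=
  congrArg (dualTensorHom k (R.Alg z x) ((R.dualRep a).obj n x))
    (BoundRep.component_summand_self (R.coresSummand a n) x t)

theorem coresToHom_incl_ne {a : Q} {n : ℕ} {z x y : Q} (hxy : x ≠ y)
    (t : Module.Dual k (R.Alg z x) ⊗[k] (R.dualRep a).obj n x) :
    R.coresToHom a n z (R.coresIncl a n x z t) y = 0 :=
  (congrArg (dualTensorHom k (R.Alg z y) ((R.dualRep a).obj n y))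
    (BoundRep.component_summand_ne (R.coresSummand a n) hxy t)).trans (map_zero _)

theorem cores_hom_ext {a : Q} {n : ℕ} {z : Q} {V : Type*} [AddCommGroup V] [Module k V]
    {f g : (R.coresObj a n).obj z →ₗ[k] V}
    (hfg : ∀ x p b, f (R.coresIncl a n x z (p ⊗ₜ b)) = g (R.coresIncl a n x z (p ⊗ₜ b))) :
    f = g := by
  refine BoundRep.directSum_ext (R.coresSummand a n) fun x t => ?_
  refine LinearMap.congr_fun (f := f ∘ₗ R.coresIncl a n x z) (g := g ∘ₗ R.coresIncl a n x z) ?_ t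
  exact TensorProduct.ext' fun p b => hfg x p b

theorem coresIncl_map (a : Q) (n : ℕ) {y z x : Q} (α : y ⟶ z) (p : Module.Dual k (R.Alg y x))
    (b : (R.dualRep a).obj n x) :
    (R.coresObj a n).map α (R.coresIncl a n x y (p ⊗ₜ b)) =
      R.coresIncl a n x z ((p ∘ₗ R.mul.flip (R.arrow α)) ⊗ₜ b) :=
  BoundRep.map_summand (R.coresSummand a n) α x _

theorem coresToHom_map (a : Q) (n : ℕ) {y z : Q} (α : y ⟶ z) (t : (R.coresObj a n).obj y) (x : Q)
    (f : R.Alg z x) :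
    R.coresToHom a n z ((R.coresObj a n).map α t) x f =
      R.coresToHom a n y t x (R.mul f (R.arrow α)) := by
  refine LinearMap.congr_fun (f := LinearMap.applyₗ f ∘ₗ LinearMap.proj x ∘ₗ
    R.coresToHom a n z ∘ₗ (R.coresObj a n).map α) (g := LinearMap.applyₗ (R.mul f (R.arrow α)) ∘ₗ
    LinearMap.proj x ∘ₗ R.coresToHom a n y) (cores_hom_ext fun x' p b => ?_) t
  simp only [LinearMap.comp_apply, LinearMap.proj_apply, LinearMap.applyₗ_apply_apply]
  rw [coresIncl_map]
  by_cases hx : x' = x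
  · subst hx
    rw [coresToHom_incl_self, coresToHom_incl_self, dualTensorHom_apply, dualTensorHom_apply]
    rfl
  · rw [coresToHom_incl_ne hx, coresToHom_incl_ne hx]
    rfl

/-- In terms of linear maps, Λ acts on T_a^n by right multiplication on the argument. -/
theorem coresToHom_act (a : Q) (n : ℕ) {y z : Q} (g : R.Alg y z) (t : (R.coresObj a n).obj y)
    (x : Q) (f : R.Alg z x) :
    R.coresToHom a n z ((R.coresObj a n).act g t) x f = R.coresToHom a n y t x (R.mul f g) := by
  obtain ⟨γ, rfl⟩ := Submodule.mkQ_surjective _ g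
  induction γ using Finsupp.induction_linear with
  | zero => simp
  | add γ δ h₁ h₂ =>
    rw [map_add, map_add, LinearMap.add_apply, map_add, Pi.add_apply, LinearMap.add_apply, h₁, h₂,
      map_add, map_add]
  | single p c =>
    rw [← Finsupp.smul_single_one]
    simp only [map_smul, LinearMap.smul_apply, Pi.smul_apply]
    congr 1
    induction p with
    | nil =>
      have h₁ := (R.coresObj a n).act_one t
      have h₂ := R.mul_one f
      exact (congrArg (fun t => R.coresToHom a n y t x f) h₁).trans
        (congrArg (R.coresToHom a n y t x) h₂.symm)
    | cons p e ih =>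
      have he : R.cls (Finsupp.single (p.cons e) 1) =
          R.mul (R.arrow e) (R.cls (Finsupp.single p 1)) := by
        rw [arrow, mul_cls, PathSpace.arrow, PathSpace.mul_single, _root_.mul_one]
        rfl
      rw [he, BoundRep.act_mul, BoundRep.act_arrow, coresToHom_map, ih, mul_assoc]

section

variable [Quiver.LocallyFinite Q]

/-- V^* ⊗ W is Hom(V, W) for V = e_x Λ e_z of finite dimension, and the direct sum over x is a
product because Λ^!_n e_a vanishes at almost all vertices. -/
theorem coresToHom_bijective (hfin : R.IsLocallyFiniteDimensional) (a : Q) (n : ℕ) (z : Q) :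
    Function.Bijective (R.coresToHom a n z) := by
  have := hfin z
  have hb : ∀ x, Function.Bijective (dualTensorHom k (R.Alg z x) ((R.dualRep a).obj n x)) :=
    fun x => (dualTensorHomEquiv k (R.Alg z x) ((R.dualRep a).obj n x)).bijective
  constructor
  · intro s t hst
    refine DFinsupp.ext fun x => ?_
    exact (hb x).1 (congrFun hst x)
  · intro f
    choose t ht using fun x => (hb x).2 (f x)
    refine ⟨∑ x ∈ (R.finite_nontrivial_dualRep a n).toFinset, R.coresIncl a n x z (t x), ?_⟩
    funext y
    rw [map_sum, Finset.sum_apply]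
    by_cases hy : y ∈ (R.finite_nontrivial_dualRep a n).toFinset
    · rw [Finset.sum_eq_single_of_mem y hy fun x _ hx => coresToHom_incl_ne hx _,
        coresToHom_incl_self, ht]
    · rw [Finset.sum_eq_zero fun x hx => coresToHom_incl_ne ?_ _]
      · rw [Set.Finite.mem_toFinset, Set.mem_ofPred_eq, not_nontrivial_iff_subsingleton] at hy
        exact LinearMap.ext fun _ => Subsingleton.elim _ _
      · rintro rfl
        exact hy hx

theorem coresDiffApp_incl (a : Q) (n : ℕ) (z x : Q) (p : Module.Dual k (R.Alg z x))
    (b : (R.dualRep a).obj n x) :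
    R.coresDiffApp a n z (R.coresIncl a n x z (p ⊗ₜ b)) = ∑ α : Quiver.Costar x,
      R.coresIncl a (n + 1) α.1 z ((p ∘ₗ R.mul (R.arrow α.2)) ⊗ₜ (R.dualRep a).map n α.2 b) := by
  refine (BoundRep.desc_summand (R.coresSummand a n) _ x _).trans ?_
  rw [finsum_eq_sum_of_fintype]
  exact LinearMap.sum_apply _ _ _

theorem coresToHom_diff (a : Q) (n : ℕ) (z : Q) (t : (R.coresObj a n).obj z) :
    R.coresToHom a (n + 1) z (R.coresDiffApp a n z t) =
      (R.dualRep a).algCodiff z n (R.coresToHom a n z t) := by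
  classical
  refine LinearMap.congr_fun (f := R.coresToHom a (n + 1) z ∘ₗ R.coresDiffApp a n z)
    (g := (R.dualRep a).algCodiff z n ∘ₗ R.coresToHom a n z) (cores_hom_ext fun x p b => ?_) t
  funext y
  refine LinearMap.ext fun f => ?_
  rw [LinearMap.comp_apply, LinearMap.comp_apply, coresDiffApp_incl, GradedOpRep.algCodiff_apply,
    map_sum, Finset.sum_apply, LinearMap.sum_apply]
  have hi : Function.Injective fun α : y ⟶ x => (⟨y, α⟩ : Quiver.Costar x) := fun α β h => by
    simpa using h
  have hi' : Function.Injective fun α : y ⟶ x => (⟨x, α⟩ : Quiver.Star y) := fun α β h => by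
    simpa using h
  -- The left sum runs over arrows ending at x, the right one over arrows starting at y. As the
  -- element sits in the summand x and the comparison is made at y, both reduce to the arrows from y
  -- to x.
  have := Fintype.ofInjective _ hi
  refine (Fintype.sum_of_injective _ hi
    (fun α => p (R.mul (R.arrow α) f) • (R.dualRep a).map n α b) _ ?_ ?_).symm.trans
    (Fintype.sum_of_injective _ hi' _ _ ?_ ?_)
  · rintro ⟨y', α⟩ hα
    rw [coresToHom_incl_ne, LinearMap.zero_apply]
    rintro rfl
    exact hα ⟨α, rfl⟩
  · intro α
    rw [coresToHom_incl_self, dualTensorHom_apply]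
    rfl
  · rintro ⟨x', α⟩ hα
    rw [coresToHom_incl_ne, LinearMap.zero_apply, map_zero]
    rintro rfl
    exact hα ⟨α, rfl⟩
  · intro α
    rw [coresToHom_incl_self, dualTensorHom_apply, map_smul]

variable (R) in
/-- The complexes `∏ₛ Hom(e_s Λ e_z, e_s Λ^!_n e_b)` are exact in positive degrees. -/
def DualExact : Prop :=
  ∀ (b z : Q) (n : ℕ) (φ : ∀ s, R.Alg z s →ₗ[k] (R.dualRep b).obj (n + 1) s),
    (R.dualRep b).algCodiff z (n + 1) φ = 0 →
      ∃ ψ : ∀ s, R.Alg z s →ₗ[k] (R.dualRep b).obj n s, (R.dualRep b).algCodiff z n ψ = φ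

/-- T_a^n is coinduced: a family of linear maps g gives the morphism m ↦ (u ↦ g(um)). -/
theorem exists_hom_coresObj (hfin : R.IsLocallyFiniteDimensional) (a : Q) (n : ℕ)
    (X : BoundRep.{u, v, w, w'} R) (g : ∀ x, X.obj x →ₗ[k] (R.dualRep a).obj n x) :
    ∃ f : X.Hom (R.coresObj a n), ∀ z (m : X.obj z) x (u : R.Alg z x),
      R.coresToHom a n z (f.app z m) x u = g x (X.act u m) := by
  let e := fun z => LinearEquiv.ofBijective _ (R.coresToHom_bijective hfin a n z)
  let f : ∀ z, X.obj z →ₗ[k] (R.coresObj a n).obj z := fun z =>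
    (e z).symm.toLinearMap ∘ₗ LinearMap.pi fun x => (X.act.flip).compr₂ (g x)
  have hf : ∀ z (m : X.obj z) x (u : R.Alg z x),
      R.coresToHom a n z (f z m) x u = g x (X.act u m) := by
    intro z m x u
    have : R.coresToHom a n z (f z m) = fun x => X.act.flip.compr₂ (g x) m :=
      (e z).apply_symm_apply _
    rw [this]
    rfl
  refine ⟨⟨f, fun {y z} α m => (R.coresToHom_bijective hfin a n z).1 ?_⟩, hf⟩
  funext x
  refine LinearMap.ext fun u => ?_
  rw [coresToHom_map, hf, hf, BoundRep.act_mul, BoundRep.act_arrow]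

/-- A morphism into a coinduced module is determined by its evaluations at the elements e_x. These
are plain linear maps, which extend along injections, and the extensions define a morphism. -/
theorem isInjective_coresObj (hfin : R.IsLocallyFiniteDimensional) (a : Q) (n : ℕ) :
    (R.coresObj a n).IsInjective := by
  intro X Y j hj f
  choose g hg using fun x => LinearMap.exists_comp_eq_of_ker_le_ker (j.app x)
    (LinearMap.applyₗ (R.cls (PathSpace.one x)) ∘ₗ LinearMap.proj x ∘ₗ
      R.coresToHom a n x ∘ₗ f.app x) (by
        rw [LinearMap.ker_eq_bot.2 (hj x)]
        exact bot_le)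
  obtain ⟨f', hf'⟩ := exists_hom_coresObj hfin a n Y g
  refine ⟨f', fun z m => (R.coresToHom_bijective hfin a n z).1 ?_⟩
  funext x
  refine LinearMap.ext fun u => ?_
  rw [hf', ← j.app_act]
  refine (LinearMap.congr_fun (hg x) (X.act u m)).trans ?_
  change R.coresToHom a n x (f.app x (X.act u m)) x (R.cls (PathSpace.one x)) = _
  rw [f.app_act, coresToHom_act, one_mul]

theorem exact_coresDiff_iff (h : R.IsGraded) (hfin : R.IsLocallyFiniteDimensional) :
    (∀ a n z, Function.Exact ((R.coresDiff a n).app z) ((R.coresDiff a (n + 1)).app z)) ↔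
      R.DualExact := by
  constructor
  · intro hex a z n φ hφ
    obtain ⟨t, rfl⟩ := (R.coresToHom_bijective hfin a (n + 1) z).2 φ
    rw [← coresToHom_diff] at hφ
    obtain ⟨s, hs⟩ := (hex a n z t).1
      ((R.coresToHom_bijective hfin a (n + 2) z).1 (hφ.trans (map_zero _).symm))
    refine ⟨R.coresToHom a n z s, ?_⟩
    rw [← coresToHom_diff]
    exact congrArg _ hs
  · intro hex a n z t
    constructor
    · intro ht
      have h0 : (R.dualRep a).algCodiff z (n + 1) (R.coresToHom a (n + 1) z t) = 0 := by
        rw [← coresToHom_diff]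
        exact (congrArg _ ht).trans (map_zero _)
      obtain ⟨ψ, hψ⟩ := hex a z n _ h0
      obtain ⟨s, rfl⟩ := (R.coresToHom_bijective hfin a n z).2 ψ
      refine ⟨s, (R.coresToHom_bijective hfin a (n + 1) z).1 ?_⟩
      rw [← hψ, ← coresToHom_diff]
      rfl
    · rintro ⟨s, rfl⟩
      apply (R.coresToHom_bijective hfin a (n + 2) z).1
      refine (coresToHom_diff a (n + 1) z _).trans ?_
      refine (congrArg _ (coresToHom_diff a n z s)).trans ?_
      rw [map_zero]
      exact (isQuadraticallyPresented_dualRep h a).codiff_codiff (R.proj z) n _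

/-- The kernel of d^0 consists of the families vanishing in positive degree. At z such a family is
determined by its value at e_z, an element of the degree-zero part of Λ^! e_a, which is isomorphic
to S_a. -/
theorem exists_simple_hom_coresObj (h : R.IsGraded) (hfin : R.IsLocallyFiniteDimensional) (a : Q) :
    ∃ ι : (R.simple a).Hom (R.coresObj a 0), (∀ x, Function.Injective (ι.app x)) ∧
      ∀ x, Function.Exact (ι.app x) ((R.coresDiff a 0).app x) := by
  let e := fun x => (h.exists_simple_equiv a x).some
  have hS : ∀ {x y : Q} (α : x ⟶ y) (m : (R.simple a).obj x), (R.simple a).map α m = 0 :=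
    fun α m => BoundRep.top_map _ α m
  obtain ⟨ι, hι⟩ := exists_hom_coresObj hfin a 0 (R.simple a) fun x => (e x).toLinearMap
  refine ⟨ι, fun z s t hst => ?_, fun z t => ⟨fun ht => ?_, ?_⟩⟩
  · apply (e z).injective
    have h₁ := hι z s z (R.cls (PathSpace.one z))
    have h₂ := hι z t z (R.cls (PathSpace.one z))
    rw [BoundRep.act_one] at h₁ h₂
    exact h₁.symm.trans ((by rw [hst]) : _ = _) |>.trans h₂
  · have h0 : (R.dualRep a).algCodiff z 0 (R.coresToHom a 0 z t) = 0 := by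
      rw [← coresToHom_diff]
      exact (congrArg _ ht).trans (map_zero _)
    refine ⟨(e z).symm (R.coresToHom a 0 z t z (R.cls (PathSpace.one z))),
      (R.coresToHom_bijective hfin a 0 z).1 ?_⟩
    funext x
    refine LinearMap.ext fun u => ?_
    have hu : R.coresToHom a 0 z t x u = R.coresToHom a 0 z t x (h.part 0 u) := by
      rw [← sub_eq_zero, ← map_sub]
      exact h.eq_zero_of_codiff (isQuadraticallyPresented_dualRep h a) h0 x _
        (by rw [map_sub, h.part_part_self, sub_self])
    rw [hι, hu, ← BoundRep.act_part_zero hS h]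
    refine h.part_zero_induction (P := fun x u => (e x).toLinearMap ((R.simple a).act u
      ((e z).symm (R.coresToHom a 0 z t z (R.cls (PathSpace.one z))))) =
        R.coresToHom a 0 z t x u) ?_ ?_ x u
    · intro x
      rw [map_zero, LinearMap.zero_apply, map_zero, map_zero]
    · intro c
      rw [map_smul, LinearMap.smul_apply, BoundRep.act_one, map_smul, map_smul]
      exact congrArg (c • ·) ((e z).apply_symm_apply _)
  · rintro ⟨s, rfl⟩
    apply (R.coresToHom_bijective hfin a 1 z).1
    refine (coresToHom_diff a 0 z _).trans ?_
    rw [map_zero]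
    funext x
    refine LinearMap.ext fun u => ?_
    rw [GradedOpRep.algCodiff_apply]
    refine Finset.sum_eq_zero fun α _ => ?_
    rw [hι, BoundRep.act_mul, BoundRep.act_arrow, hS, map_zero, map_zero]

theorem isInjectiveCoresolution_iff (h : R.IsGraded) (hfin : R.IsLocallyFiniteDimensional) :
    (∀ a : Q, (R.simple a).IsInjectiveCoresolution (R.coresObj a) (R.coresDiff a)) ↔
      R.DualExact := by
  rw [← exact_coresDiff_iff h hfin]
  constructor
  · intro hT a
    obtain ⟨-, -, -, -, hex⟩ := hT a
    exact hex
  · intro hex a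
    obtain ⟨ι, hι₁, hι₂⟩ := exists_simple_hom_coresObj h hfin a
    exact ⟨isInjective_coresObj hfin a, ι, hι₁, hι₂, hex a⟩

end

end PathIdeal

/-! ### Finite families of basis vectors over the vertices -/

instance Quiver.LocallyFinite.fintypeHom {Q : Type u} [Quiver.{v + 1} Q] [Quiver.LocallyFinite Q]
    (x y : Q) : Fintype (x ⟶ y) :=
  Fintype.ofInjective (fun α : x ⟶ y => (⟨y, α⟩ : Quiver.Star x)) fun α β h => by simpa using h

theorem Module.Basis.repr_sum_smulRight {ι k A V : Type*} [Fintype ι] [Field k] [AddCommGroup A]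
    [Module k A] [AddCommGroup V] [Module k V] (B : Module.Basis ι k V) (φ : ι → A →ₗ[k] k) (u : A)
    (i : ι) : B.repr ((∑ i, (φ i).smulRight (B i)) u) i = φ i u := by
  rw [LinearMap.sum_apply]
  exact congrFun (B.repr_sum_self fun i => φ i u) i

/-- Bases of all members of a family of finite-dimensional vector spaces, almost all of which are
zero, as a finite family of vectors and coordinate forms. -/
theorem exists_finite_family_basis {k : Type w} [Field k] {Q : Type u} [Quiver.{v + 1} Q]
    [Quiver.LocallyFinite Q] {V : Q → Type w'} [∀ x, AddCommGroup (V x)] [∀ x, Module k (V x)]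
    [∀ x, FiniteDimensional k (V x)] (hV : {x | Nontrivial (V x)}.Finite) :
    ∃ (m : ℕ) (c : Fin m → Q) (b : ∀ j, V (c j)) (ξ : ∀ j, V (c j) →ₗ[k] k),
      (∀ x (v : V x), (∀ j (hj : x = c j), ξ j (hj ▸ v) = 0) → v = 0) ∧
      (∀ (A : Q → Type (max u (v + 1) w)) [∀ x, AddCommGroup (A x)] [∀ x, Module k (A x)]
        (φ : ∀ j, A (c j) →ₗ[k] k), ∃ f : ∀ x, A x →ₗ[k] V x, ∀ j, ξ j ∘ₗ f (c j) = φ j) ∧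
      (∀ (y : Q) (H : ∀ α : Quiver.Costar y, V α.1 →ₗ[k] k) (v : ∀ α : Quiver.Costar y, V α.1),
        ∑ α, H α (v α) =
          ∑ j, ∑ α : c j ⟶ y, ξ j (v ⟨c j, α⟩) * H ⟨c j, α⟩ (b j)) ∧
      (∀ a, (∀ x, a ≠ x → Subsingleton (V x)) → Module.finrank k (V a) = 1 →
        ∃ j₀, c j₀ = a ∧ ∀ j, j = j₀) := by
  classical
  obtain ⟨X, hX₁, hX⟩ : ∃ X : Finset Q, (∀ x ∈ X, Nontrivial (V x)) ∧
      ∀ x, x ∉ X → Subsingleton (V x) :=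
    ⟨hV.toFinset, fun x hx => hV.mem_toFinset.1 hx, fun x hx => not_nontrivial_iff_subsingleton.1
      fun h => hx (hV.mem_toFinset.2 h)⟩
  obtain ⟨B⟩ : Nonempty (∀ x, Module.Basis (Fin (Module.finrank k (V x))) k (V x)) :=
    ⟨fun x => Module.finBasis k (V x)⟩
  have e := (Fintype.equivFin (Σ x : X, Fin (Module.finrank k (V x)))).symm
  -- The indices enumerate all basis vectors at the vertices in the support. The first two clauses
  -- will make the pairing with a sum of projectives injective and surjective, the third transposes
  -- the differential, and the last identifies the degree-zero term with a single P_a.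
  refine ⟨_, fun j => (e j).1, fun j => B _ (e j).2, fun j => (B _).coord (e j).2,
    fun x v hv => ?_, fun A _ _ φ => ?_, fun y H v => ?_, fun a ha ha₁ => ?_⟩
  · by_cases hx : x ∈ X
    · have hv' : ∀ (q : Σ x : X, Fin (Module.finrank k (V x))) (hq : x = q.1),
          (B _).coord q.2 (hq ▸ v) = 0 := by
        intro q
        obtain ⟨j, rfl⟩ := e.surjective q
        exact hv j
      exact (B x).forall_coord_eq_zero_iff.1 fun i => hv' ⟨⟨x, hx⟩, i⟩ rfl
    · exact (hX _ hx).elim _ _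
  · obtain ⟨φ', hφ'⟩ : ∃ φ' : ∀ x (_ : x ∈ X) (_ : Fin (Module.finrank k (V x))), A x →ₗ[k] k,
        ∀ j, φ' (e j).1 (e j).1.2 (e j).2 = φ j :=
      ⟨fun x hx i => Equiv.piCongrLeft
          (fun q : Σ x : X, Fin (Module.finrank k (V x)) => A q.1 →ₗ[k] k) e φ ⟨⟨x, hx⟩, i⟩,
        fun j => Equiv.piCongrLeft_apply_apply
          (fun q : Σ x : X, Fin (Module.finrank k (V x)) => A q.1 →ₗ[k] k) e φ j⟩
    refine ⟨fun x => if hx : x ∈ X then ∑ i, (φ' x hx i).smulRight (B x i) else 0, fun j => ?_⟩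
    rw [← hφ']
    have key : ∀ x (hx : x ∈ X) (i : Fin (Module.finrank k (V x))), (B x).coord i ∘ₗ
        (if hx : x ∈ X then ∑ i, (φ' x hx i).smulRight (B x i) else 0) = φ' x hx i := by
      intro x hx i
      rw [dif_pos hx]
      exact LinearMap.ext fun u => (B x).repr_sum_smulRight (φ' x hx) u i
    exact key _ (e j).1.2 (e j).2
  · have hinj : Function.Injective fun α : Σ x : X, x.1 ⟶ y => (⟨α.1, α.2⟩ : Quiver.Costar y) := by
      rintro ⟨⟨x, hx⟩, α⟩ ⟨⟨x', hx'⟩, α'⟩ hα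
      cases hα
      rfl
    refine Eq.trans ?_ (Equiv.sum_comp e fun q : Σ x : X, Fin (Module.finrank k (V x)) =>
      ∑ α : q.1.1 ⟶ y,
      (B q.1).coord q.2 (v ⟨q.1, α⟩) * H ⟨q.1, α⟩ (B q.1 q.2)).symm
    have hsum : ∑ α : Σ x : X, x.1 ⟶ y, H ⟨α.1, α.2⟩ (v ⟨α.1, α.2⟩) = ∑ α, H α (v α) := by
      refine Fintype.sum_of_injective _ hinj _ _ ?_ fun _ => rfl
      intro α hα
      have : α.1 ∉ X := fun hx => hα ⟨⟨⟨α.1, hx⟩, α.2⟩, rfl⟩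
      rw [(hX _ this).elim (v α) 0, map_zero]
    rw [← hsum, Fintype.sum_sigma, Fintype.sum_sigma]
    refine Finset.sum_congr rfl fun x _ => ?_
    change _ = ∑ i, ∑ α : x.1 ⟶ y, (B x).coord i (v ⟨x, α⟩) * H ⟨x, α⟩ (B x i)
    rw [Finset.sum_comm]
    refine Finset.sum_congr rfl fun α _ => ?_
    refine (congrArg (H ⟨x, α⟩) ((B x).sum_repr (v ⟨x, α⟩)).symm).trans ?_
    rw [map_sum]
    refine Finset.sum_congr rfl fun i _ => ?_
    rw [map_smul, smul_eq_mul]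
    rfl
  · have haX : a ∈ X := by
      by_contra hx
      have := hX _ hx
      rw [Module.finrank_zero_of_subsingleton] at ha₁
      exact zero_ne_one ha₁
    refine ⟨e.symm ⟨⟨a, haX⟩, ⟨0, ha₁.symm ▸ Nat.one_pos⟩⟩, ?_, fun j => ?_⟩
    · change ((e _).1 : Q) = a
      rw [e.apply_symm_apply]
    rw [Equiv.eq_symm_apply]
    generalize e j = q
    obtain ⟨⟨x, hx⟩, i⟩ := q
    have hxa : a = x := by
      by_contra hax
      have := ha x hax
      exact not_nontrivial _ (hX₁ x hx)
    subst hxa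
    have : Subsingleton (Fin (Module.finrank k (V a))) := by
      rw [ha₁]
      infer_instance
    exact congrArg (Sigma.mk _) (Subsingleton.elim _ _)

namespace PathIdeal

variable {k : Type w} [Field k] {Q : Type u} [Quiver.{v + 1} Q] {R : PathIdeal k Q}

/-! ### Simple modules -/

/-- For 0 ≠ s in S(a), the submodules Λ_{≥n}s decrease from S, and each is zero or S. They cannot
all be S: e_a Λ e_a is zero in large degrees, so s would be zero. At the last n with Λ_{≥n}s = S the
next one is zero, whence the arrows kill S and S is spanned by s. -/
theorem IsGraded.exists_of_isSimple (h : R.IsGraded) (hfin : R.IsLocallyFiniteDimensional)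
    {S : BoundRep.{u, v, w, w'} R} (hS : S.IsSimple) :
    (∀ {x y : Q} (α : x ⟶ y) (m : S.obj x), S.map α m = 0) ∧
      ∃ a, (∀ x, a ≠ x → ∀ t : S.obj x, t = 0) ∧
        ∃ s : S.obj a, s ≠ 0 ∧ ∀ t, ∃ c : k, t = c • s := by
  obtain ⟨⟨a, ha⟩, hsub⟩ := hS
  obtain ⟨s, hs⟩ := exists_ne (0 : S.obj a)
  -- The submodule Λ_{≥n}s; each arrow maps it into the next one.
  let N : ℕ → ∀ x, Submodule k (S.obj x) := fun n x =>
    (⨅ j : Fin n, LinearMap.ker (h.part (x := a) (y := x) j)).map (S.act.flip s)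
  have hmem : ∀ {n x} {f : R.Alg a x}, (∀ j < n, h.part j f = 0) → S.act f s ∈ N n x := by
    intro n x f hf
    refine ⟨f, ?_, rfl⟩
    rw [SetLike.mem_coe, Submodule.mem_iInf]
    exact fun j => hf j j.2
  have hN : ∀ n x t, t ∈ N n x → ∃ f : R.Alg a x, (∀ j < n, h.part j f = 0) ∧ S.act f s = t := by
    rintro n x t ⟨f, hf, rfl⟩
    rw [SetLike.mem_coe, Submodule.mem_iInf] at hf
    exact ⟨f, fun j hj => hf ⟨j, hj⟩, rfl⟩
  have hmap : ∀ n {x y : Q} (α : x ⟶ y), ∀ t ∈ N n x, S.map α t ∈ N (n + 1) y := by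
    intro n x y α t ht
    obtain ⟨f, hf, rfl⟩ := hN n x t ht
    rw [← S.act_arrow, ← S.act_mul]
    refine hmem fun j hj => ?_
    cases j with
    | zero => exact h.part_zero_arrow_mul α f
    | succ j => rw [h.part_arrow_mul, hf j (by omega), map_zero]
  have hle : ∀ n x, N (n + 1) x ≤ N n x := by
    intro n x t ht
    obtain ⟨f, hf, rfl⟩ := hN _ x t ht
    exact hmem fun j hj => hf j (by omega)
  have hNsub : ∀ n, (∀ x, N n x = ⊥) ∨ (∀ x, N n x = ⊤) := fun n =>
    hsub (N n) fun α t ht => hle n _ (hmap n α t ht)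
  have htop : ∀ x, N 0 x = ⊤ := by
    refine (hNsub 0).resolve_left fun hb => hs ?_
    have : S.act (R.cls (PathSpace.one a)) s ∈ N 0 a := hmem fun j hj => absurd hj (by omega)
    rw [hb a, S.act_one] at this
    exact this
  obtain ⟨L, hL⟩ := h.exists_part_eq_zero hfin a a
  have hLbot : ¬ ∀ x, N L x = ⊤ := by
    intro ht
    have hst : s ∈ N L a := by
      rw [ht a]
      exact Submodule.mem_top
    obtain ⟨f, hf, hfs⟩ := hN L a s hst
    obtain ⟨M, hM⟩ := h.exists_sum_part f
    apply hs
    rw [← hfs, ← hM, Finset.sum_eq_zero, map_zero, LinearMap.zero_apply]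
    intro j _
    by_cases hj : j < L
    · exact hf j hj
    · exact hL j (by omega) f
  have hbot : ∃ n, ¬ ∀ x, N n x = ⊤ := ⟨L, hLbot⟩
  classical
  obtain ⟨n, hn⟩ : ∃ n, Nat.find hbot = n + 1 :=
    Nat.exists_eq_succ_of_ne_zero fun h0 => by
      have := Nat.find_spec hbot
      rw [h0] at this
      exact this htop
  have hn₁ : ∀ x, N n x = ⊤ := by
    by_contra hc
    exact Nat.find_min hbot (by omega) hc
  have hn₂ : ∀ x, N (n + 1) x = ⊥ := by
    refine (hNsub (n + 1)).resolve_right ?_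
    rw [← hn]
    exact Nat.find_spec hbot
  have hzero : ∀ {x y : Q} (α : x ⟶ y) (m : S.obj x), S.map α m = 0 := by
    intro x y α m
    have := hmap n α m (by rw [hn₁ x]; exact Submodule.mem_top)
    rwa [hn₂ y] at this
  have hgen : ∀ x (t : S.obj x), ∃ f : R.Alg a x, S.act (h.part 0 f) s = t := by
    intro x t
    obtain ⟨f, -, hft⟩ := hN 0 x t (by rw [htop x]; exact Submodule.mem_top)
    exact ⟨f, (BoundRep.act_part_zero hzero h f s).trans hft⟩
  refine ⟨hzero, a, fun x hax t => ?_, s, hs, fun t => ?_⟩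
  · obtain ⟨f, rfl⟩ := hgen x t
    rw [h.part_zero_of_ne hax, map_zero, LinearMap.zero_apply]
  · obtain ⟨f, rfl⟩ := hgen a t
    obtain ⟨c, hc⟩ := h.exists_part_zero_eq f
    exact ⟨c, by rw [hc, map_smul, LinearMap.smul_apply, S.act_one]⟩

end PathIdeal

/-- A graded representation of a quiver, in which arrows act with degree one. -/
structure GradedRep (k : Type w) [Field k] (Q : Type u) [Quiver.{v + 1} Q] where
  /-- The vector space at a vertex in a given degree. -/
  obj : ℕ → Q → Type w'
  [addCommGroup : ∀ n x, AddCommGroup (obj n x)]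
  [module : ∀ n x, Module k (obj n x)]
  /-- The action of an arrow. -/
  map : ∀ (n : ℕ) {x y : Q}, (x ⟶ y) → obj n x →ₗ[k] obj (n + 1) y

attribute [instance] GradedRep.addCommGroup GradedRep.module

namespace PathIdeal

variable {k : Type w} [Field k] {Q : Type u} [Quiver.{v + 1} Q] {R : PathIdeal k Q}

/-! ### Morphisms between finite direct sums of projective modules -/

section

variable {m m' : ℕ} {c : Fin m → Q} {c' : Fin m' → Q}

/-- The morphism given by the right multiplication with a matrix over `Λ`. -/
def mulRight (D : ∀ j j', R.Alg (c' j') (c j)) : (R.projSum c).Hom (R.projSum c') where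
  app x := R.projDesc c fun j => ∑ j', R.incl c' j' x ∘ₗ R.mul.flip (D j j')
  naturality {x y} α p := by
    refine LinearMap.congr_fun (f := R.projDesc c _ ∘ₗ (R.projSum c).map α)
      (g := (R.projSum c').map α ∘ₗ R.projDesc c _) (projSum_hom_ext fun j f => ?_) p
    rw [LinearMap.comp_apply, LinearMap.comp_apply, map_incl, projDesc_incl, projDesc_incl,
      LinearMap.sum_apply, LinearMap.sum_apply, map_sum]
    refine Finset.sum_congr rfl fun j' _ => ?_
    rw [LinearMap.comp_apply, LinearMap.comp_apply, map_incl, LinearMap.flip_apply,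
      LinearMap.flip_apply, R.mul_assoc]

theorem mulRight_incl (D : ∀ j j', R.Alg (c' j') (c j)) (x : Q) (j : Fin m) (f : R.Alg (c j) x) :
    (mulRight D).app x (R.incl c j x f) = ∑ j', R.incl c' j' x (R.mul f (D j j')) := by
  refine (projDesc_incl _ j f).trans ?_
  rw [LinearMap.sum_apply]
  rfl

theorem coord_mulRight (D : ∀ j j', R.Alg (c' j') (c j)) (x : Q) (p : (R.projSum c).obj x)
    (j' : Fin m') :
    R.coord c' j' x ((mulRight D).app x p) = ∑ j, R.mul (R.coord c j x p) (D j j') := by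
  conv_lhs => rw [← sum_incl_coord p, map_sum, map_sum]
  refine Finset.sum_congr rfl fun j _ => ?_
  rw [mulRight_incl, map_sum, Finset.sum_eq_single_of_mem j' (Finset.mem_univ _), coord_incl_self]
  exact fun l _ hl => coord_incl_ne hl _

variable {D : ∀ j j', R.Alg (c' j') (c j)} (h : R.IsGraded)

theorem IsGraded.sumPart_zero_mulRight
    (hD₀ : ∀ j j' (x : Q) (f : R.Alg (c j) x), h.part 0 (R.mul f (D j j')) = 0) (x : Q)
    (p : (R.projSum c).obj x) : h.sumPart 0 c' x ((mulRight D).app x p) = 0 := by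
  refine projSum_ext fun j' => ?_
  rw [coord_sumPart, coord_mulRight, map_sum, map_zero]
  exact Finset.sum_eq_zero fun j _ => hD₀ j j' x _

theorem IsGraded.isHomogeneousOfDegreeOne_mulRight
    (hD : ∀ (n : ℕ) j j' (x : Q) (f : R.Alg (c j) x),
      h.part (n + 1) (R.mul f (D j j')) = R.mul (h.part n f) (D j j')) :
    R.IsHomogeneousOfDegreeOne (mulRight D) := by
  intro n x p hp j'
  change R.coord c' j' x ((mulRight D).app x p) ∈ _
  rw [coord_mulRight]
  refine sum_mem fun j _ => ?_
  have hpj : h.part n (R.coord c j x p) = R.coord c j x p := h.part_of_mem (hp j)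
  rw [← hpj, ← hD]
  exact h.part_mem_algDeg _ _

end

end PathIdeal

/-! ### Linear resolutions from exact dual complexes -/

theorem Submodule.mem_of_forall_dual {k V : Type*} [Field k] [AddCommGroup V] [Module k V]
    (W : Submodule k V) {v : V} (hv : ∀ φ : V →ₗ[k] k, (∀ w ∈ W, φ w = 0) → φ v = 0) : v ∈ W := by
  by_contra hvW
  obtain ⟨φ, hφ, hW⟩ := Submodule.exists_le_ker_of_notMem hvW
  exact hφ (hv φ fun w hw => hW hw)

namespace GradedRep

variable {k : Type w} [Field k] {Q : Type u} [Quiver.{v + 1} Q] [Quiver.LocallyFinite Q]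
  (G : GradedRep.{u, v, w, w'} k Q) {R : PathIdeal k Q}

/-- The differential of the complex with terms `∏ₓ Hom(e_z Λ e_x, Gₙ(x))`. -/
def codiff (z : Q) (n : ℕ) (f : ∀ x, R.Alg x z →ₗ[k] G.obj n x) (y : Q) :
    R.Alg y z →ₗ[k] G.obj (n + 1) y :=
  ∑ α : Quiver.Costar y, G.map n α.2 ∘ₗ f α.1 ∘ₗ R.mul.flip (R.arrow α.2)

theorem codiff_apply (z : Q) (n : ℕ) (f : ∀ x, R.Alg x z →ₗ[k] G.obj n x) (y : Q)
    (p : R.Alg y z) :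
    G.codiff z n f y p = ∑ α : Quiver.Costar y, G.map n α.2 (f α.1 (R.mul p (R.arrow α.2))) := by
  rw [codiff, LinearMap.sum_apply]
  rfl

/-- The complexes with terms `∏ₓ Hom(e_z Λ e_x, Gₙ(x))` are exact, up to the elements of `Λ` of
degree zero, and `G` is small enough to define finite direct sums of projective modules. -/
structure IsKoszulDual (h : R.IsGraded) : Prop where
  finiteDimensional : ∀ n x, FiniteDimensional k (G.obj n x)
  finite_nontrivial : ∀ n, {x | Nontrivial (G.obj n x)}.Finite
  codiff_codiff : ∀ (z : Q) n (f : ∀ x, R.Alg x z →ₗ[k] G.obj n x),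
    G.codiff z (n + 1) (G.codiff z n f) = 0
  eq_zero_of_codiff : ∀ (z : Q) (f : ∀ x, R.Alg x z →ₗ[k] G.obj 0 x), G.codiff z 0 f = 0 →
    ∀ x (p : R.Alg x z), h.part 0 p = 0 → f x p = 0
  exists_codiff_eq : ∀ (z : Q) n (f : ∀ x, R.Alg x z →ₗ[k] G.obj (n + 1) x),
    G.codiff z (n + 1) f = 0 → ∃ e : ∀ x, R.Alg x z →ₗ[k] G.obj n x, G.codiff z n e = f

variable {G}

/-- P^{-n} has one summand P_x for each basis vector of Gₙ(x). Its dual at a vertex is the n-th term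
of the complex attached to `G`, so exactness follows by testing on linear forms. Minimality follows
from exactness, since the differentials have image in the radical. -/
theorem IsKoszulDual.hasLinearProjectiveResolution {h : R.IsGraded} (hG : G.IsKoszulDual h) {a : Q}
    (ha : ∀ x, a ≠ x → Subsingleton (G.obj 0 x)) (ha₁ : Module.finrank k (G.obj 0 a) = 1)
    {S : BoundRep.{u, v, w, max u (v + 1) w} R}
    (hS : ∀ {x y : Q} (α : x ⟶ y) (m : S.obj x), S.map α m = 0)
    (hSa : ∀ x, a ≠ x → ∀ t : S.obj x, t = 0) {s : S.obj a} (hs : s ≠ 0)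
    (hSs : ∀ t, ∃ c : k, t = c • s) : R.HasLinearProjectiveResolution S := by
  have := hG.finiteDimensional
  choose m c b ξ hi hii hiii hiv using fun n =>
    exists_finite_family_basis (k := k) (hG.finite_nontrivial n)
  -- Each arrow is weighted by the matrix entry of its action from Gₙ to Gₙ₊₁, so the entries are
  -- homogeneous of degree one.
  let D : ∀ n j j', R.Alg (c n j') (c (n + 1) j) := fun n j j' =>
    ∑ α : c n j' ⟶ c (n + 1) j, ξ (n + 1) j (G.map n α (b n j')) • R.arrow α
  have hD : ∀ n (i : ℕ) j j' (x : Q) (f : R.Alg (c (n + 1) j) x),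
      h.part (i + 1) (R.mul f (D n j j')) = R.mul (h.part i f) (D n j j') := by
    intro n i j j' x f
    simp only [D, map_sum, map_smul, h.part_mul_arrow]
  have hD₀ : ∀ n j j' (x : Q) (f : R.Alg (c (n + 1) j) x), h.part 0 (R.mul f (D n j j')) = 0 := by
    intro n j j' x f
    simp only [D, map_sum, map_smul, h.part_zero_mul_arrow, smul_zero, Finset.sum_const_zero]
  let d : ∀ n, (R.projSum (c (n + 1))).Hom (R.projSum (c n)) := fun n => PathIdeal.mulRight (D n)
  -- This identifies the n-th term of the complex with the dual of P^{-n}(x); by `pair_d` the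
  -- transpose of `d` is the differential.
  let pair : ∀ n x, (∀ y, R.Alg y x →ₗ[k] G.obj n y) → (R.projSum (c n)).obj x →ₗ[k] k :=
    fun n x f => R.projDesc (c n) fun j => ξ n j ∘ₗ f (c n j)
  have pair_incl : ∀ n x f j (p : R.Alg (c n j) x),
      pair n x f (R.incl (c n) j x p) = ξ n j (f (c n j) p) := fun n x f j p =>
    PathIdeal.projDesc_incl _ j p
  have pair_inj : ∀ n x f, pair n x f = 0 → f = 0 := by
    intro n x f hf
    funext y
    refine LinearMap.ext fun p => hi n y (f y p) ?_
    rintro j rfl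
    rw [← pair_incl, hf]
    rfl
  have pair_surj : ∀ n x φ, ∃ f, pair n x f = φ := by
    intro n x φ
    obtain ⟨f, hf⟩ := hii n (fun y => R.Alg y x) fun j => φ ∘ₗ R.incl (c n) j x
    refine ⟨f, PathIdeal.projSum_hom_ext fun j p => ?_⟩
    rw [pair_incl]
    exact LinearMap.congr_fun (hf j) p
  have pair_d : ∀ n x f q, pair n x f ((d n).app x q) = pair (n + 1) x (G.codiff x n f) q := by
    intro n x f q
    refine LinearMap.congr_fun (f := pair n x f ∘ₗ (d n).app x) (PathIdeal.projSum_hom_ext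
      fun j p => ?_) q
    rw [LinearMap.comp_apply, PathIdeal.mulRight_incl, map_sum, pair_incl, G.codiff_apply, map_sum]
    refine Eq.trans ?_ (hiii n (c (n + 1) j) (fun α => ξ (n + 1) j ∘ₗ G.map n α.2)
      fun α => f α.1 (R.mul p (R.arrow α.2))).symm
    refine Finset.sum_congr rfl fun j' _ => ?_
    rw [pair_incl]
    simp only [D, map_sum, map_smul, smul_eq_mul]
    exact Finset.sum_congr rfl fun α _ => mul_comm _ _
  have hdd : ∀ n x q, (d n).app x ((d (n + 1)).app x q) = 0 := by
    intro n x q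
    rw [← Module.forall_dual_apply_eq_zero_iff k]
    intro φ
    obtain ⟨f, rfl⟩ := pair_surj n x φ
    rw [pair_d, pair_d, hG.codiff_codiff]
    refine LinearMap.congr_fun (f := pair (n + 2) x 0) (g := 0)
      (PathIdeal.projSum_hom_ext fun j p => ?_) q
    rw [pair_incl]
    exact map_zero _
  have hex : ∀ n x, Function.Exact ((d (n + 1)).app x) ((d n).app x) := by
    intro n x q
    refine ⟨fun hq => ?_, ?_⟩
    -- A form vanishing on the image is a cocycle, hence a coboundary, and coboundaries vanish on
    -- the kernel of `d n`.
    · refine Submodule.mem_of_forall_dual (LinearMap.range ((d (n + 1)).app x)) fun φ hφ => ?_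
      obtain ⟨f, rfl⟩ := pair_surj _ x φ
      obtain ⟨e, rfl⟩ := hG.exists_codiff_eq x n f (pair_inj _ x _ (LinearMap.ext fun q' => by
        rw [← pair_d]
        exact hφ _ ⟨q', rfl⟩))
      rw [← pair_d, hq, map_zero]
    · rintro ⟨q, rfl⟩
      exact hdd n x q
  have hd_rad : ∀ n x q, (d n).app x q ∈ (R.projSum (c n)).rad x := fun n x q =>
    (h.mem_rad_projSum _ _).2 (h.sumPart_zero_mulRight (hD₀ n) x q)
  obtain ⟨j₀, hj₀, hj⟩ := hiv 0 a ha ha₁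
  subst hj₀
  let ε : (R.projSum (c 0)).Hom S :=
    { app := fun x => S.act.flip s ∘ₗ R.coord (c 0) j₀ x
      naturality := fun {x y} α q => by
        rw [LinearMap.comp_apply, PathIdeal.coord_map, LinearMap.flip_apply, S.act_mul,
          S.act_arrow]
        rfl }
  have hε : ∀ x q, ε.app x q = S.act (R.coord (c 0) j₀ x q) s := fun _ _ => rfl
  have hε_ker : ∀ x q, ε.app x q = 0 ↔ q ∈ (R.projSum (c 0)).rad x := by
    intro x q
    refine ⟨fun hq => ?_, fun hq => ε.app_of_mem_rad hS hq⟩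
    rw [hε, ← BoundRep.act_part_zero hS h] at hq
    rw [h.mem_rad_projSum]
    refine PathIdeal.projSum_ext fun j => ?_
    rw [hj j, PathIdeal.IsGraded.coord_sumPart, map_zero]
    by_cases hx : c 0 j₀ = x
    · subst hx
      obtain ⟨t, ht⟩ := h.exists_part_zero_eq (R.coord (c 0) j₀ _ q)
      rw [ht, map_smul, LinearMap.smul_apply, S.act_one, smul_eq_zero] at hq
      rw [ht, hq.resolve_right hs, zero_smul]
    · exact h.part_zero_of_ne hx _
  refine ⟨m, c, d, ε, fun x t => ?_, fun x q => ?_, hex, fun x q hq => (hε_ker x q).1 hq,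
    fun n x q hq => ?_, fun n => h.isHomogeneousOfDegreeOne_mulRight (hD n)⟩
  · by_cases hx : c 0 j₀ = x
    · subst hx
      obtain ⟨r, rfl⟩ := hSs t
      refine ⟨r • R.incl (c 0) j₀ _ (R.cls (PathSpace.one _)), ?_⟩
      rw [map_smul, hε, PathIdeal.coord_incl_self, S.act_one]
    · exact ⟨0, (map_zero _).trans (hSa x hx t).symm⟩
  · rw [hε_ker]
    refine ⟨fun hq => ?_, ?_⟩
    -- A form vanishing on the image of `d 0` is a cocycle of degree zero, so it vanishes in
    -- positive degree, that is, on the radical.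
    · refine Submodule.mem_of_forall_dual (LinearMap.range ((d 0).app x)) fun φ hφ => ?_
      obtain ⟨f, rfl⟩ := pair_surj _ x φ
      have hf := hG.eq_zero_of_codiff x f (pair_inj _ x _ (LinearMap.ext fun q' => by
        rw [← pair_d]
        exact hφ _ ⟨q', rfl⟩))
      rw [h.mem_rad_projSum] at hq
      rw [← PathIdeal.sum_incl_coord q, map_sum]
      refine Finset.sum_eq_zero fun j _ => ?_
      rw [pair_incl, hf _ _ ?_, map_zero]
      rw [← PathIdeal.IsGraded.coord_sumPart, hq, map_zero]
    · rintro ⟨q, rfl⟩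
      exact hd_rad 0 x q
  · obtain ⟨q', rfl⟩ := (hex n x q).1 hq
    exact hd_rad (n + 1) x q'

end GradedRep

namespace PathIdeal

variable {k : Type w} [Field k] {Q : Type u} [Quiver.{v + 1} Q] (R : PathIdeal k Q)

/-! ### The opposite algebra -/

/-- The canonical anti-isomorphism between the opposite algebra `kQᵒ/Rᵒ` and `kQ/R`. -/
def opEquiv (a b : Qᵒᵖ) : R.op.Alg a b ≃ₗ[k] R.Alg b.unop a.unop :=
  LinearEquiv.ofBijective
    (Submodule.mapQ (R.op.carrier a b) (R.carrier b.unop a.unop) PathSpace.unop fun _ hρ => hρ) (by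
      constructor
      · rw [← LinearMap.ker_eq_bot, LinearMap.ker_eq_bot']
        intro f hf
        obtain ⟨γ, rfl⟩ := Submodule.mkQ_surjective _ f
        refine (Submodule.Quotient.mk_eq_zero _).2 ?_
        exact (Submodule.Quotient.mk_eq_zero (R.carrier b.unop a.unop)).1 hf
      · intro f
        obtain ⟨γ, rfl⟩ := Submodule.mkQ_surjective _ f
        obtain ⟨γ, rfl⟩ := PathSpace.unop_surjective γ
        exact ⟨R.op.cls γ, rfl⟩)

theorem opEquiv_cls {a b : Qᵒᵖ} (γ : PathSpace k a b) :
    R.opEquiv a b (R.op.cls γ) = R.cls (PathSpace.unop γ) := rfl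

theorem opEquiv_mul {a b c : Qᵒᵖ} (f : R.op.Alg b c) (g : R.op.Alg a b) :
    R.opEquiv a c (R.op.mul f g) = R.mul (R.opEquiv a b g) (R.opEquiv b c f) := by
  obtain ⟨γ, rfl⟩ := Submodule.mkQ_surjective _ f
  obtain ⟨δ, rfl⟩ := Submodule.mkQ_surjective _ g
  rw [mul_cls, opEquiv_cls, opEquiv_cls, opEquiv_cls, mul_cls, PathSpace.unop_mul]

theorem opEquiv_arrow {a b : Qᵒᵖ} (α : a ⟶ b) :
    R.opEquiv a b (R.op.arrow α) = R.arrow α.unop := by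
  rw [arrow, opEquiv_cls, PathSpace.arrow, PathSpace.unop, Finsupp.lmapDomain_apply,
    Finsupp.mapDomain_single]
  rfl

variable {R}

theorem IsGraded.op (h : R.IsGraded) : R.op.IsGraded where
  part_mem n a b ρ hρ := by
    change PathSpace.unop (PathSpace.part n ρ) ∈ R.carrier b.unop a.unop
    rw [← PathSpace.part_unop]
    exact h.part_mem n hρ
  part_eq_zero hn _ _ ρ hρ := by
    apply PathSpace.unop_injective
    rw [← PathSpace.part_unop, map_zero]
    exact h.part_eq_zero hn hρ

theorem IsGraded.opEquiv_part (h : R.IsGraded) (n : ℕ) {a b : Qᵒᵖ} (f : R.op.Alg a b) :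
    R.opEquiv a b (h.op.part n f) = h.part n (R.opEquiv a b f) := by
  obtain ⟨γ, rfl⟩ := Submodule.mkQ_surjective _ f
  rw [part_cls, opEquiv_cls, opEquiv_cls, part_cls, PathSpace.part_unop]

theorem IsLocallyFiniteDimensional.op (hfin : R.IsLocallyFiniteDimensional) :
    R.op.IsLocallyFiniteDimensional := fun a b =>
  have := hfin b.unop a.unop
  (R.opEquiv a b).symm.finiteDimensional

variable [Quiver.LocallyFinite Q]

/-! ### Linear resolutions from exactness -/

theorem sum_star_eq_sum_costar_op {M : Type*} [AddCommMonoid M] (s : Q)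
    (F : Quiver.Costar (Opposite.op s) → M) :
    ∑ β : Quiver.Star s, F ⟨Opposite.op β.1, β.2.op⟩ = ∑ α, F α :=
  Fintype.sum_bijective _ ⟨fun β β' h => by
    by_contra hβ
    exact PathSpace.op_mk_ne hβ h, fun α => ⟨⟨α.1.unop, α.2.unop⟩, rfl⟩⟩ _ _ fun _ => rfl

theorem sum_star_op_eq_sum_costar {M : Type*} [AddCommMonoid M] (y : Q)
    (F : Quiver.Costar y → M) :
    ∑ β : Quiver.Star (Opposite.op y), F ⟨β.1.unop, β.2.unop⟩ = ∑ α, F α :=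
  Fintype.sum_bijective _ ⟨fun β β' h => by
    simpa using congrArg (fun α : Quiver.Costar y =>
      (⟨Opposite.op α.1, α.2.op⟩ : Quiver.Star (Opposite.op y))) h,
    fun α => ⟨⟨Opposite.op α.1, α.2.op⟩, rfl⟩⟩ _ _ fun _ => rfl

end PathIdeal

/-! ### Transport of exactness between an algebra and its opposite -/

/-- A graded representation of the opposite of a quiver. -/
abbrev GradedOpRep.unop {k : Type w} [Field k] {Q : Type u} [Quiver.{v + 1} Q]
    (G : GradedOpRep.{u, v, w, w'} k Q) : GradedRep.{u, v, w, w'} k Qᵒᵖ where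
  obj n x := G.obj n x.unop
  map n _ _ α := G.map n α.unop

/-- A graded representation of a quiver, the opposite of its opposite. -/
abbrev GradedOpRep.ofOp {k : Type w} [Field k] {Q : Type u} [Quiver.{v + 1} Q]
    (G : GradedOpRep.{u, v, w, w'} k Qᵒᵖ) : GradedRep.{u, v, w, w'} k Q where
  obj n x := G.obj n (Opposite.op x)
  map n _ _ α := G.map n α.op

namespace PathIdeal

variable {k : Type w} [Field k] {Q : Type u} [Quiver.{v + 1} Q] [Quiver.LocallyFinite Q]
  {R : PathIdeal k Q}

/-- The anti-isomorphism turns left multiplication by arrows starting at a vertex into right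
multiplication by arrows ending there, so the two differentials correspond. -/
theorem codiff_unop_comp_opEquiv (G : GradedOpRep.{u, v, w, w'} k Q) (z : Qᵒᵖ) (n : ℕ)
    (f : ∀ s, R.Alg z.unop s →ₗ[k] G.obj n s) :
    G.unop.codiff z n (fun x => f x.unop ∘ₗ (R.opEquiv x z).toLinearMap) =
      fun x => G.algCodiff z.unop n f x.unop ∘ₗ (R.opEquiv x z).toLinearMap := by
  funext x
  refine LinearMap.ext fun p => ?_
  rw [GradedRep.codiff_apply, LinearMap.comp_apply, GradedOpRep.algCodiff_apply]
  refine (sum_star_eq_sum_costar_op x.unop _).symm.trans (Finset.sum_congr rfl fun β _ => ?_)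
  refine congrArg (fun t => G.map n β.2 (f β.1 t)) ?_
  refine (R.opEquiv_mul _ _).trans ?_
  rw [opEquiv_arrow]
  rfl

theorem codiff_ofOp_comp_opEquiv (G : GradedOpRep.{u, v, w, w'} k Qᵒᵖ) (z : Q) (n : ℕ)
    (f : ∀ s, R.op.Alg (Opposite.op z) s →ₗ[k] G.obj n s) :
    G.ofOp.codiff z n (fun x => f (Opposite.op x) ∘ₗ
        (R.opEquiv (Opposite.op z) (Opposite.op x)).symm.toLinearMap) =
      fun x => G.algCodiff (Opposite.op z) n f (Opposite.op x) ∘ₗ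
        (R.opEquiv (Opposite.op z) (Opposite.op x)).symm.toLinearMap := by
  funext x
  refine LinearMap.ext fun p => ?_
  rw [GradedRep.codiff_apply, LinearMap.comp_apply, GradedOpRep.algCodiff_apply]
  refine (sum_star_op_eq_sum_costar x _).symm.trans (Finset.sum_congr rfl fun β _ => ?_)
  refine congrArg (fun t => G.map n β.2 (f β.1 t)) ?_
  refine (LinearEquiv.symm_apply_eq _).2 ((R.opEquiv_mul _ _).trans ?_).symm
  rw [opEquiv_arrow]
  exact congrArg (fun t => R.mul t _) (LinearEquiv.apply_symm_apply _ _)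

theorem isKoszulDual_unop (h : R.IsGraded) {G : GradedOpRep.{u, v, w, w'} k Q}
    (hG : G.IsQuadraticallyPresented R) (hfd : ∀ n x, FiniteDimensional k (G.obj n x))
    (hnt : ∀ n, {x | Nontrivial (G.obj n x)}.Finite)
    (hex : ∀ (z : Q) (n : ℕ) (φ : ∀ s, R.Alg z s →ₗ[k] G.obj (n + 1) s),
      G.algCodiff z (n + 1) φ = 0 →
        ∃ ψ : ∀ s, R.Alg z s →ₗ[k] G.obj n s, G.algCodiff z n ψ = φ) :
    G.unop.IsKoszulDual h.op := by
  have hsurj : ∀ (z : Qᵒᵖ) (n : ℕ) (f : ∀ x, R.op.Alg x z →ₗ[k] G.unop.obj n x),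
      ∃ g : ∀ s, R.Alg z.unop s →ₗ[k] G.obj n s,
        (fun x => g x.unop ∘ₗ (R.opEquiv x z).toLinearMap) = f := fun z n f =>
    ⟨fun s => f (Opposite.op s) ∘ₗ (R.opEquiv (Opposite.op s) z).symm.toLinearMap, by
      funext x
      exact LinearMap.ext fun p => congrArg (f x) (LinearEquiv.symm_apply_apply _ p)⟩
  have hinj : ∀ (z : Qᵒᵖ) (n : ℕ) (g : ∀ s, R.Alg z.unop s →ₗ[k] G.obj n s),
      (fun x => g x.unop ∘ₗ (R.opEquiv x z).toLinearMap : ∀ x, R.op.Alg x z →ₗ[k] G.unop.obj n x) =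
        0 → g = 0 := by
    intro z n g hg
    funext s
    refine LinearMap.ext fun p => ?_
    obtain ⟨p, rfl⟩ := (R.opEquiv (Opposite.op s) z).surjective p
    exact LinearMap.congr_fun (congrFun hg (Opposite.op s)) p
  refine ⟨fun n x => hfd n x.unop, fun n => ?_, fun z n f => ?_, fun z f hf x p hp => ?_,
    fun z n f hf => ?_⟩
  · exact Set.Finite.preimage (f := Opposite.unop) Opposite.unop_injective.injOn (hnt n)
  · obtain ⟨g, rfl⟩ := hsurj z n f
    rw [codiff_unop_comp_opEquiv, codiff_unop_comp_opEquiv]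
    have := hG.codiff_codiff (R.proj z.unop) n g
    funext x
    refine LinearMap.ext fun p => ?_
    exact LinearMap.congr_fun (congrFun this x.unop) _
  · obtain ⟨g, rfl⟩ := hsurj z 0 f
    rw [codiff_unop_comp_opEquiv] at hf
    refine h.eq_zero_of_codiff hG (hinj z 1 _ hf) x.unop _ ?_
    rw [LinearEquiv.coe_coe, ← h.opEquiv_part, hp, map_zero]
  · obtain ⟨g, rfl⟩ := hsurj z (n + 1) f
    rw [codiff_unop_comp_opEquiv] at hf
    obtain ⟨ψ, rfl⟩ := hex z.unop n g (hinj z _ _ hf)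
    exact ⟨_, codiff_unop_comp_opEquiv G z n ψ⟩

/-- The mirror image of `isKoszulDual_unop`, leading from Λᵒ to Λ itself; no identification of the
double opposite of Λ with Λ is needed. -/
theorem isKoszulDual_ofOp (h : R.IsGraded) {G : GradedOpRep.{u, v, w, w'} k Qᵒᵖ}
    (hG : G.IsQuadraticallyPresented R.op) (hfd : ∀ n x, FiniteDimensional k (G.obj n x))
    (hnt : ∀ n, {x | Nontrivial (G.obj n x)}.Finite)
    (hex : ∀ (z : Qᵒᵖ) (n : ℕ) (φ : ∀ s, R.op.Alg z s →ₗ[k] G.obj (n + 1) s),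
      G.algCodiff z (n + 1) φ = 0 →
        ∃ ψ : ∀ s, R.op.Alg z s →ₗ[k] G.obj n s, G.algCodiff z n ψ = φ) :
    G.ofOp.IsKoszulDual h := by
  have hsurj : ∀ (z : Q) (n : ℕ) (f : ∀ x, R.Alg x z →ₗ[k] G.ofOp.obj n x),
      ∃ g : ∀ s, R.op.Alg (Opposite.op z) s →ₗ[k] G.obj n s,
        (fun x => g (Opposite.op x) ∘ₗ
          (R.opEquiv (Opposite.op z) (Opposite.op x)).symm.toLinearMap) = f := fun z n f =>
    ⟨fun s => f s.unop ∘ₗ (R.opEquiv (Opposite.op z) s).toLinearMap, by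
      funext x
      exact LinearMap.ext fun p => congrArg (f x) (LinearEquiv.apply_symm_apply _ p)⟩
  have hinj : ∀ (z : Q) (n : ℕ) (g : ∀ s, R.op.Alg (Opposite.op z) s →ₗ[k] G.obj n s),
      (fun x => g (Opposite.op x) ∘ₗ
          (R.opEquiv (Opposite.op z) (Opposite.op x)).symm.toLinearMap :
        ∀ x, R.Alg x z →ₗ[k] G.ofOp.obj n x) = 0 → g = 0 := by
    intro z n g hg
    funext s
    refine LinearMap.ext fun p => ?_
    obtain ⟨p, rfl⟩ := (R.opEquiv (Opposite.op z) s).symm.surjective p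
    exact LinearMap.congr_fun (congrFun hg s.unop) p
  refine ⟨fun n x => hfd n _, fun n => ?_, fun z n f => ?_, fun z f hf x p hp => ?_,
    fun z n f hf => ?_⟩
  · exact Set.Finite.preimage (f := Opposite.op) Opposite.op_injective.injOn (hnt n)
  · obtain ⟨g, rfl⟩ := hsurj z n f
    rw [codiff_ofOp_comp_opEquiv, codiff_ofOp_comp_opEquiv]
    have := hG.codiff_codiff (R.op.proj (Opposite.op z)) n g
    funext x
    refine LinearMap.ext fun p => ?_
    exact LinearMap.congr_fun (congrFun this (Opposite.op x)) _
  · obtain ⟨g, rfl⟩ := hsurj z 0 f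
    rw [codiff_ofOp_comp_opEquiv] at hf
    refine h.op.eq_zero_of_codiff hG (hinj z 1 _ hf) (Opposite.op x) _ ?_
    apply (R.opEquiv _ _).injective
    rw [h.opEquiv_part, LinearEquiv.coe_coe, LinearEquiv.apply_symm_apply, map_zero]
    exact hp
  · obtain ⟨g, rfl⟩ := hsurj z (n + 1) f
    rw [codiff_ofOp_comp_opEquiv] at hf
    obtain ⟨ψ, rfl⟩ := hex (Opposite.op z) n g (hinj z _ _ hf)
    exact ⟨_, codiff_ofOp_comp_opEquiv G z n ψ⟩

/-! ### The three conditions -/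

theorem isKoszul_op_of_dualExact (h : R.IsGraded) (hfin : R.IsLocallyFiniteDimensional)
    (hR : R.DualExact) : R.op.IsKoszul := by
  intro S hS
  obtain ⟨hmap, a, hSa, s, hs, hSs⟩ := h.op.exists_of_isSimple hfin.op hS
  refine (isKoszulDual_unop h (isQuadraticallyPresented_dualRep h a.unop)
    (fun n x => R.quadraticDual.finiteDimensional_algDeg n _ _)
    (R.finite_nontrivial_dualRep a.unop) (hR a.unop)).hasLinearProjectiveResolution (a := a)
    (fun x hx => ⟨fun f g => ?_⟩) (R.finrank_dualRep_zero a.unop) hmap hSa hs hSs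
  have hx' : a.unop ≠ x.unop := fun hax => hx (Opposite.unop_injective hax)
  exact (dualRep_zero_of_ne hx' f).trans (dualRep_zero_of_ne hx' g).symm

theorem isKoszul_of_dualExact_op (h : R.IsGraded) (hfin : R.IsLocallyFiniteDimensional)
    (hR : R.op.DualExact) : R.IsKoszul := by
  intro S hS
  obtain ⟨hmap, a, hSa, s, hs, hSs⟩ := h.exists_of_isSimple hfin hS
  refine (isKoszulDual_ofOp h (isQuadraticallyPresented_dualRep h.op (Opposite.op a))
    (fun n x => R.op.quadraticDual.finiteDimensional_algDeg n _ _)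
    (R.op.finite_nontrivial_dualRep (Opposite.op a))
    (hR (Opposite.op a))).hasLinearProjectiveResolution (a := a)
    (fun x hx => ⟨fun f g => ?_⟩) (R.op.finrank_dualRep_zero (Opposite.op a)) hmap hSa hs hSs
  have hx' : Opposite.op a ≠ Opposite.op x := fun hax => hx (Opposite.op_injective hax)
  exact (dualRep_zero_of_ne hx' f).trans (dualRep_zero_of_ne hx' g).symm

theorem dualExact_of_isKoszul (h : R.IsGraded) (hfin : R.IsLocallyFiniteDimensional)
    (hR : R.IsKoszul) : R.DualExact := fun b z n φ hφ =>
  h.exists_algCodiff_eq (h.exactAt_of_isKoszul (isQuadraticallyPresented_dualRep h b) hR) hfin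
    z n φ hφ

end PathIdeal

end

/-! ### The equivalence -/

theorem theorem3p12 {k : Type w} [Field k] {Q : Type u} [Quiver.{v + 1} Q]
    [Quiver.LocallyFinite Q] (R : PathIdeal k Q) (hquad : R.IsQuadratic)
    (hfin : R.IsLocallyFiniteDimensional) :
    List.TFAE [R.IsKoszul, R.op.IsKoszul,
      ∀ a : Q, (R.simple a).IsInjectiveCoresolution (R.coresObj a) (R.coresDiff a)] := by
  have h := hquad.isGraded
  rw [PathIdeal.isInjectiveCoresolution_iff h hfin]
  tfae_have 1 → 3 := PathIdeal.dualExact_of_isKoszul h hfin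
  tfae_have 3 → 2 := PathIdeal.isKoszul_op_of_dualExact h hfin
  tfae_have 2 → 1 := fun hK =>
    PathIdeal.isKoszul_of_dualExact_op h hfin (PathIdeal.dualExact_of_isKoszul h.op hfin.op hK)
  tfae_finish
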